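/- Let $p$ be a prime and let $R$ be a commutative ring of characteristic $p$ of one of the following two types: (A) $R$ is a complete local Noetherian ring with residue field $k$ such that $[k:k^p]<\infty$; (B) $R=k\oplus R_1\oplus R_2\oplus\cdots$ is an $\mathbb N$-graded, finitely generated $k$-algebra, where $k$ is a field with $[k:k^p]<\infty$. Let $D(R)$ be the ring of $\mathbb Z$-linear differential operators on $R$. A finite dimensional representation of $D(R)$ is a nonzero $D(R)$-module $W$ that has finite length as an $R$-module. Its dimension is $\dim_k W$, where in case (A) this means the length of $W$ over $R$ (equivalently, the dimension of $W$ over any copy of $k$ contained in $R$). For $e\ge 0$ let ${}^eR$ be the $R$-module with underlying group $R$ and action $r\cdot x=r^{p^e}x$; in case (B) it is $\mathbb Q$-graded by $({}^eR)_\alpha=R_{p^e\alpha}$. In case (B), all $R$-modules ${}^eR$, direct summands and endomorphisms are graded (endomorphisms preserve degree), and isomorphism of summands is meant up to a shift of degree. Then ${}^eR$ is a finite direct sum of indecomposable modules. For an indecomposable summand $M$ let $m(e,M,R)$ be the number of summands isomorphic to $M$ in such a decomposition of ${}^eR$, and let $d(M)$ be the dimension over $k$ of $\operatorname{End}(M)/\operatorname{rad}\operatorname{End}(M)$,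 where $k$ acts through the $R$-module structure of $M$. Then the minimal dimension of a finite dimensional $D(R)$-representation (taken to be $\infty$ if there is none) equals $$u=\sup_{e\ge 0}\ \min_{M\mid {}^eR}\ \frac{d(M)\,m(e,M,R)}{[k:k^{p^e}]},$$ where $M$ ranges over the indecomposable summands of ${}^eR$. In particular, $D(R)$ has no finite dimensional representation if and only if $u=\infty$. If $k$ is perfect, then $[k:k^{p^e}]=1$ and $$u=\sup_{e\ge 0}\ \min_{M\mid {}^eR}\ d(M)\,m(e,M,R).$$ -/

import Mathlib

open scoped ENNReal

universe u v

/-! ### Rings of differential operators -/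

/-- `IsDiffOp k R n θ`: the `k`-linear map `θ : R → R` is a differential operator of order at
most `n`. Order `≤ 0` means `R`-linear; order `≤ n + 1` means that all commutators `[r, θ]`
have order `≤ n`. -/
def IsDiffOp (k R : Type*) [CommRing k] [CommRing R] [Algebra k R] :
    ℕ → Module.End k R → Prop
  | 0, θ => ∀ r x : R, θ (r * x) = r * θ x
  | n + 1, θ => ∀ r : R,
      IsDiffOp k R n (LinearMap.mulLeft k r * θ - θ * LinearMap.mulLeft k r)

section DiffOp

variable {k R : Type*} [CommRing k] [CommRing R] [Algebra k R]

lemma IsDiffOp.succ {n : ℕ} {θ : Module.End k R} (h : IsDiffOp k R n θ) :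
    IsDiffOp k R (n + 1) θ := by
  induction n generalizing θ with
  | zero =>
    intro r s x
    have h1 := h
    simp only [IsDiffOp] at h1
    simp [h1]
  | succ n ih => exact fun r => ih (h r)

lemma IsDiffOp.mono {m n : ℕ} (hmn : m ≤ n) {θ : Module.End k R} (h : IsDiffOp k R m θ) :
    IsDiffOp k R n θ := by
  induction hmn with
  | refl => exact h
  | step _ ih => exact ih.succ

lemma IsDiffOp.zero_mem (n : ℕ) : IsDiffOp k R n 0 := by
  refine IsDiffOp.mono (Nat.zero_le n) ?_
  intro r x
  simp

lemma IsDiffOp.add {n : ℕ} {θ φ : Module.End k R} (h : IsDiffOp k R n θ)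
    (h' : IsDiffOp k R n φ) : IsDiffOp k R n (θ + φ) := by
  induction n generalizing θ φ with
  | zero =>
    intro r x
    simp only [IsDiffOp] at h h'
    simp [h, h', mul_add]
  | succ n ih =>
    intro r
    have := ih (h r) (h' r)
    convert this using 1
    rw [mul_add, add_mul]
    abel

lemma IsDiffOp.neg {n : ℕ} {θ : Module.End k R} (h : IsDiffOp k R n θ) :
    IsDiffOp k R n (-θ) := by
  induction n generalizing θ with
  | zero =>
    intro r x
    simp only [IsDiffOp] at h
    simp [h]
  | succ n ih =>
    intro r
    have := ih (h r)
    convert this using 1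
    ext x
    simp
    ring

lemma IsDiffOp.mul_zero_zero {θ φ : Module.End k R} (h : IsDiffOp k R 0 θ)
    (h' : IsDiffOp k R 0 φ) : IsDiffOp k R 0 (θ * φ) := by
  intro r x
  simp only [IsDiffOp] at h h'
  simp [h, h']

lemma IsDiffOp.mul_aux (N : ℕ) : ∀ (m n : ℕ), m + n = N → ∀ {θ φ : Module.End k R},
    IsDiffOp k R m θ → IsDiffOp k R n φ → IsDiffOp k R N (θ * φ) := by
  induction N with
  | zero =>
    intro m n hmn θ φ h h'
    obtain ⟨rfl, rfl⟩ : m = 0 ∧ n = 0 := by omega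
    exact h.mul_zero_zero h'
  | succ N ih =>
    intro m n hmn θ φ h h' r
    have hcomm0 : ∀ {ψ : Module.End k R}, IsDiffOp k R 0 ψ →
        LinearMap.mulLeft k r * ψ - ψ * LinearMap.mulLeft k r = 0 := by
      intro ψ hψ
      ext x
      simp only [IsDiffOp] at hψ
      simp [hψ]
    have e : LinearMap.mulLeft k r * (θ * φ) - θ * φ * LinearMap.mulLeft k r
        = (LinearMap.mulLeft k r * θ - θ * LinearMap.mulLeft k r) * φ
          + θ * (LinearMap.mulLeft k r * φ - φ * LinearMap.mulLeft k r) := by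
      simp only [sub_mul, mul_sub, mul_assoc]
      abel
    rw [e]
    refine IsDiffOp.add ?_ ?_
    · cases m with
      | zero => rw [hcomm0 h, zero_mul]; exact IsDiffOp.zero_mem N
      | succ m => exact ih m n (by omega) (h r) h'
    · cases n with
      | zero => rw [hcomm0 h', mul_zero]; exact IsDiffOp.zero_mem N
      | succ n => exact ih m n (by omega) h (h' r)

end DiffOp

/-- The ring `D_k(R)` of `k`-linear differential operators on `R`. -/
def diffOps (k R : Type*) [CommRing k] [CommRing R] [Algebra k R] :
    Subring (Module.End k R) where
  carrier := {θ | ∃ n, IsDiffOp k R n θ}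
  zero_mem' := ⟨0, IsDiffOp.zero_mem 0⟩
  one_mem' := ⟨0, fun r x => rfl⟩
  add_mem' := by
    rintro θ φ ⟨m, hm⟩ ⟨n, hn⟩
    exact ⟨max m n, (hm.mono (le_max_left m n)).add (hn.mono (le_max_right m n))⟩
  mul_mem' := by
    rintro θ φ ⟨m, hm⟩ ⟨n, hn⟩
    exact ⟨m + n, IsDiffOp.mul_aux (m + n) m n rfl hm hn⟩
  neg_mem' := by
    rintro θ ⟨m, hm⟩
    exact ⟨m, hm.neg⟩

/-- `D(R) = D_ℤ(R)`. -/
abbrev DZ (R : Type*) [CommRing R] : Type _ := diffOps ℤ R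

/-- The inclusion `R → D(R)` sending `r` to multiplication by `r`. -/
def toDZ (R : Type*) [CommRing R] : R →+* DZ R where
  toFun r := ⟨LinearMap.mulLeft ℤ r, 0, fun s x => by simp [mul_left_comm]⟩
  map_one' := by ext; simp
  map_mul' r s := by ext; simp
  map_zero' := by ext; simp
  map_add' r s := by ext; simp [add_mul]

/-! ### Finite dimensional representations of `D(R)` -/

/-- A `D(R)`-module is a finite dimensional representation if it has finite length as an
`R`-module. -/
def IsFiniteDimRep (R W : Type*) [CommRing R] [AddCommGroup W] [Module (DZ R) W] : Prop :=
  letI : Module R W := Module.compHom W (toDZ R)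
  IsFiniteLength R W

/-- The length of a `D(R)`-module `W` over `R`. For `R` local this is the dimension of `W` over
any copy in `R` of the residue field. -/
noncomputable def repLength (R W : Type*) [CommRing R] [AddCommGroup W] [Module (DZ R) W] : ℕ∞ :=
  letI : Module R W := Module.compHom W (toDZ R)
  Module.length R W

/-- The dimension over a field `k` of a `D(R)`-module `W`, for a `k`-algebra `R`; the field acts
through `k → R → D(R)`. -/
noncomputable def repFinrank (k R W : Type*) [Field k] [CommRing R] [Algebra k R]
    [AddCommGroup W] [Module (DZ R) W] : ℕ :=
  letI : Module k W := Module.compHom W ((toDZ R).comp (algebraMap k R))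
  Module.finrank k W

/-- `D(R)` has a (nonzero) finite dimensional representation. -/
def HasFiniteDimRep (R : Type u) [CommRing R] : Prop :=
  ∃ (W : Type u) (_ : AddCommGroup W) (_ : Module (DZ R) W), Nontrivial W ∧ IsFiniteDimRep R W

/-- The minimal dimension of a nonzero finite dimensional `D(R)`-representation for a local ring
`R` containing its residue field; it is `⊤` if there is none. -/
noncomputable def minRepDimLocal (R : Type u) [CommRing R] : ℕ∞ :=
  sInf {n : ℕ∞ | ∃ (W : Type u) (_ : AddCommGroup W) (_ : Module (DZ R) W),
    Nontrivial W ∧ IsFiniteDimRep R W ∧ n = repLength R W}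

/-- The minimal dimension over `k` of a nonzero finite dimensional `D(R)`-representation for a
`k`-algebra `R`; it is `⊤` if there is none. -/
noncomputable def minRepDimOver (k : Type v) (R : Type u) [Field k] [CommRing R]
    [Algebra k R] : ℕ∞ :=
  sInf {n : ℕ∞ | ∃ (W : Type u) (_ : AddCommGroup W) (_ : Module (DZ R) W),
    Nontrivial W ∧ IsFiniteDimRep R W ∧ n = (repFinrank k R W : ℕ∞)}

/-! ### The modules `ᵉM` -/

/-- `ᵉM`: the abelian group `M`, with scalars acting through the `e`-th iterate of Frobenius. -/
def FrobTwist (_p _e : ℕ) (M : Type*) : Type _ := M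

namespace FrobTwist

variable (p e : ℕ)

instance (M : Type*) [AddCommGroup M] : AddCommGroup (FrobTwist p e M) :=
  inferInstanceAs (AddCommGroup M)

/-- The identity map `ᵉM → M`. -/
def toBase (M : Type*) [AddCommGroup M] : FrobTwist p e M ≃+ M := AddEquiv.refl M

/-- `a • x = a ^ (p ^ e) x`. -/
instance (A M : Type*) [CommRing A] [ExpChar A p] [AddCommGroup M] [Module A M] :
    Module A (FrobTwist p e M) :=
  Module.compHom M (iterateFrobenius A p e)

lemma smul_def {A M : Type*} [CommRing A] [ExpChar A p] [AddCommGroup M] [Module A M]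
    (a : A) (x : FrobTwist p e M) :
    toBase p e M (a • x) = a ^ p ^ e • toBase p e M x := rfl

instance (k A : Type*) [CommRing k] [CommRing A] [ExpChar k p] [ExpChar A p] [Algebra k A] :
    IsScalarTower k A (FrobTwist p e A) where
  smul_assoc c r x := (toBase p e A).injective (by
    simp only [smul_def, smul_eq_mul, smul_pow, smul_mul_assoc])

end FrobTwist

/-! ### Decompositions into indecomposable modules -/

/-- A nonzero module that is not a direct sum of two nonzero submodules. -/
def IsIndecomposableModule (R M : Type*) [CommRing R] [AddCommGroup M] [Module R M] : Prop :=
  Nontrivial M ∧ ∀ A B : Submodule R M, IsCompl A B → A = ⊥ ∨ B = ⊥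

/-- `d(M) = dim End(M) / rad End(M)` for a module over a local ring `R`. The dimension over the
residue field is the length over `R`. -/
noncomputable def endResidueLength (R M : Type*) [CommRing R] [AddCommGroup M] [Module R M] : ℕ∞ :=
  Module.length R (Module.End R M ⧸ Ring.jacobson (Module.End R M))

/-- A decomposition `X = M₁ ⊕ ⋯ ⊕ Mₙ` into indecomposable modules. -/
structure IndecDecomposition (R X : Type*) [CommRing R] [AddCommGroup X] [Module R X] where
  n : ℕ
  summand : Fin n → Submodule R X
  isInternal : DirectSum.IsInternal summand
  indecomposable : ∀ i, IsIndecomposableModule R (summand i)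

/-- The multiplicity of `Mᵢ` in `X = M₁ ⊕ ⋯ ⊕ Mₙ`: the number of `j` with `Mⱼ ≅ Mᵢ`. -/
noncomputable def IndecDecomposition.mult {R X : Type*} [CommRing R] [AddCommGroup X]
    [Module R X] (D : IndecDecomposition R X) (i : Fin D.n) : ℕ :=
  Nat.card {j : Fin D.n // Nonempty (D.summand j ≃ₗ[R] D.summand i)}

/-- The minimum of `d(Mᵢ)` times the multiplicity of `Mᵢ`, over all summands `Mᵢ`. -/
noncomputable def IndecDecomposition.minDim {R X : Type*} [CommRing R] [AddCommGroup X]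
    [Module R X] (D : IndecDecomposition R X) : ℕ∞ :=
  ⨅ i : Fin D.n, endResidueLength R (D.summand i) * (D.mult i : ℕ∞)

/-! ### The graded case

Here `R` is a `k`-algebra and `X` is an `R`-module graded by `gr : ℚ → Submodule k X`. -/

section Graded

variable {k R X : Type*} [Field k] [CommRing R] [Algebra k R] [AddCommGroup X] [Module R X]
  [Module k X] [IsScalarTower k R X] (gr : ℚ → Submodule k X)

/-- `N` is a graded submodule: it is spanned by its homogeneous elements. -/
def IsGradedSubmodule (N : Submodule R X) : Prop :=
  N.restrictScalars k = ⨆ α : ℚ, N.restrictScalars k ⊓ gr α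

/-- A nonzero graded submodule that is not a direct sum of two nonzero graded submodules. -/
def IsGradedIndecomposable (N : Submodule R X) : Prop :=
  IsGradedSubmodule gr N ∧ N ≠ ⊥ ∧
    ∀ A B : Submodule R X, IsGradedSubmodule gr A → IsGradedSubmodule gr B →
      A ⊔ B = N → A ⊓ B = ⊥ → A = ⊥ ∨ B = ⊥

/-- `N ≅ N'` up to a shift of degree: there are a rational `δ` and an `R`-linear bijection
`N → N'` that sends `N_α` onto `N'_{α + δ}` for all `α`. -/
def GradedIsoUpToShift (N N' : Submodule R X) : Prop :=
  ∃ (δ : ℚ) (f : N ≃ₗ[R] N'), ∀ (α : ℚ) (x : N), (x : X) ∈ gr α ↔ (f x : X) ∈ gr (α + δ)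

/-- The `k`-algebra of degree preserving `R`-linear endomorphisms of `N`. -/
def gradedEnd (N : Submodule R X) : Subalgebra k (Module.End R N) where
  carrier := {f | ∀ (α : ℚ) (x : N), (x : X) ∈ gr α → ((f x : N) : X) ∈ gr α}
  mul_mem' := fun hf hg α x hx => hf α _ (hg α x hx)
  add_mem' := fun hf hg α x hx => (gr α).add_mem (hf α x hx) (hg α x hx)
  algebraMap_mem' := fun c α _ hx => (gr α).smul_mem c hx

/-- `d(N) = dim_k End(N) / rad End(N)`, where `End(N)` is the ring of degree preserving
endomorphisms. -/
noncomputable def gradedEndResidueDim (N : Submodule R X) : ℕ :=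
  Module.finrank k (gradedEnd gr N ⧸ Ring.jacobson (gradedEnd gr N))

/-- A decomposition `X = M₁ ⊕ ⋯ ⊕ Mₙ` into indecomposable graded submodules. -/
structure GradedIndecDecomposition where
  n : ℕ
  summand : Fin n → Submodule R X
  isInternal : DirectSum.IsInternal summand
  indecomposable : ∀ i, IsGradedIndecomposable gr (summand i)

/-- The multiplicity of `Mᵢ` in `X = M₁ ⊕ ⋯ ⊕ Mₙ`: the number of `j` such that `Mⱼ` and `Mᵢ`
are isomorphic up to a shift of degree. -/
noncomputable def GradedIndecDecomposition.mult {gr : ℚ → Submodule k X}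
    (D : GradedIndecDecomposition (R := R) gr) (i : Fin D.n) : ℕ :=
  Nat.card {j : Fin D.n // GradedIsoUpToShift gr (D.summand j) (D.summand i)}

/-- The minimum of `d(Mᵢ)` times the multiplicity of `Mᵢ`, over all summands `Mᵢ`. -/
noncomputable def GradedIndecDecomposition.minDim {gr : ℚ → Submodule k X}
    (D : GradedIndecDecomposition (R := R) gr) : ℕ∞ :=
  ⨅ i : Fin D.n, ((gradedEndResidueDim gr (D.summand i) : ℕ∞) * (D.mult i : ℕ∞))

end Graded

/-- The grading of `ᵉR` for a graded ring `R`: `(ᵉR)_α = R_{p ^ e * α}`, which is zero unless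
`p ^ e * α` is a natural number. -/
def frobGrading (p e : ℕ) {k R : Type*} [Field k] [CommRing R] [Algebra k R] [ExpChar k p]
    (𝒜 : ℕ → Submodule k R) (α : ℚ) : Submodule k (FrobTwist p e R) :=
  ⨆ (n : ℕ) (_ : (n : ℚ) = (p : ℚ) ^ e * α),
    { carrier := {x | FrobTwist.toBase p e R x ∈ 𝒜 n}
      add_mem' := fun hx hy => (𝒜 n).add_mem hx hy
      zero_mem' := (𝒜 n).zero_mem
      smul_mem' := fun c _ hx => (𝒜 n).smul_mem (c ^ p ^ e) hx }

/-- The degree `[k : k ^ (p ^ e)]`. -/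
noncomputable def frobDegree (p e : ℕ) (k : Type*) [Field k] [ExpChar k p] : ℕ :=
  Module.finrank (iterateFrobenius k p e).fieldRange k

/-! In characteristic `p` one has `ad(r) ^ (p ^ e) = ad(r ^ (p ^ e))`, so every differential
operator commutes with all `p ^ e`-th powers once `e` is large. Conversely, as `R` is finite over `R
^ (p ^ e)`, all `R ^ (p ^ e)`-linear maps are differential operators. Hence `D(R)` is the increasing
union of the rings `End_R(ᵉR)` (`exists_mem_frobLevel`, `endEquivFrobLevel`). The coefficients act
on a `D(R)`-module `W` in two ways: through `R → D(R)`, and through the algebra structure of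
`End_R(ᵉR)`, which is the first action composed with Frobenius `e` times. Lengths for the second are
`[k : k ^ (p ^ e)]` times lengths for the first; this is the denominator in the formula.

Lower bound. The projections onto the summands `Mᵢ` of `ᵉR` split any nonzero `End(ᵉR)`-module into
pieces `εᵢW`. On a nonzero piece a local ring with residue division ring of length `d(Mᵢ)` acts, so
the piece has length at least `d(Mᵢ)`, and isomorphic summands give equally long pieces. Therefore
the length is at least `d(Mᵢ)` times the multiplicity of some `Mᵢ` (`exists_mul_length_residue_le`).

Upper bound. For a single `e` the bound is attained by column vectors over the residue division ring
of `Mᵢ` (`exists_module_of_residue`). These modules live at different levels, and a compactness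
argument glues them (`FiltrationData.exists_of_forall_good`). Present modules as cyclic quotients by
left ideals and take the least length bound that works at all levels. Far enough out, quotients
satisfying it have exactly this length at every level and are simple, with finitely many isomorphism
classes on each level. By the pigeonhole principle one chooses left ideals that restrict to each
other. As all quotients have the same length, their union gives a `D(R)`-module of that length.
`minimal_length_eq` combines both bounds.

In the complete case `End(Mᵢ)` is local. In the graded case only the ring of degree preserving
endomorphisms need be local; the class of the degree zero component modulo its radical is
nevertheless multiplicative on all of `End(Mᵢ)` (`IsGradingProj.residue_mul`), because an
endomorphism of negative degree of a module bounded below cannot be injective. -/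

/-! ### Differential operators as Frobenius-linear endomorphisms -/

section DiffOpFrobenius

set_option linter.unusedSectionVars false

variable (p : ℕ) [Fact p.Prime] (R : Type*) [CommRing R] [CharP R p]

/-- The subring of those `θ ∈ D(R)` that commute with all `p ^ e`-th powers in `R`. -/
def frobLevel (e : ℕ) : Subring (DZ R) where
  carrier := {θ | ∀ r x : R, θ.1 (r ^ p ^ e * x) = r ^ p ^ e * θ.1 x}
  mul_mem' {a b} ha hb r x := by
    change a.1 (b.1 _) = _ * a.1 (b.1 x)
    rw [hb, ha]
  one_mem' r x := rfl
  add_mem' {a b} ha hb r x := by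
    change a.1 _ + b.1 _ = _ * (a.1 x + b.1 x)
    rw [hb, ha, mul_add]
  zero_mem' r x := (mul_zero _).symm
  neg_mem' {a} ha r x := by
    change - a.1 _ = _ * (- a.1 x)
    rw [ha, mul_neg]

variable {p R}

lemma frobLevel_mono : Monotone (frobLevel p R) := by
  intro e f hef θ hθ r x
  obtain ⟨d, rfl⟩ := Nat.exists_eq_add_of_le hef
  rw [Nat.add_comm, pow_add, pow_mul]
  exact hθ _ _

lemma toDZ_mem_frobLevel (e : ℕ) (r : R) : toDZ R r ∈ frobLevel p R e :=
  fun _ _ => mul_left_comm _ _ _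

/-- The commutator with `r` is written as left minus right multiplication because these two commute,
which makes the characteristic `p` binomial formula available. -/
lemma IsDiffOp.ad_pow_eq_zero {n : ℕ} {θ : Module.End ℤ R} (h : IsDiffOp ℤ R n θ) (r : R) :
    ((LinearMap.mulLeft ℤ (LinearMap.mulLeft ℤ r) - LinearMap.mulRight ℤ (LinearMap.mulLeft ℤ r)) ^
      (n + 1)) θ = 0 := by
  induction n generalizing θ with
  | zero =>
    ext x
    simp only [IsDiffOp] at h
    simp [h]
  | succ n ih =>
    rw [pow_succ, Module.End.mul_apply]
    exact ih (h r)

/-- Once `p ^ e > n + 1`, where `n` bounds the order of `θ`, the operator `ad(r) ^ (p ^ e) = ad(r ^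
(p ^ e))` kills `θ`. The choice of `e` does not depend on `r`. -/
lemma exists_mem_frobLevel (θ : DZ R) : ∃ e, θ ∈ frobLevel p R e := by
  obtain ⟨θ, n, hn⟩ := θ
  have : Nontrivial R := CharP.nontrivial_of_char_ne_one (R := R) (Fact.out : p.Prime).ne_one
  obtain ⟨e, he⟩ := pow_unbounded_of_one_lt (n + 1) (Fact.out : p.Prime).one_lt
  refine ⟨e, fun r x => ?_⟩
  have h0 := hn.ad_pow_eq_zero r
  obtain ⟨d, hd⟩ := Nat.exists_eq_add_of_le he.le
  have : CharP (Module.End ℤ (Module.End ℤ R)) p := by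
    rw [CharP.charP_iff_prime_eq_zero Fact.out, ← nsmul_one]
    ext θ x
    simp
  have h1 : ((LinearMap.mulLeft ℤ (LinearMap.mulLeft ℤ r) -
      LinearMap.mulRight ℤ (LinearMap.mulLeft ℤ r)) ^ p ^ e) θ = 0 := by
    rw [hd, add_comm, pow_add, Module.End.mul_apply, h0, map_zero]
  rw [sub_pow_char_pow_of_commute _ _ (LinearMap.commute_mulLeft_right _ _),
    LinearMap.pow_mulLeft, LinearMap.pow_mulRight, LinearMap.pow_mulLeft] at h1
  have := LinearMap.congr_fun h1 x
  exact (sub_eq_zero.1 (by simpa using this)).symm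

open TensorProduct in
/-- Additive endomorphisms that commute with `A` are differential operators if the ideal of the
diagonal of `R` over `A` is nilpotent. -/
lemma isDiffOp_of_ideal_pow {A R : Type*} [CommRing A] [CommRing R] [Algebra A R]
    (Φ : R ⊗[A] R →ₐ[A] Module.End A (Module.End A R))
    (hΦ : ∀ a b θ x, Φ (a ⊗ₜ b) θ x = a * θ (b * x)) (n : ℕ) (θ : Module.End A R)
    (h : ∀ t ∈ (KaehlerDifferential.ideal A R) ^ (n + 1), Φ t θ = 0) :
    IsDiffOp ℤ R n (θ.restrictScalars ℤ) := by
  induction n generalizing θ with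
  | zero =>
    intro r x
    have := LinearMap.congr_fun (h _ ((zero_add 1).symm ▸
        (pow_one (KaehlerDifferential.ideal A R)).symm
      ▸ KaehlerDifferential.one_smul_sub_smul_one_mem_ideal A r)) x
    simpa [hΦ, sub_eq_zero] using this
  | succ n ih =>
    intro r
    -- Acting by `r ⊗ 1 - 1 ⊗ r` replaces `θ` by its commutator with `r` and uses up one factor of
    -- the diagonal ideal.
    have := ih (Φ (r ⊗ₜ 1 - 1 ⊗ₜ r) θ) ?_
    · convert this using 1
      ext x
      simp [hΦ]
    · intro t ht
      rw [← Module.End.mul_apply, ← map_mul]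
      refine h _ ?_
      rw [pow_succ]
      refine Ideal.mul_mem_mul ht ?_
      rw [← neg_sub]
      exact neg_mem (KaehlerDifferential.one_smul_sub_smul_one_mem_ideal A r)

open TensorProduct in
/-- `a ⊗ b` acts on `End_A(R)` by `θ ↦ a θ b`. -/
noncomputable def tensorEndAction (A R : Type*) [CommRing A] [CommRing R] [Algebra A R] :
    R ⊗[A] R →ₐ[A] Module.End A (Module.End A R) :=
  Algebra.TensorProduct.lift
    ((Algebra.lmul A (Module.End A R)).comp (Algebra.lmul A R))
    (AlgHom.ofLinearMap ((LinearMap.mul A (Module.End A R)).flip.comp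
        (Algebra.lmul A R).toLinearMap)
      (by ext; simp) (fun a b => by ext; simp [mul_left_comm, mul_assoc]))
    (fun _ _ => (commute_iff_eq _ _).2 (by ext; rfl))

lemma tensorEndAction_tmul {A R : Type*} [CommRing A] [CommRing R] [Algebra A R] (a b : R)
    (θ : Module.End A R) (x : R) : tensorEndAction A R (a ⊗ₜ b) θ x = a * θ (b * x) := by
  rw [tensorEndAction, Algebra.TensorProduct.lift_tmul]
  rfl

/-- If `R` is finite over `R ^ (p ^ e)` then all `R ^ (p ^ e)`-linear maps are differential
operators. -/
lemma exists_isDiffOp_of_commute [IsNoetherianRing R] {e : ℕ}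
    (hfin : (iterateFrobenius R p e).Finite)
    (θ : Module.End ℤ R) (h : ∀ r x : R, θ (r ^ p ^ e * x) = r ^ p ^ e * θ x) :
    ∃ n, IsDiffOp ℤ R n θ := by
  let A := (iterateFrobenius R p e).range
  have hAR : Module.Finite A R := by
    exact (RingHom.Finite.of_comp_finite (f := (iterateFrobenius R p e).rangeRestrict)
        (g := A.subtype) hfin)
  let θ' : Module.End A R :=
    { θ with
      map_smul' := by
        rintro ⟨_, r, rfl⟩ x
        exact h r x }
  -- The diagonal ideal is finitely generated, so nilpotency can be tested on its generators. The `p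
  -- ^ e`-th power of `1 ⊗ r - r ⊗ 1` is `1 ⊗ r ^ (p ^ e) - r ^ (p ^ e) ⊗ 1`, which vanishes because
  -- `r ^ (p ^ e)` lies in `A`.
  have hnil : IsNilpotent (KaehlerDifferential.ideal A R) := by
    rw [Ideal.FG.isNilpotent_iff_le_nilradical (KaehlerDifferential.ideal_fg A R),
      ← KaehlerDifferential.span_range_eq_ideal, Ideal.span_le]
    rintro _ ⟨r, rfl⟩
    have hp : ((p : ℕ) : TensorProduct A R R) = 0 := by
      rw [← map_natCast (Algebra.TensorProduct.includeLeft (R := A) (S := A) (A := R) (B := R)),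
        CharP.cast_eq_zero, map_zero]
    refine ⟨p ^ e, ?_⟩
    rcases subsingleton_or_nontrivial (TensorProduct A R R) with _ | _
    · exact Subsingleton.elim _ _
    have : CharP (TensorProduct A R R) p := (CharP.charP_iff_prime_eq_zero Fact.out).2 hp
    rw [sub_pow_char_pow, Algebra.TensorProduct.tmul_pow, Algebra.TensorProduct.tmul_pow,
      one_pow]
    refine sub_eq_zero.2 ?_
    have := TensorProduct.smul_tmul (R := A) (R' := A) (⟨r ^ p ^ e, r, rfl⟩ : A) (1 : R) (1 : R)
    simpa only [Subring.smul_def, smul_eq_mul, mul_one] using this.symm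
  obtain ⟨n, hn⟩ := hnil
  refine ⟨n, isDiffOp_of_ideal_pow (tensorEndAction A R) tensorEndAction_tmul n θ' ?_⟩
  intro t ht
  rw [pow_succ, hn, zero_mul] at ht
  rw [(Submodule.mem_bot _).1 ht]; simp

variable (p R)

/-- `D(R)`-operators that commute with `R ^ (p ^ e)` are the endomorphisms of `ᵉR`. -/
noncomputable def endEquivFrobLevel [IsNoetherianRing R] {e : ℕ}
    (hfin : (iterateFrobenius R p e).Finite) :
    Module.End R (FrobTwist p e R) ≃+* frobLevel p R e where
  toFun f := ⟨⟨(FrobTwist.toBase p e R).toAddMonoidHom.toIntLinearMap ∘ₗ f.restrictScalars ℤ ∘ₗ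
      (FrobTwist.toBase p e R).symm.toAddMonoidHom.toIntLinearMap,
    exists_isDiffOp_of_commute hfin _ fun r x => f.map_smul r x⟩, fun r x => f.map_smul r x⟩
  invFun θ :=
    { toFun := fun x => (FrobTwist.toBase p e R).symm (θ.1.1 (FrobTwist.toBase p e R x))
      map_add' := fun x y => θ.1.1.map_add x y
      map_smul' := fun r x => θ.2 r x }
  left_inv _ := rfl
  right_inv _ := rfl
  map_mul' _ _ := rfl
  map_add' _ _ := rfl

/-- The discrepancy between `r` and `r ^ (p ^ e)` here is the source of the factor `[k : k ^ (p ^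
e)]`. -/
lemma endEquivFrobLevel_algebraMap [IsNoetherianRing R] {e : ℕ}
    (hfin : (iterateFrobenius R p e).Finite) (r : R) :
    (endEquivFrobLevel p R hfin (algebraMap R _ r) : DZ R) = toDZ R (r ^ p ^ e) := rfl

end DiffOpFrobenius

/-! ### Noncommutative local rings and their radical -/

section NoncommutativeLocal

variable {Λ : Type*} [Ring Λ] [IsLocalRing Λ]

lemma isUnit_or_isUnit_one_sub (f : Λ) : IsUnit f ∨ IsUnit (1 - f) :=
  IsLocalRing.isUnit_or_isUnit_of_add_one (by abel)

/-- Since `1 - a * b` kills `a ≠ 0`, it is not a unit; so the idempotent `a * b` is a unit, hence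
equal to `1`. -/
lemma isUnit_right_of_mul_eq_one {a b : Λ} (h : b * a = 1) : IsUnit a := by
  rcases isUnit_or_isUnit_one_sub (a * b) with h1 | h1
  · obtain ⟨c, hc⟩ := h1.exists_right_inv
    refine ⟨⟨a, b, ?_, h⟩, rfl⟩
    have h2 : b * c = b := by
      calc b * c = b * (a * b * c) := by rw [← mul_assoc, ← mul_assoc, h, one_mul]
        _ = b := by rw [hc, mul_one]
    calc a * b = a * (b * c) := by rw [h2]
      _ = 1 := by rw [← mul_assoc, hc]
  · have h2 : (1 - a * b) * a = 0 := by rw [sub_mul, mul_assoc, h, one_mul, mul_one, sub_self]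
    have h3 : a = 0 := by simpa using h1.mul_left_cancel (h2.trans (mul_zero _).symm)
    rw [h3, mul_zero] at h
    exact absurd h zero_ne_one

lemma isUnit_right_of_isUnit_mul {a b : Λ} (h : IsUnit (b * a)) : IsUnit a := by
  obtain ⟨c, hc⟩ := h.exists_left_inv
  exact isUnit_right_of_mul_eq_one (b := c * b) (by rw [mul_assoc, hc])

/-- If a maximal left ideal misses `a`, it contains some `1 - b * a`. This is not a unit, so `b * a`
is one, and then so is `a`. -/
lemma mem_jacobson_of_not_isUnit {a : Λ} (h : ¬ IsUnit a) : a ∈ Ring.jacobson Λ := by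
  rw [Ring.jacobson, Module.jacobson, Submodule.mem_sInf]
  intro M hM
  by_contra ha
  have h1 : (1 : Λ) ∈ M ⊔ Submodule.span Λ {a} := by
    rw [hM.2 _ (left_lt_sup.2 fun h' => ha (h' (Submodule.mem_span_singleton_self a)))]
    trivial
  obtain ⟨i, hi, c, hc, hic⟩ := Submodule.mem_sup.1 h1
  obtain ⟨b, rfl⟩ := Submodule.mem_span_singleton.1 hc
  rcases isUnit_or_isUnit_one_sub (b * a) with h1 | h1
  · exact h (isUnit_right_of_isUnit_mul h1)
  · rw [← hic, smul_eq_mul, add_sub_cancel_right] at h1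
    exact hM.1 (Ideal.eq_top_of_isUnit_mem _ hi h1)

lemma ideal_le_jacobson {I : Ideal Λ} (h : I ≠ ⊤) : I ≤ Ring.jacobson Λ := fun _ hx =>
  mem_jacobson_of_not_isUnit fun hu => h (Ideal.eq_top_of_isUnit_mem _ hx hu)

omit [IsLocalRing Λ] in
lemma length_quotient_ker_le (A V : Type*) [CommRing A] [Algebra A Λ] [AddCommGroup V]
    [Module Λ V] [Module A V] [IsScalarTower A Λ V] (f : Λ →ₗ[Λ] V) :
    Module.length A (Λ ⧸ LinearMap.ker f) ≤ Module.length A V := by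
  let g : (Λ ⧸ LinearMap.ker f) →ₗ[A] V := ((LinearMap.ker f).liftQ f le_rfl).restrictScalars A
  have hg : Function.Injective g := by
    have : Function.Injective ((LinearMap.ker f).liftQ f le_rfl) :=
      LinearMap.ker_eq_bot.1 (Submodule.ker_liftQ_eq_bot _ _ _ le_rfl)
    exact this
  exact Module.length_le_of_injective g hg

/-- The annihilator of a nonzero vector is a proper left ideal, hence lies in the radical; so the
residue ring is a quotient of a cyclic submodule of `V`. -/
lemma length_residue_le (A V : Type*) [CommRing A] [Algebra A Λ] [AddCommGroup V] [Module Λ V]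
    [Module A V] [IsScalarTower A Λ V] [Nontrivial V] :
    Module.length A (Λ ⧸ Ring.jacobson Λ) ≤ Module.length A V := by
  obtain ⟨x, hx⟩ := exists_ne (0 : V)
  have hker : LinearMap.ker (LinearMap.toSpanSingleton Λ V x) ≤ Ring.jacobson Λ :=
    ideal_le_jacobson fun h => hx <| by
      simpa using LinearMap.congr_fun (LinearMap.ker_eq_top.1 h) 1
  refine le_trans ?_ (length_quotient_ker_le A V (LinearMap.toSpanSingleton Λ V x))
  exact Module.length_le_of_surjective ((Submodule.factor hker).restrictScalars A)
    (Submodule.factor_surjective hker)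

end NoncommutativeLocal

/-! ### Idempotents in Henselian pairs -/

section Idempotents

/-- Idempotents lift along the ideal of a Henselian pair. -/
lemma HenselianRing.exists_idempotent_lift {S : Type*} [CommRing S] (I : Ideal S)
    [HenselianRing S I] (a : S) (ha : a * a - a ∈ I) : ∃ e : S, e * e = e ∧ e - a ∈ I := by
  rcases subsingleton_or_nontrivial S with _ | _
  · exact ⟨0, Subsingleton.elim _ _, by simp [Subsingleton.elim a 0]⟩
  obtain ⟨e, he, hea⟩ : ∃ e : S, (Polynomial.X ^ 2 - Polynomial.X : Polynomial S).IsRoot e ∧ e - a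
      ∈ I := by
    -- `2a - 1` is the derivative of `X² - X` at `a`; it is a unit modulo `I` since `(2a - 1)² - 1 =
    -- 4(a² - a)`.
    have h1 : Ideal.Quotient.mk I (2 * a - 1) * Ideal.Quotient.mk I (2 * a - 1) = 1 := by
      rw [← map_mul, ← map_one (Ideal.Quotient.mk I), Ideal.Quotient.eq]
      convert I.mul_mem_left 4 ha using 1
      ring
    have h2 : (Polynomial.X : Polynomial S).degree < (Polynomial.X ^ 2 : Polynomial S).degree := by
      simp
    refine HenselianRing.is_henselian _ ((Polynomial.monic_X_pow 2).sub_of_left h2) a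
      (by simpa [pow_two] using ha) ?_
    simpa [one_add_one_eq_two] using IsUnit.of_mul_eq_one _ h1
  exact ⟨e, by simpa [sub_eq_zero, pow_two] using he, hea⟩

/-- Over an Artinian quotient by the ideal of a Henselian pair, absence of nontrivial idempotents
forces locality. -/
lemma HenselianRing.isUnit_or_isUnit_one_sub {S : Type*} [CommRing S] (I : Ideal S)
    [HenselianRing S I] [IsArtinianRing (S ⧸ I)] (h : ∀ e : S, e * e = e → e = 0 ∨ e = 1) (f : S) :
    IsUnit f ∨ IsUnit (1 - f) := by
  have hloc := isLocalHom_of_le_jacobson_bot I HenselianRing.jac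
  set r := Ideal.Quotient.mk I f with hr
  -- The powers of `r` stabilise, so `r ^ n = r ^ (n + 1) * y`, and then `r ^ n * y ^ n` is
  -- idempotent. Its lift is `0` or `1`, which makes `r` nilpotent or a unit.
  obtain ⟨n, y, hy⟩ := IsArtinian.exists_pow_succ_smul_dvd r (1 : S ⧸ I)
  simp only [smul_eq_mul, mul_one] at hy
  have hy' : ∀ k, r ^ (n + k) * y ^ k = r ^ n := by
    intro k
    induction k with
    | zero => simp
    | succ k ih =>
      calc r ^ (n + (k + 1)) * y ^ (k + 1) = (r ^ (n + 1) * y) * (r ^ k * y ^ k) := by ring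
        _ = r ^ n * (r ^ k * y ^ k) := by rw [← hy]
        _ = r ^ n := by rw [← mul_assoc, ← pow_add, ih]
  have hid : (r ^ n * y ^ n) * (r ^ n * y ^ n) = r ^ n * y ^ n := by
    have := hy' n
    calc _ = (r ^ (n + n) * y ^ n) * y ^ n := by ring
      _ = _ := by rw [this]
  obtain ⟨a, ha⟩ := Ideal.Quotient.mk_surjective (r ^ n * y ^ n)
  obtain ⟨e, he, hea⟩ := HenselianRing.exists_idempotent_lift I a (by
    rw [← Ideal.Quotient.eq_zero_iff_mem, map_sub, map_mul, ha, hid, sub_self])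
  rw [← Ideal.Quotient.eq_zero_iff_mem, map_sub, ha, sub_eq_zero] at hea
  rcases h e he with rfl | rfl
  · right
    refine isUnit_of_map_unit (Ideal.Quotient.mk I) _ ?_
    rw [map_sub, map_one, ← hr]
    refine IsNilpotent.isUnit_one_sub ⟨n, ?_⟩
    rw [map_zero] at hea
    calc r ^ n = r ^ n * (r ^ n * y ^ n) := by rw [← mul_assoc, ← pow_add, hy']
      _ = 0 := by rw [← hea, mul_zero]
  -- For `n = 0` the idempotent is `1` for trivial reasons, and invertibility of `r` comes from
  -- `hy`, which then reads `r * y = 1`.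
  · rcases n with _ | n
    · left
      refine isUnit_of_map_unit (Ideal.Quotient.mk I) _ ?_
      exact IsUnit.of_mul_eq_one y (by simpa using hy)
    · left
      refine isUnit_of_map_unit (Ideal.Quotient.mk I) _ ?_
      refine IsUnit.of_mul_eq_one (r ^ n * y ^ (n + 1)) ?_
      rw [← mul_assoc, ← pow_succ', ← hea, map_one]

end Idempotents

/-! ### Finite modules over complete rings -/

section CompleteModules

/-- For finite `M` the completion of `M` is a quotient of the completion of `R` tensored with `M`,
and elements of the completion of `R` come from `R`. -/
lemma IsPrecomplete.of_finite {R : Type*} [CommRing R] (I : Ideal R) [IsPrecomplete I R]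
    (M : Type*) [AddCommGroup M] [Module R M] [Module.Finite R M] : IsPrecomplete I M := by
  rw [← AdicCompletion.of_surjective_iff]
  intro y
  obtain ⟨t, rfl⟩ := AdicCompletion.ofTensorProduct_surjective_of_finite I M y
  induction t with
  | zero => exact ⟨0, by simp⟩
  | add a b ha hb =>
    obtain ⟨x, hx⟩ := ha
    obtain ⟨x', hx'⟩ := hb
    exact ⟨x + x', by simp [hx, hx']⟩
  | tmul r m =>
    obtain ⟨s, rfl⟩ := AdicCompletion.of_surjective I R r
    refine ⟨s • m, ?_⟩
    rw [AdicCompletion.ofTensorProduct_tmul, map_smul]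
    ext n
    rfl

/-- Nakayama's lemma for a separated module over a complete ring. -/
lemma Module.Finite.of_isAdicComplete {R : Type*} [CommRing R] (I : Ideal R) [IsPrecomplete I R]
    (M : Type*) [AddCommGroup M] [Module R M] [IsHausdorff I M]
    [Module.Finite R (M ⧸ (I • ⊤ : Submodule R M))] : Module.Finite R M := by
  obtain ⟨n, f, hf⟩ := Module.Finite.exists_fin' R (M ⧸ (I • ⊤ : Submodule R M))
  obtain ⟨g, hg⟩ := Module.projective_lifting_property (I • ⊤ : Submodule R M).mkQ f
    (Submodule.mkQ_surjective _)
  have := IsPrecomplete.of_finite I (Fin n → R)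
  exact Module.Finite.of_surjective g
    (surjective_of_mkQ_comp_surjective (I := I) (f := g) (hg ▸ hf))

end CompleteModules

/-! ### Local endomorphism rings -/

section LocalEnd

/-- If the only idempotents in a finite algebra over a complete local ring are trivial, then it
is local. -/
lemma isLocalRing_of_finite_of_isAdicComplete (R Λ : Type*) [CommRing R] [IsLocalRing R]
    [IsNoetherianRing R] [IsAdicComplete (IsLocalRing.maximalIdeal R) R] [Ring Λ] [Nontrivial Λ]
    [Algebra R Λ] [Module.Finite R Λ] (h : ∀ e : Λ, e * e = e → e = 0 ∨ e = 1) :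
    IsLocalRing Λ := by
  have key : ∀ f : Λ, IsUnit f ∨ IsUnit (1 - f) := by
    intro f
    -- The commutative subalgebra `R[f]` is finite over `R`, hence complete for the extended maximal
    -- ideal and Henselian. It inherits the absence of idempotents, and its units are units of `Λ`.
    let S := Algebra.adjoin R {f}
    let _ : CommRing S := { (inferInstance : Ring S) with
      mul_comm := (Algebra.isMulCommutative_adjoin R (s := {f}) (by simp)).is_comm.comm }
    let f' : S := ⟨f, Algebra.subset_adjoin rfl⟩
    have hS : Module.Finite R S := inferInstanceAs (Module.Finite R (Subalgebra.toSubmodule S))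
    let m := IsLocalRing.maximalIdeal R
    have h1 : IsPrecomplete m S := IsPrecomplete.of_finite m S
    have h2 : IsHausdorff m S := inferInstance
    have h3 : IsAdicComplete (m.map (algebraMap R S)) S :=
      { toIsHausdorff := IsHausdorff.map_algebraMap_iff.2 h2
        toIsPrecomplete := IsPrecomplete.map_algebraMap_iff.2 h1 }
    have h4 : IsArtinianRing (S ⧸ m.map (algebraMap R S)) := by
      let _ : Field (R ⧸ m) := Ideal.Quotient.field m
      have : Module.Finite (R ⧸ m) (S ⧸ m.map (algebraMap R S)) :=
        Module.Finite.of_restrictScalars_finite R _ _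
      exact IsArtinianRing.of_finite (R ⧸ m) _
    have h5 : ∀ e : S, e * e = e → e = 0 ∨ e = 1 := by
      intro e he
      rcases h e (congrArg Subtype.val he) with h | h
      · exact Or.inl (Subtype.ext h)
      · exact Or.inr (Subtype.ext h)
    rcases HenselianRing.isUnit_or_isUnit_one_sub (m.map (algebraMap R S)) h5 f' with h | h
    · exact Or.inl (h.map S.val)
    · exact Or.inr (by simpa [f'] using h.map S.val)
  refine ⟨fun {a b} hab => ?_⟩
  rw [← eq_sub_iff_add_eq'] at hab
  exact hab ▸ key a

lemma exists_isCompl_of_idempotent {R M : Type*} [CommRing R] [AddCommGroup M] [Module R M]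
    (h : IsIndecomposableModule R M) (e : Module.End R M) (he : e * e = e) : e = 0 ∨ e = 1 := by
  have hc : IsCompl (LinearMap.range e) (LinearMap.ker e) :=
    LinearMap.IsIdempotentElem.isCompl (f := e) he
  rcases h.2 _ _ hc with h | h
  · exact Or.inl (LinearMap.range_eq_bot.1 h)
  · refine Or.inr (LinearMap.ext fun x => ?_)
    have := LinearMap.ker_eq_bot.1 h (a₁ := e x) (a₂ := x) (LinearMap.congr_fun he x)
    simpa using this

lemma IsIndecomposableModule.isLocalRing_end {R M : Type*} [CommRing R] [IsLocalRing R]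
    [IsNoetherianRing R] [IsAdicComplete (IsLocalRing.maximalIdeal R) R] [AddCommGroup M]
    [Module R M] [Module.Finite R M] (h : IsIndecomposableModule R M) :
    IsLocalRing (Module.End R M) := by
  have := h.1
  exact isLocalRing_of_finite_of_isAdicComplete R _ (exists_isCompl_of_idempotent h)

end LocalEnd

/-! ### Peirce decomposition of a module -/

section Peirce

variable {A E W : Type*} [CommRing A] [Ring E] [Algebra A E] [AddCommGroup W] [Module E W]
  [Module A W] [IsScalarTower A E W]

/-- The summand `εW` of `W` cut out by an idempotent `ε`. -/
def peirceSubmodule (A W : Type*) {E : Type*} [CommRing A] [Ring E] [Algebra A E] [AddCommGroup W]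
    [Module E W] [Module A W] [IsScalarTower A E W] (ε : E) : Submodule A W where
  carrier := {w | ε • w = w}
  add_mem' {a b} (ha : ε • a = a) (hb : ε • b = b) := by simp [ha, hb]
  zero_mem' := smul_zero _
  smul_mem' c x (hx : ε • x = x) := by
    change ε • c • x = c • x
    rw [smul_algebra_smul_comm, hx]

lemma mem_peirceSubmodule {ε : E} {w : W} : w ∈ peirceSubmodule A W ε ↔ ε • w = w := Iff.rfl

/-- `W = ⨁ εᵢW` for a complete system of orthogonal idempotents. -/
def peirceEquiv {ι : Type*} [Fintype ι] [DecidableEq ι] (ε : ι → E)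
    (horth : ∀ i j, ε i * ε j = if i = j then ε i else 0) (hsum : ∑ i, ε i = 1) :
    W ≃ₗ[A] (∀ i, peirceSubmodule A W (ε i)) where
  toFun w i := ⟨ε i • w, by simp [mem_peirceSubmodule, smul_smul, horth]⟩
  map_add' x y := by ext i; simp
  map_smul' a x := by ext i; simp [smul_algebra_smul_comm]
  invFun f := ∑ i, (f i : W)
  left_inv w := by simp [← Finset.sum_smul, hsum]
  right_inv f := by
    ext i
    have h : ∀ j, (f j : W) = ε j • (f j : W) := fun j => (f j).2.symm
    simp only [Finset.smul_sum]
    rw [Finset.sum_eq_single i]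
    · exact (f i).2
    · intro j _ hj
      rw [h j, smul_smul, horth, if_neg hj.symm, zero_smul]
    · simp

lemma length_eq_sum_peirce {ι : Type*} [Fintype ι] [DecidableEq ι] (ε : ι → E)
    (horth : ∀ i j, ε i * ε j = if i = j then ε i else 0) (hsum : ∑ i, ε i = 1) :
    Module.length A W = ∑ i, Module.length A (peirceSubmodule A W (ε i)) := by
  rw [(peirceEquiv (A := A) (W := W) ε horth hsum).length_eq, Module.length_pi_of_fintype]

/-- Multiplication by `a` and by `b` are inverse isomorphisms between `εW` and `ε'W`. This is
applied to the projections onto two isomorphic summands. -/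
lemma length_peirce_eq {ε ε' : E} {a b : E} (ha : ε' * a = a) (hb : ε * b = b) (hab : a * b = ε')
    (hba : b * a = ε) :
    Module.length A (peirceSubmodule A W ε) = Module.length A (peirceSubmodule A W ε') := by
  refine LinearEquiv.length_eq
    { toFun := fun w => ⟨a • (w : W), by rw [mem_peirceSubmodule, smul_smul, ha]⟩
      map_add' := fun x y => by ext; simp
      map_smul' := fun c x => by ext; simp [smul_algebra_smul_comm]
      invFun := fun w => ⟨b • (w : W), by rw [mem_peirceSubmodule, smul_smul, hb]⟩
      left_inv := fun w => Subtype.ext (by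
        change b • a • (w : W) = w
        rw [smul_smul, hba]
        exact w.2)
      right_inv := fun w => Subtype.ext (by
        change a • b • (w : W) = w
        rw [smul_smul, hab]
        exact w.2) }

/-- A local ring acting on the nonzero summand `εW` through the corner `εEε` forces this summand
to be as long as the residue division ring. -/
lemma length_residue_le_peirce {Λ : Type*} [Ring Λ] [IsLocalRing Λ] [Algebra A Λ] {ε : E}
    (κ : Λ →ₗ[A] E) (hκ : ∀ x y, κ (x * y) = κ x * κ y) (hκ1 : κ 1 = ε)
    (hne : peirceSubmodule A W ε ≠ ⊥) :
    Module.length A (Λ ⧸ Ring.jacobson Λ) ≤ Module.length A (peirceSubmodule A W ε) := by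
  have hε : ∀ x, ε * κ x = κ x := fun x => by rw [← hκ1, ← hκ, one_mul]
  let _ : Module Λ (peirceSubmodule A W ε) :=
    { smul := fun x w => ⟨κ x • (w : W), by rw [mem_peirceSubmodule, smul_smul, hε]⟩
      one_smul := fun w => Subtype.ext ((congrArg (· • (w : W)) hκ1).trans w.2)
      mul_smul := fun x y w => Subtype.ext (by
        change κ (x * y) • (w : W) = κ x • κ y • (w : W)
        rw [hκ, mul_smul])
      smul_zero := fun x => Subtype.ext (smul_zero (κ x))
      smul_add := fun x y z => Subtype.ext (smul_add (κ x) (y : W) (z : W))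
      add_smul := fun x y z => Subtype.ext (by
        change κ (x + y) • (z : W) = κ x • (z : W) + κ y • (z : W)
        rw [map_add, add_smul])
      zero_smul := fun z => Subtype.ext (by
        change κ 0 • (z : W) = 0
        rw [map_zero, zero_smul]) }
  have : IsScalarTower A Λ (peirceSubmodule A W ε) := ⟨fun a x w => Subtype.ext (by
    change κ (a • x) • (w : W) = a • κ x • (w : W)
    rw [map_smul, smul_assoc])⟩
  have : Nontrivial (peirceSubmodule A W ε) := Submodule.nontrivial_iff_ne_bot.2 hne
  exact length_residue_le A _

end Peirce

/-! ### Modules over the endomorphism ring of a direct sum -/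

section InternalSum

variable {R X : Type*} [CommRing R] [AddCommGroup X] [Module R X] {n : ℕ}
  {M : Fin n → Submodule R X}

lemma DirectSum.IsInternal.exists_proj (h : DirectSum.IsInternal M) :
    ∃ π : ∀ j, X →ₗ[R] M j, (∀ j (x : M j), π j x = x) ∧
      (∀ j l, l ≠ j → ∀ x : M l, π j x = 0) ∧ ∀ x, ∑ j, (π j x : X) = x := by
  let e := LinearEquiv.ofBijective (DirectSum.coeLinearMap M) h
  have he : ∀ j (x : M j), e.symm x = DirectSum.lof R _ (fun j => M j) j x := fun j x => by
    rw [LinearEquiv.symm_apply_eq]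
    exact (DirectSum.coeLinearMap_lof M j x).symm
  refine ⟨fun j => DirectSum.component R _ (fun j => M j) j ∘ₗ e.symm.toLinearMap, ?_, ?_, ?_⟩
  · intro j x
    simp [he, DirectSum.component.lof_self]
  · intro j l hl x
    simp only [LinearMap.comp_apply, LinearEquiv.coe_coe, he]
    rw [DirectSum.component.of, dif_neg hl]
  · intro x
    obtain ⟨y, rfl⟩ := e.surjective x
    simp only [LinearMap.comp_apply, LinearEquiv.coe_coe, LinearEquiv.symm_apply_apply]
    change _ = DirectSum.coeLinearMap M y
    induction y using DirectSum.induction_on with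
    | zero => simp
    | of j x =>
      change _ = DirectSum.coeLinearMap M (DirectSum.lof R _ _ j x)
      rw [DirectSum.coeLinearMap_lof, Finset.sum_eq_single j]
      · exact congrArg _ (DirectSum.component.lof_self R (M := fun j => M j) j x)
      · intro l _ hl
        change ((DirectSum.component R _ (fun j => M j) l
          (DirectSum.lof R _ (fun j => M j) j x) : M l) : X) = 0
        rw [DirectSum.component.of, dif_neg hl.symm, ZeroMemClass.coe_zero]
      · simp
    | add x y hx hy => simp [Finset.sum_add_distrib, hx, hy]

variable {A : Type*} [CommRing A] [Algebra A R] [Module A X] [IsScalarTower A R X]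
  (h : DirectSum.IsInternal M)

/-- Lower bound for the length of a module over the endomorphism ring of `⨁ Mⱼ`. -/
lemma exists_mul_length_residue_le (h : DirectSum.IsInternal M) (rel : Fin n → Fin n → Prop)
    (hrel : ∀ i j, rel j i → Nonempty (M j ≃ₗ[R] M i))
    (Λ : Fin n → Type*) [∀ i, Ring (Λ i)] [∀ i, IsLocalRing (Λ i)] [∀ i, Algebra A (Λ i)]
    (κ : ∀ i, Λ i →ₐ[A] Module.End R (M i)) (W : Type*) [AddCommGroup W]
    [Module (Module.End R X) W] [Module A W] [IsScalarTower A (Module.End R X) W] [Nontrivial W] :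
    ∃ i, Module.length A (Λ i ⧸ Ring.jacobson (Λ i)) * (Nat.card {j // rel j i} : ℕ∞) ≤
      Module.length A W := by
  classical
  obtain ⟨π, hπ1, hπ2, hπ3⟩ := h.exists_proj
  let ε : Fin n → Module.End R X := fun j => (M j).subtype ∘ₗ π j
  have horth : ∀ i j, ε i * ε j = if i = j then ε i else 0 := by
    intro i j
    ext x
    split_ifs with hij
    · subst hij
      simp [ε, hπ1]
    · simp [ε, hπ2 i j (Ne.symm hij)]
  have hsum : ∑ i, ε i = 1 := by
    ext x
    simp [ε, hπ3]
  have hlen := length_eq_sum_peirce (A := A) (W := W) ε horth hsum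
  -- Any `i` with `εᵢW ≠ 0` will do: the bound only counts pieces isomorphic to this one and
  -- discards the others.
  obtain ⟨i, hi⟩ : ∃ i, peirceSubmodule A W (ε i) ≠ ⊥ := by
    by_contra! hcon
    have : Module.length A W = 0 := by
      rw [hlen]
      exact Finset.sum_eq_zero fun i _ => by rw [hcon i, Module.length_bot]
    exact Module.length_pos.ne' this
  refine ⟨i, ?_⟩
  have hΛ : Module.length A (Λ i ⧸ Ring.jacobson (Λ i)) ≤
      Module.length A (peirceSubmodule A W (ε i)) := by
    refine length_residue_le_peirce (E := Module.End R X)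
      { toFun := fun x => (M i).subtype ∘ₗ κ i x ∘ₗ π i
        map_add' := fun x y => by ext; simp
        map_smul' := fun a x => by ext; simp } ?_ ?_ hi
    · intro x y
      ext z
      simp [hπ1]
    · ext z
      simp [ε]
  have hiso : ∀ j, rel j i → Module.length A (peirceSubmodule A W (ε j)) =
      Module.length A (peirceSubmodule A W (ε i)) := by
    intro j hj
    obtain ⟨f⟩ := hrel i j hj
    refine length_peirce_eq (a := (M i).subtype ∘ₗ f.toLinearMap ∘ₗ π j)
      (b := (M j).subtype ∘ₗ f.symm.toLinearMap ∘ₗ π i) ?_ ?_ ?_ ?_ <;>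
    · ext x
      simp [ε, hπ1]
  calc _ ≤ Module.length A (peirceSubmodule A W (ε i)) * (Nat.card {j // rel j i} : ℕ∞) := by gcongr
    _ = ∑ j with rel j i, Module.length A (peirceSubmodule A W (ε j)) := by
      rw [Finset.sum_congr rfl (fun j hj => hiso j (Finset.mem_filter.1 hj).2), Finset.sum_const,
        nsmul_eq_mul, mul_comm, Nat.card_eq_fintype_card, Fintype.card_subtype]
    _ ≤ _ := by
      rw [hlen]
      exact Finset.sum_le_sum_of_subset (Finset.filter_subset _ _)

/-- Construction of a module over the endomorphism ring of `⨁ Mⱼ` from a representation of the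
endomorphism ring of one summand that kills the maps factoring through non-isomorphic summands. -/
lemma exists_module_of_residue (h : DirectSum.IsInternal M) (i : Fin n) (rel : Fin n → Prop)
    (hi : rel i) (hrel : ∀ j, rel j → Nonempty (M i ≃ₗ[R] M j))
    {Δ : Type u} [Ring Δ] [Nontrivial Δ] [Module A Δ] (χ : Module.End R (M i) →+* Δ)
    (hsurj : Function.Surjective χ) (hA : ∀ (a : A) f, χ (a • f) = a • χ f)
    (hχ : ∀ j, ¬ rel j → ∀ (g : M i →ₗ[R] M j) (f : M j →ₗ[R] M i), χ (f ∘ₗ g) = 0) :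
    ∃ (W : Type u) (_ : AddCommGroup W) (_ : Module (Module.End R X) W) (_ : Module A W),
      IsScalarTower A (Module.End R X) W ∧ Nontrivial W ∧
      Module.length A W = Module.length A Δ * (Nat.card {j // rel j} : ℕ∞) ∧
      ∀ r : R, χ (algebraMap R _ r) = 0 → ∀ w : W, algebraMap R (Module.End R X) r • w = 0 := by
  classical
  obtain ⟨π, hπ1, hπ2, hπ3⟩ := h.exists_proj
  let ι := {j // rel j}
  let f : ∀ j : ι, M i ≃ₗ[R] M j := fun j => (hrel j.1 j.2).some
  let u : ∀ l : ι, M i →ₗ[R] X := fun l => (M l).subtype ∘ₗ (f l).toLinearMap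
  let v : ∀ l : ι, X →ₗ[R] M i := fun l => (f l).symm.toLinearMap ∘ₗ π l
  have hvu : ∀ j l, v j ∘ₗ u l = if j = l then 1 else 0 := by
    intro j l
    split_ifs with hjl
    · subst hjl
      ext x
      simp [u, v, hπ1]
    · ext x
      simp [u, v, hπ2 j l (fun h => hjl (Subtype.ext h).symm)]
  -- Insert the identity of `X` as the sum of the projections between `a` and `b`. Terms through a
  -- summand outside `rel` are killed by `χ`; the others factor through `M i`, where `χ` is
  -- multiplicative. So the entries multiply like matrices, and `End(X)` acts on column vectors over
  -- `Δ`.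
  have hmul : ∀ (a b : Module.End R X) (j l : ι),
      χ (v j ∘ₗ (a * b) ∘ₗ u l) = ∑ t, χ (v j ∘ₗ a ∘ₗ u t) * χ (v t ∘ₗ b ∘ₗ u l) := by
    intro a b j l
    have h1 : v j ∘ₗ (a * b) ∘ₗ u l =
        ∑ t, (v j ∘ₗ a ∘ₗ (M t).subtype) ∘ₗ (π t ∘ₗ b ∘ₗ u l) := by
      ext x
      have := congrArg (fun y => v j (a y)) (hπ3 (b (u l x)))
      refine (congrArg Subtype.val this.symm).trans ?_
      simp [map_sum]
    rw [h1, map_sum, ← Finset.sum_filter_of_ne (p := rel)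
      (fun t _ ht => by_contra fun hr => ht (hχ t hr _ _)),
      Finset.sum_subtype (p := rel) _ (by simp)]
    refine Finset.sum_congr rfl fun t _ => ?_
    rw [← map_mul]
    congr 1
    ext x
    simp [u, v]
  let ρ : Module.End R X →+* Matrix ι ι Δ :=
    { toFun := fun a => Matrix.of fun j l => χ (v j ∘ₗ a ∘ₗ u l)
      map_one' := by
        ext j l
        have : v j ∘ₗ (1 : Module.End R X) ∘ₗ u l = v j ∘ₗ u l := rfl
        rw [Matrix.of_apply, this, hvu, Matrix.one_apply]
        split_ifs <;> simp
      map_mul' := fun a b => by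
        ext j l
        simp only [Matrix.of_apply, Matrix.mul_apply]
        exact hmul a b j l
      map_zero' := by
        ext j l
        simp
      map_add' := fun a b => by
        ext j l
        simp only [Matrix.of_apply, Matrix.add_apply, LinearMap.add_comp, LinearMap.comp_add,
          map_add] }
  have hρA : ∀ (a : A) (j l : ι) (d : Δ), ρ (algebraMap A _ a) j l * d =
      if j = l then a • d else 0 := by
    intro a j l d
    have h1 : v j ∘ₗ (algebraMap A (Module.End R X) a) ∘ₗ u l = a • (v j ∘ₗ u l) := by
      ext x
      simp
    obtain ⟨g, rfl⟩ := hsurj d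
    change χ (v j ∘ₗ (algebraMap A (Module.End R X) a) ∘ₗ u l) * χ g = _
    rw [h1, hvu]
    split_ifs
    · rw [← map_mul, smul_mul_assoc, one_mul, hA]
    · simp
  let _ : Module (Module.End R X) (ι → Δ) :=
    letI := Matrix.Module.matrixModule (ι := ι) (R := Δ) (M := Δ)
    Module.compHom (ι → Δ) ρ
  have hsmul : ∀ (a : Module.End R X) (w : ι → Δ) j, (a • w) j = ∑ l, ρ a j l * w l :=
    fun _ _ _ => rfl
  have : Nonempty ι := ⟨⟨i, hi⟩⟩
  refine ⟨ι → Δ, inferInstance, inferInstance, inferInstance, ⟨fun a x w => ?_⟩, inferInstance, ?_,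
    fun r hr w => ?_⟩
  · rw [Algebra.smul_def, mul_smul]
    ext j
    rw [hsmul, Finset.sum_eq_single j]
    · rw [hρA, if_pos rfl, Pi.smul_apply]
    · intro l _ hl
      rw [hρA, if_neg hl.symm]
    · simp
  · rw [Module.length_pi, mul_comm, ENat.card_eq_coe_natCard]
  · ext j
    rw [hsmul]
    refine Finset.sum_eq_zero fun l _ => ?_
    have h1 : v j ∘ₗ (algebraMap R (Module.End R X) r) ∘ₗ u l =
        (algebraMap R (Module.End R (M i)) r) * (v j ∘ₗ u l) := by
      ext x
      simp
    change χ (v j ∘ₗ (algebraMap R (Module.End R X) r) ∘ₗ u l) * _ = 0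
    rw [h1, map_mul, hr, zero_mul, zero_mul]

end InternalSum

/-! ### Lengths measured through a ring homomorphism -/

section LengthVia

variable {A B B' V V' : Type*} [Ring A] [Ring B] [Ring B'] [AddCommGroup V] [AddCommGroup V']
  [Module B V] [Module B' V']

/-- The length over `A` of a `B`-module, where `A` acts through a ring homomorphism `A → B`. -/
noncomputable def lengthVia (φ : A →+* B) (V : Type*) [AddCommGroup V] [Module B V] : ℕ∞ :=
  letI : Module A V := Module.compHom V φ
  Module.length A V

lemma lengthVia_eq_length [Module A V] (φ : A →+* B) (h : ∀ (a : A) (x : V), a • x = φ a • x) :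
    lengthVia φ V = Module.length A V := by
  have : ‹Module A V› = Module.compHom V φ := Module.ext (by ext a x; exact h a x)
  subst this
  rfl

variable (φ : A →+* B) (φ' : A →+* B') (f : V →+ V') (hf : ∀ a x, f (φ a • x) = φ' a • f x)

include hf in
lemma lengthVia_le_of_injective (h : Function.Injective f) : lengthVia φ V ≤ lengthVia φ' V' :=
  letI : Module A V := Module.compHom V φ
  letI : Module A V' := Module.compHom V' φ'
  Module.length_le_of_injective ({ f with map_smul' := hf } : V →ₗ[A] V') h

include hf in
lemma lengthVia_le_of_surjective (h : Function.Surjective f) : lengthVia φ' V' ≤ lengthVia φ V :=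
  letI : Module A V := Module.compHom V φ
  letI : Module A V' := Module.compHom V' φ'
  Module.length_le_of_surjective ({ f with map_smul' := hf } : V →ₗ[A] V') h

include hf in
lemma injective_of_lengthVia_le (h : Function.Surjective f) (hle : lengthVia φ V ≤ lengthVia φ' V')
    (htop : lengthVia φ' V' ≠ ⊤) : Function.Injective f := by
  let _ : Module A V := Module.compHom V φ
  let _ : Module A V' := Module.compHom V' φ'
  let g : V →ₗ[A] V' := { f with map_smul' := hf }
  have h1 := Module.length_eq_add_of_exact (LinearMap.ker g).subtype g
    (Submodule.subtype_injective _) h (LinearMap.exact_subtype_ker_map g)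
  change Module.length A V ≤ Module.length A V' at hle
  change Module.length A V' ≠ ⊤ at htop
  rw [h1] at hle
  have h2 : Module.length A (LinearMap.ker g) = 0 := by
    rw [← nonpos_iff_eq_zero]
    refine (ENat.add_le_add_iff_right htop).1 (by simpa using hle)
  rw [Module.length_eq_zero_iff] at h2
  have : LinearMap.ker g = ⊥ := (Submodule.subsingleton_iff_eq_bot).1 h2
  exact LinearMap.ker_eq_bot.1 this

include hf in
lemma surjective_of_lengthVia_le (h : Function.Injective f) (hle : lengthVia φ' V' ≤ lengthVia φ V)
    (htop : lengthVia φ V ≠ ⊤) : Function.Surjective f := by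
  let _ : Module A V := Module.compHom V φ
  let _ : Module A V' := Module.compHom V' φ'
  let g : V →ₗ[A] V' := { f with map_smul' := hf }
  have h1 := Module.length_eq_add_of_exact g (LinearMap.range g).mkQ h
    (Submodule.mkQ_surjective _) (LinearMap.exact_map_mkQ_range g)
  change Module.length A V' ≤ Module.length A V at hle
  change Module.length A V ≠ ⊤ at htop
  rw [h1] at hle
  have h2 : Module.length A (V' ⧸ LinearMap.range g) = 0 := by
    rw [← nonpos_iff_eq_zero]
    refine (ENat.add_le_add_iff_left htop).1 (by simpa using hle)
  rw [Module.length_eq_zero_iff] at h2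
  have : LinearMap.range g = ⊤ := Submodule.Quotient.subsingleton_iff.1 h2
  exact LinearMap.range_eq_top.1 this

lemma lengthVia_ne_zero [Nontrivial V] : lengthVia φ V ≠ 0 :=
  letI : Module A V := Module.compHom V φ
  (Module.length_pos (R := A) (M := V)).ne'

variable (φ : A →+* B) (φ' : A →+* B') (J : Ideal B) (J' : Ideal B') (g : B →+ B')
  (hg : ∀ x, x ∈ J ↔ g x ∈ J') (hφ : ∀ a x, g (φ a * x) = φ' a * g x)

-- Covers two situations: restriction of a left ideal to a smaller ring (`g` the inclusion), and
-- passage to the annihilator of a class (`g` a right multiplication).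
include hg hφ in
lemma exists_quotientMap : ∃ f : (B ⧸ J) →+ (B' ⧸ J'),
    (∀ x, f (Submodule.Quotient.mk x) = Submodule.Quotient.mk (g x)) ∧
    (∀ (a : A) x, f (φ a • x) = φ' a • f x) ∧ Function.Injective f := by
  refine ⟨QuotientAddGroup.map J.toAddSubgroup J'.toAddSubgroup g (fun x hx => (hg x).1 hx),
    fun x => rfl, ?_, ?_⟩
  · rintro a ⟨x⟩
    exact congrArg (Submodule.Quotient.mk (p := J')) (hφ a x)
  · refine (injective_iff_map_eq_zero _).2 ?_
    rintro ⟨x⟩ hx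
    exact (Submodule.Quotient.mk_eq_zero J).2 ((hg x).2 ((Submodule.Quotient.mk_eq_zero J').1 hx))

include hg hφ in
lemma lengthVia_quotient_le : lengthVia φ (B ⧸ J) ≤ lengthVia φ' (B' ⧸ J') := by
  obtain ⟨f, -, hf, hinj⟩ := exists_quotientMap φ φ' J J' g hg hφ
  exact lengthVia_le_of_injective φ φ' f hf hinj

-- An injection into a module that is no longer, with finite length, is onto; so classes over the
-- larger ring have representatives in the smaller one.
include hg hφ in
lemma exists_sub_mem_of_lengthVia_le (hle : lengthVia φ' (B' ⧸ J') ≤ lengthVia φ (B ⧸ J))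
    (htop : lengthVia φ (B ⧸ J) ≠ ⊤) (y : B') : ∃ x, y - g x ∈ J' := by
  obtain ⟨f, hf0, hf, hinj⟩ := exists_quotientMap φ φ' J J' g hg hφ
  obtain ⟨x, hx⟩ := surjective_of_lengthVia_le φ φ' f hf hinj hle htop (Submodule.Quotient.mk y)
  obtain ⟨x, rfl⟩ := Submodule.Quotient.mk_surjective J x
  exact ⟨x, (Submodule.Quotient.eq J').1 (hx.symm.trans (hf0 x))⟩

end LengthVia

/-! ### Finiteness of the set of simple quotients -/

section SimpleQuotients

/-- A module of finite length has only finitely many simple quotients up to isomorphism. -/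
lemma IsFiniteLength.exists_classes {B M : Type*} [Ring B] [AddCommGroup M] [Module B M]
    (h : IsFiniteLength B M) : ∃ n : ℕ, ∀ (ι : Type) (V : ι → Type v)
      [∀ i, AddCommGroup (V i)] [∀ i, Module B (V i)] [∀ i, IsSimpleModule B (V i)]
      (f : ∀ i, M →ₗ[B] V i), (∀ i, f i ≠ 0) →
      ∃ c : ι → Fin n, ∀ i j, c i = c j → Nonempty (V i ≃ₗ[B] V j) := by
  classical
  induction h with
  | of_subsingleton =>
    refine ⟨0, fun ι V _ _ _ f hf => ⟨fun i => (hf i ?_).elim, fun i => (hf i ?_).elim⟩⟩ <;>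
    · ext x
      rw [Subsingleton.elim x 0, map_zero, map_zero]
  | @of_simple_quotient M _ _ N _ _ ih =>
    obtain ⟨n, hn⟩ := ih
    refine ⟨n + 1, fun ι V _ _ _ f hf => ?_⟩
    obtain ⟨c, hc⟩ := hn {i // f i ∘ₗ N.subtype ≠ 0} (fun i => V i.1)
      (fun i => f i.1 ∘ₗ N.subtype) (fun i => i.2)
    -- A simple quotient either stays nonzero on `N`, where induction applies, or is isomorphic to
    -- the simple module `M ⧸ N`; the latter all share the new class `Fin.last n`.
    have hq : ∀ i, ¬ (f i ∘ₗ N.subtype ≠ 0) → Nonempty ((M ⧸ N) ≃ₗ[B] V i) := by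
      intro i hi
      have hle : N ≤ LinearMap.ker (f i) := by
        intro x hx
        exact LinearMap.congr_fun (not_not.1 hi) ⟨x, hx⟩
      refine ⟨LinearEquiv.ofBijective (N.liftQ (f i) hle) (LinearMap.bijective_of_ne_zero ?_)⟩
      intro h0
      refine hf i ?_
      rw [← N.liftQ_mkQ (f i) hle, h0, LinearMap.zero_comp]
    refine ⟨fun i => if hi : f i ∘ₗ N.subtype ≠ 0 then (c ⟨i, hi⟩).castSucc else Fin.last n,
      fun i j hij => ?_⟩
    by_cases hi : f i ∘ₗ N.subtype ≠ 0 <;> by_cases hj : f j ∘ₗ N.subtype ≠ 0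
    · simp only [dif_pos hi, dif_pos hj] at hij
      exact hc _ _ (Fin.castSucc_injective _ hij)
    · simp only [dif_pos hi, dif_neg hj] at hij
      exact absurd hij (Fin.castSucc_lt_last _).ne
    · simp only [dif_neg hi, dif_pos hj] at hij
      exact absurd hij.symm (Fin.castSucc_lt_last _).ne
    · obtain ⟨a⟩ := hq i hi
      obtain ⟨b⟩ := hq j hj
      exact ⟨a.symm.trans b⟩

end SimpleQuotients

/-! ### Compactness: modules over an increasing union of rings -/

section Union

variable {A R D : Type*} [Ring A] [CommRing R] [Ring D]

/-- Data for a union of an increasing chain of rings `S 0 ⊆ S 1 ⊆ ⋯`, with coefficients in `A`,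
such that powers of elements of the ideal `m` become central. -/
structure FiltrationData (A R D : Type*) [Ring A] [CommRing R] [Ring D] where
  S : ℕ → Subring D
  mono : Monotone S
  exists_mem : ∀ x, ∃ e, x ∈ S e
  φ : A →+* D
  φ_mem : ∀ a e, φ a ∈ S e
  ψ : R →+* D
  ψ_mem : ∀ r e, ψ r ∈ S e
  m : Ideal R
  q : ℕ → ℕ
  q_ne_zero : ∀ e, q e ≠ 0
  central : ∀ e r, ∀ x ∈ S e, ψ r ^ q e * x = x * ψ r ^ q e
  finiteLength : ∀ e, IsFiniteLength (S e) (S e ⧸ Ideal.span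
    {x : S e | ∃ r ∈ m, (x : D) = ψ r ^ q e})

namespace FiltrationData

variable (F : FiltrationData A R D)

def φS (e : ℕ) : A →+* F.S e := F.φ.codRestrict (F.S e) fun a => F.φ_mem a e

/-- `J` is a proper left ideal of `S e` whose quotient is `m`-torsion of length at most `u`. -/
structure Good (e u : ℕ) (J : Ideal (F.S e)) : Prop where
  ne_top : J ≠ ⊤
  length_le : lengthVia (F.φS e) (F.S e ⧸ J) ≤ u
  torsion : ∀ r ∈ F.m, ∀ x : F.S e, ∃ n : ℕ, (⟨F.ψ r, F.ψ_mem r e⟩ : F.S e) ^ n * x ∈ J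

abbrev res {e e' : ℕ} (h : e ≤ e') (J : Ideal (F.S e')) : Ideal (F.S e) :=
  J.comap (Subring.inclusion (F.mono h))

/-- This is the annihilator of the class of `b` in `S e ⧸ J`. When that quotient is simple and `b ∉
J`, passing to it only changes the chosen generator. -/
def colon {e : ℕ} (J : Ideal (F.S e)) (b : F.S e) : Ideal (F.S e) :=
  Submodule.comap (LinearMap.toSpanSingleton (F.S e) (F.S e) b) J

variable {F}

lemma mem_colon {e : ℕ} {J : Ideal (F.S e)} {a b : F.S e} : a ∈ F.colon J b ↔ a * b ∈ J := Iff.rfl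

lemma Good.res {e e' u : ℕ} (h : e ≤ e') {J : Ideal (F.S e')} (hJ : F.Good e' u J) :
    F.Good e u (F.res h J) where
  ne_top h1 := hJ.ne_top ((Ideal.eq_top_iff_one _).2 (by
    have := (Ideal.eq_top_iff_one _).1 h1
    rwa [Ideal.mem_comap, map_one] at this))
  length_le := (lengthVia_quotient_le _ _ _ _ (Subring.inclusion (F.mono h)).toAddMonoidHom
    (fun _ => Iff.rfl) (fun _ _ => rfl)).trans hJ.length_le
  torsion r hr x := hJ.torsion r hr (Subring.inclusion (F.mono h) x)

lemma Good.colon {e u : ℕ} {J : Ideal (F.S e)} (hJ : F.Good e u J) {b : F.S e} (hb : b ∉ J) :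
    F.Good e u (F.colon J b) where
  ne_top h1 := hb (by simpa [mem_colon] using (Ideal.eq_top_iff_one _).1 h1)
  length_le := (lengthVia_quotient_le _ _ _ _ (AddMonoidHom.mulRight b)
    (fun _ => Iff.rfl) (fun _ _ => mul_assoc _ _ _)).trans hJ.length_le
  torsion r hr x := by
    obtain ⟨n, hn⟩ := hJ.torsion r hr (x * b)
    exact ⟨n, by rwa [mem_colon, mul_assoc]⟩

/-- If `u` is the minimal length at level `e`, the quotients of length `u` are simple. -/
lemma Good.isCoatom {e u : ℕ} (hmin : ∀ J : Ideal (F.S e), F.Good e u J →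
    (u : ℕ∞) ≤ lengthVia (F.φS e) (F.S e ⧸ J)) {J : Ideal (F.S e)} (hJ : F.Good e u J) :
    IsCoatom J := by
  refine ⟨hJ.ne_top, fun K hK => ?_⟩
  by_contra hne
  have hf := Submodule.factor_surjective hK.le
  have hlen : lengthVia (F.φS e) (F.S e ⧸ K) ≤ lengthVia (F.φS e) (F.S e ⧸ J) :=
    lengthVia_le_of_surjective _ _ (Submodule.factor hK.le).toAddMonoidHom
      (fun a x => (Submodule.factor hK.le).map_smul _ _) hf
  have hKg : F.Good e u K := ⟨hne, hlen.trans hJ.length_le, fun r hr x => by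
    obtain ⟨n, hn⟩ := hJ.torsion r hr x
    exact ⟨n, hK.le hn⟩⟩
  have hinj := injective_of_lengthVia_le _ _ (Submodule.factor hK.le).toAddMonoidHom
    (fun a x => (Submodule.factor hK.le).map_smul _ _) hf (hJ.length_le.trans (hmin K hKg))
    (ne_top_of_le_ne_top (ENat.natCast_ne_top u) hKg.length_le)
  refine hK.not_ge fun x hx => ?_
  rw [← Submodule.Quotient.mk_eq_zero J]
  refine hinj ?_
  rw [map_zero]
  exact (Submodule.Quotient.mk_eq_zero K).2 hx

/-- An instance of Schur's lemma: a central element acts on the simple module `B ⧸ J` as zero or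
invertibly, so it acts as zero if it is nilpotent there. -/
lemma pow_mem_of_isCoatom {B : Type*} [Ring B] {J : Ideal B} (hJ : IsCoatom J) {c : B}
    (hc : ∀ x, c * x = x * c) {n : ℕ} (hn : c ^ n ∈ J) : c ∈ J := by
  by_contra hcJ
  have hone : (1 : B) ∉ J := fun h => hJ.1 ((Ideal.eq_top_iff_one _).2 h)
  induction n with
  | zero => exact hone (by simpa using hn)
  | succ n ih =>
    refine ih ?_
    have h1 : (1 : B) ∈ J ⊔ Submodule.span B {c} := by
      rw [hJ.2 _ (left_lt_sup.2 fun h' => hcJ (h' (Submodule.mem_span_singleton_self c)))]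
      trivial
    obtain ⟨j, hj, d, hd, hjd⟩ := Submodule.mem_sup.1 h1
    obtain ⟨b, rfl⟩ := Submodule.mem_span_singleton.1 hd
    have hcn : Commute (c ^ n) j := (Commute.pow_left (hc j) n)
    have : c ^ n = c ^ n * j + b * c ^ (n + 1) := by
      calc c ^ n = (j + b * c) * c ^ n := by rw [← smul_eq_mul b c, hjd, one_mul]
        _ = _ := by rw [add_mul, ← hcn.eq, mul_assoc, pow_succ']
    rw [this]
    exact J.add_mem (J.mul_mem_left _ hj) (J.mul_mem_left _ hn)

/-- The element `ψ r ^ q e` is central in `S e` and, by torsion, nilpotent on the class of `1`.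
Consequently all simple good quotients of level `e` are quotients of one module of finite length, so
they form finitely many isomorphism classes. -/
lemma Good.span_le {e u : ℕ} {J : Ideal (F.S e)} (hJ : F.Good e u J) (hc : IsCoatom J) :
    Ideal.span {x : F.S e | ∃ r ∈ F.m, (x : D) = F.ψ r ^ F.q e} ≤ J := by
  rw [Ideal.span_le]
  rintro x ⟨r, hr, hx⟩
  have hx' : x = (⟨F.ψ r, F.ψ_mem r e⟩ : F.S e) ^ F.q e := Subtype.ext hx
  obtain ⟨n, hn⟩ := hJ.torsion r hr 1
  rw [mul_one] at hn
  refine pow_mem_of_isCoatom hc (n := n) (fun y => Subtype.ext ?_) ?_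
  · rw [hx']
    exact F.central e r y y.2
  · rw [hx', ← pow_mul, mul_comm, pow_mul]
    obtain ⟨k, hk⟩ := Nat.exists_eq_succ_of_ne_zero (F.q_ne_zero e)
    rw [hk, pow_succ]
    exact J.mul_mem_left _ hn

/-- Among infinitely many good left ideals, infinitely many have isomorphic quotients. -/
lemma exists_colon_eq {e u : ℕ} (hmin : ∀ J : Ideal (F.S e), F.Good e u J →
    (u : ℕ∞) ≤ lengthVia (F.φS e) (F.S e ⧸ J)) (K : ℕ → Ideal (F.S e))
    (hK : ∀ i, F.Good e u (K i)) :
    ∃ i₀, ∀ N, ∃ i ≥ N, ∃ b, b ∉ K i ∧ K i₀ = F.colon (K i) b := by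
  obtain ⟨n, hn⟩ := (F.finiteLength e).exists_classes
  have hco : ∀ i, IsCoatom (K i) := fun i => (hK i).isCoatom hmin
  have hsimple : ∀ i, IsSimpleModule (F.S e) (F.S e ⧸ K i) := fun i =>
    isSimpleModule_iff_isCoatom.2 (hco i)
  obtain ⟨c, hc⟩ := hn ℕ (fun i => F.S e ⧸ K i)
    (fun i => Submodule.factor ((hK i).span_le (hco i))) (fun i h0 => (hK i).ne_top (by
      have := LinearMap.congr_fun h0 (Submodule.Quotient.mk 1)
      rw [Ideal.eq_top_iff_one, ← Submodule.Quotient.mk_eq_zero]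
      exact this))
  obtain ⟨y, hy⟩ := Finite.exists_infinite_fiber c
  rw [Set.infinite_coe_iff] at hy
  obtain ⟨i₀, hi₀⟩ := hy.nonempty
  refine ⟨i₀, fun N => ?_⟩
  obtain ⟨i, hi, hNi⟩ := hy.exists_gt N
  obtain ⟨f⟩ := hc i₀ i (by rw [hi₀, hi])
  obtain ⟨b, hb⟩ := Submodule.Quotient.mk_surjective (K i) (f (Submodule.Quotient.mk 1))
  -- The isomorphism takes the class of `1` to the class of `b`, so the two have the same
  -- annihilator.
  have key : ∀ a : F.S e, a ∈ K i₀ ↔ a * b ∈ K i := by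
    intro a
    rw [← Submodule.Quotient.mk_eq_zero, ← Submodule.Quotient.mk_eq_zero (K i), ← smul_eq_mul,
      Submodule.Quotient.mk_smul, hb, ← map_smul, ← Submodule.Quotient.mk_smul, smul_eq_mul,
          mul_one,
      map_eq_zero_iff f f.injective]
  refine ⟨i, hNi.le, b, fun h => (hK i₀).ne_top ?_, Ideal.ext fun a => key a⟩
  rw [Ideal.eq_top_iff_one, key, one_mul]
  exact h

/-- `J` is the restriction of good left ideals at all higher levels. -/
def Extends (F : FiltrationData A R D) (u e : ℕ) (J : Ideal (F.S e)) : Prop :=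
  ∀ e' (h : e ≤ e'), ∃ J' : Ideal (F.S e'), F.Good e' u J' ∧ F.res h J' = J

/-- Restrict the given ideals to level `e`. By the pigeonhole principle one restriction is
isomorphic, as a quotient, to restrictions from arbitrarily high levels. Replacing those high ideals
by annihilators of a class `b` turns the isomorphism into an equality, and restricting to level `e'`
in between gives the extension. -/
lemma exists_extends {e u : ℕ} (hmin : ∀ J : Ideal (F.S e), F.Good e u J →
    (u : ℕ∞) ≤ lengthVia (F.φS e) (F.S e ⧸ J)) (J : ∀ e', e ≤ e' → Ideal (F.S e'))
    (hJ : ∀ e' h, F.Good e' u (J e' h)) :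
    ∃ e' h, F.Extends u e (F.res h (J e' h)) := by
  obtain ⟨i₀, hi₀⟩ := exists_colon_eq hmin
    (fun i => F.res (Nat.le_add_right e i) (J _ (Nat.le_add_right e i))) (fun i => (hJ _ _).res _)
  refine ⟨e + i₀, Nat.le_add_right e i₀, fun e' he' => ?_⟩
  obtain ⟨i, hi, b, hb, hcol⟩ := hi₀ e'
  refine ⟨F.res (hi.trans (Nat.le_add_left i e))
    (F.colon (J _ (Nat.le_add_right e i)) (Subring.inclusion (F.mono (Nat.le_add_right e i)) b)),
    ((hJ _ _).colon hb).res _, ?_⟩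
  rw [hcol]
  rfl

/-- As in König's lemma, one climbs only through ideals that extend to all higher levels. -/
lemma exists_compatible {u : ℕ} (hmin : ∀ e, ∀ J : Ideal (F.S e), F.Good e u J →
    (u : ℕ∞) ≤ lengthVia (F.φS e) (F.S e ⧸ J)) (h : ∀ e, ∃ J : Ideal (F.S e), F.Good e u J) :
    ∃ J : ∀ e, Ideal (F.S e), (∀ e, F.Good e u (J e)) ∧
      ∀ e, F.res (Nat.le_succ e) (J (e + 1)) = J e := by
  have h0 : ∃ J : Ideal (F.S 0), F.Extends u 0 J := by
    choose J hJ using h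
    obtain ⟨e', h', hE⟩ := exists_extends (hmin 0) (fun e' _ => J e') (fun e' _ => hJ e')
    exact ⟨_, hE⟩
  have hstep : ∀ e, ∀ J : {J : Ideal (F.S e) // F.Extends u e J},
      ∃ J' : {J : Ideal (F.S (e + 1)) // F.Extends u (e + 1) J},
        F.res (Nat.le_succ e) J'.1 = J.1 := by
    rintro e ⟨J, hJ⟩
    -- All `K e'` restrict to `J` at level `e`; so does whichever of them `exists_extends` selects
    -- at level `e + 1`.
    choose K hK using fun e' (h' : e + 1 ≤ e') => hJ e' ((Nat.le_succ e).trans h')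
    obtain ⟨e', h', hE⟩ := exists_extends (hmin (e + 1)) K (fun e' h' => (hK e' h').1)
    exact ⟨⟨_, hE⟩, (hK e' h').2⟩
  choose next hnext using hstep
  obtain ⟨J₀, hJ₀⟩ := h0
  let J : ∀ e, {J : Ideal (F.S e) // F.Extends u e J} := fun e => Nat.rec ⟨J₀, hJ₀⟩ next e
  refine ⟨fun e => (J e).1, fun e => ?_, fun e => hnext e (J e)⟩
  obtain ⟨J', hJ', hres⟩ := (J e).2 e le_rfl
  have := hJ'.res le_rfl
  rwa [hres] at this

/-- Let `J'` be the union of a compatible family. The maps `S 0 ⧸ J 0 → S e ⧸ J e` are injective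
between modules of length `u`, hence bijective, so `S 0 ⧸ J 0` maps onto `D ⧸ J'`. -/
lemma exists_of_minimal {u : ℕ} (hmin : ∀ e, ∀ J : Ideal (F.S e), F.Good e u J →
    (u : ℕ∞) ≤ lengthVia (F.φS e) (F.S e ⧸ J)) (h : ∀ e, ∃ J : Ideal (F.S e), F.Good e u J) :
    ∃ J : Ideal D, J ≠ ⊤ ∧ lengthVia F.φ (D ⧸ J) ≤ u := by
  obtain ⟨J, hJ, hcomp⟩ := exists_compatible hmin h
  have hcomp' : ∀ e e' (he : e ≤ e'), F.res he (J e') = J e := by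
    intro e e' he
    induction e', he using Nat.le_induction with
    | base => rfl
    | succ e' he ih => rw [← ih, ← hcomp e']; rfl
  have hmem : ∀ e e' x (hx : x ∈ F.S e) (hx' : x ∈ F.S e'),
      (⟨x, hx⟩ : F.S e) ∈ J e → (⟨x, hx'⟩ : F.S e') ∈ J e' := by
    intro e e' x hx hx' h
    rcases le_total e e' with he | he
    · rw [← hcomp' e e' he] at h
      exact h
    · rw [← hcomp' e' e he]
      exact h
  let J' : Ideal D :=
    { carrier := {x | ∃ e, ∃ hx : x ∈ F.S e, (⟨x, hx⟩ : F.S e) ∈ J e}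
      add_mem' := by
        rintro x y ⟨e, hx, hxe⟩ ⟨e', hy, hye⟩
        have hx' := F.mono (le_max_left e e') hx
        have hy' := F.mono (le_max_right e e') hy
        exact ⟨max e e', add_mem hx' hy', (J _).add_mem (hmem _ _ _ _ hx' hxe)
          (hmem _ _ _ _ hy' hye)⟩
      zero_mem' := ⟨0, zero_mem _, (J 0).zero_mem⟩
      smul_mem' := by
        rintro c x ⟨e, hx, hxe⟩
        obtain ⟨e', hc⟩ := F.exists_mem c
        have hx' := F.mono (le_max_left e e') hx
        have hc' := F.mono (le_max_right e e') hc
        exact ⟨max e e', mul_mem hc' hx', (J _).mul_mem_left ⟨c, hc'⟩ (hmem _ _ _ _ hx' hxe)⟩ }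
  have hJ' : ∀ e (x : F.S e), (x : D) ∈ J' ↔ x ∈ J e :=
    fun e x => ⟨fun ⟨e', hx, hxe⟩ => hmem _ _ _ hx x.2 hxe, fun h => ⟨e, x.2, h⟩⟩
  refine ⟨J', fun htop => (hJ 0).ne_top ?_, ?_⟩
  · rw [Ideal.eq_top_iff_one] at htop ⊢
    exact (hJ' 0 1).1 htop
  · refine le_trans ?_ (hJ 0).length_le
    obtain ⟨f, hf0, hf, -⟩ := exists_quotientMap (F.φS 0) F.φ (J 0) J'
        (F.S 0).subtype.toAddMonoidHom
      (fun x => (hJ' 0 x).symm) (fun _ _ => rfl)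
    refine lengthVia_le_of_surjective _ _ f hf fun y => ?_
    obtain ⟨y, rfl⟩ := Submodule.Quotient.mk_surjective J' y
    obtain ⟨e, hy⟩ := F.exists_mem y
    obtain ⟨x, hx⟩ := exists_sub_mem_of_lengthVia_le (F.φS 0) (F.φS e) (J 0) (J e)
      (Subring.inclusion (F.mono (Nat.zero_le e))).toAddMonoidHom
      (fun x => by rw [← hcomp' 0 e (Nat.zero_le e)]; rfl) (fun _ _ => rfl)
      ((hJ e).length_le.trans (hmin 0 _ (hJ 0)))
      (ne_top_of_le_ne_top (ENat.natCast_ne_top u) (hJ 0).length_le) ⟨y, hy⟩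
    refine ⟨Submodule.Quotient.mk x, ?_⟩
    rw [hf0, eq_comm, Submodule.Quotient.eq]
    exact (hJ' e _).2 hx

/-- Compactness: bounded torsion modules at all levels give a bounded module over the union. -/
theorem exists_of_forall_good {u : ℕ} (h : ∀ e, ∃ J : Ideal (F.S e), F.Good e u J) :
    ∃ J : Ideal D, J ≠ ⊤ ∧ lengthVia F.φ (D ⧸ J) ≤ u := by
  classical
  have hex : ∃ u, ∀ e, ∃ J : Ideal (F.S e), F.Good e u J := ⟨u, h⟩
  set w := Nat.find hex with hw
  have hw1 : ∀ e, ∃ J : Ideal (F.S e), F.Good e w J := Nat.find_spec hex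
  have hwu : w ≤ u := Nat.find_min' hex h
  -- Needed for `w - 1` to be a genuine predecessor; it holds because good quotients are nonzero.
  have hpos : w ≠ 0 := by
    intro h0
    obtain ⟨J, hJ⟩ := hw1 0
    have := hJ.length_le
    have : Nontrivial (F.S 0 ⧸ J) := Submodule.Quotient.nontrivial_iff.2 hJ.ne_top
    exact lengthVia_ne_zero (F.φS 0) (V := F.S 0 ⧸ J) (by simpa [h0] using hJ.length_le)
  have hnot : ¬ ∀ e, ∃ J : Ideal (F.S e), F.Good e (w - 1) J :=
    Nat.find_min hex (Nat.sub_lt (Nat.pos_of_ne_zero hpos) one_pos)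
  push Not at hnot
  obtain ⟨e₀, he₀⟩ := hnot
  -- The bound `w - 1` fails at level `e₀`. An ideal beyond `e₀` with a quotient shorter than `w`
  -- would restrict to one at `e₀`, so after dropping the first `e₀` levels `w` is minimal at every
  -- level.
  let G : FiltrationData A R D :=
    { F with
      S := fun e => F.S (e₀ + e)
      mono := fun e e' h => F.mono (Nat.add_le_add_left h e₀)
      exists_mem := fun x => by
        obtain ⟨e, he⟩ := F.exists_mem x
        exact ⟨e, F.mono (Nat.le_add_left e e₀) he⟩
      φ_mem := fun a e => F.φ_mem a _
      ψ_mem := fun a e => F.ψ_mem a _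
      q := fun e => F.q (e₀ + e)
      q_ne_zero := fun e => F.q_ne_zero _
      central := fun e => F.central _
      finiteLength := fun e => F.finiteLength _ }
  have hmin : ∀ e, ∀ J : Ideal (G.S e), G.Good e w J →
      (w : ℕ∞) ≤ lengthVia (G.φS e) (G.S e ⧸ J) := by
    intro e J hJ
    by_contra! hlt
    refine he₀ (F.res (Nat.le_add_right e₀ e) J) (Good.res _ ⟨hJ.ne_top, ?_, hJ.torsion⟩)
    have : w = (w - 1) + 1 := by omega
    rw [this] at hlt
    exact ENat.lt_natCast_add_one_iff.1 (by exact_mod_cast hlt)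
  obtain ⟨J, hJ, hlen⟩ := exists_of_minimal hmin (fun e => by
    obtain ⟨J, hJ⟩ := hw1 (e₀ + e)
    exact ⟨J, hJ.ne_top, hJ.length_le, hJ.torsion⟩)
  exact ⟨J, hJ, hlen.trans (by exact_mod_cast hwu)⟩

end FiltrationData

end Union

/-! ### Lengths of Frobenius twists -/

section FrobTwist

variable (p : ℕ) [Fact p.Prime] (e : ℕ)

lemma moduleFinite_frobTwist_iff (A : Type*) [CommRing A] [CharP A p] :
    Module.Finite A (FrobTwist p e A) ↔ (iterateFrobenius A p e).Finite := Iff.rfl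

lemma RingHom.Finite.iterateFrobenius {A : Type*} [CommRing A] [CharP A p]
    (h : (frobenius A p).Finite) : (_root_.iterateFrobenius A p e).Finite := by
  induction e with
  | zero =>
    rw [iterateFrobenius_zero]
    exact RingHom.Finite.id A
  | succ e ih =>
    have : _root_.iterateFrobenius A p (e + 1) = (_root_.iterateFrobenius A p e).comp
        (frobenius A p) := by
      ext x
      simp [iterateFrobenius_def, frobenius_def, pow_succ', pow_mul]
    rw [this]
    exact ih.comp h

variable {A : Type*} [CommRing A] [CharP A p]

/-- `ᵉf` for a linear map `f`. -/
def FrobTwist.map {M N : Type*} [AddCommGroup M] [AddCommGroup N] [Module A M] [Module A N]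
    (f : M →ₗ[A] N) : FrobTwist p e M →ₗ[A] FrobTwist p e N where
  toFun := fun x => (toBase p e N).symm (f (toBase p e M x))
  map_add' := fun x y => f.map_add x y
  map_smul' := fun a x => f.map_smul (a ^ p ^ e) x

lemma length_frobTwist_add {M : Type*} [AddCommGroup M] [Module A M] (N : Submodule A M) :
    Module.length A (FrobTwist p e M) =
      Module.length A (FrobTwist p e N) + Module.length A (FrobTwist p e (M ⧸ N)) :=
  Module.length_eq_add_of_exact (FrobTwist.map p e N.subtype) (FrobTwist.map p e N.mkQ)
    Subtype.val_injective N.mkQ_surjective (LinearMap.exact_subtype_mkQ N)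

lemma length_frobTwist_congr {M N : Type*} [AddCommGroup M] [Module A M] [AddCommGroup N]
    [Module A N] (f : M ≃ₗ[A] N) :
    Module.length A (FrobTwist p e M) = Module.length A (FrobTwist p e N) :=
  (LinearEquiv.ofBijective (FrobTwist.map p e f.toLinearMap) f.bijective).length_eq

/-- Submodules of `M` remain submodules of `ᵉM`. No finiteness is required, so infinite lengths are
transported too. -/
lemma length_le_length_frobTwist (M : Type*) [AddCommGroup M] [Module A M] :
    Module.length A M ≤ Module.length A (FrobTwist p e M) := by
  let f : Submodule A M ↪o Submodule A (FrobTwist p e M) := OrderEmbedding.ofMapLEIff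
    (fun N => { carrier := {x | FrobTwist.toBase p e M x ∈ N}
                add_mem' := fun hx hy => N.add_mem hx hy
                zero_mem' := N.zero_mem
                smul_mem' := fun a _ hx => N.smul_mem (a ^ p ^ e) hx }) (fun _ _ => Iff.rfl)
  rw [← WithBot.coe_le_coe, Module.coe_length, Module.coe_length]
  exact Order.krullDim_le_of_strictMono f f.strictMono

/-- Both sides are additive in short exact sequences, so simple modules decide. -/
lemma length_frobTwist {M : Type v} [AddCommGroup M] [Module A M] (c : ℕ∞)
    (hc : ∀ (S : Type v) [AddCommGroup S] [Module A S] [IsSimpleModule A S],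
      Module.length A (FrobTwist p e S) = c) (h : IsFiniteLength A M) :
    Module.length A (FrobTwist p e M) = Module.length A M * c := by
  induction h with
  | @of_subsingleton M _ _ _ =>
    have : Subsingleton (FrobTwist p e M) := ‹Subsingleton M›
    simp
  | @of_simple_quotient M _ _ N _ _ ih =>
    rw [length_frobTwist_add p e N, ih, hc (M ⧸ N),
      Module.length_eq_add_of_exact N.subtype N.mkQ N.injective_subtype N.mkQ_surjective
      (LinearMap.exact_subtype_mkQ N), Module.length_eq_one A (M ⧸ N), add_mul, one_mul]

lemma frobDegree_eq_finrank (k : Type*) [Field k] [CharP k p] :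
    frobDegree p e k = Module.finrank k (FrobTwist p e k) := by
  let _ : Algebra k k := (iterateFrobenius k p e).toAlgebra
  exact (Algebra.finrank_eq_of_equiv_equiv (R₀ := k) (S₀ := k)
    (RingEquiv.ofBijective (iterateFrobenius k p e).rangeRestrictField
      (RingHom.rangeRestrictField_bijective _)) (RingEquiv.refl k) rfl).symm

end FrobTwist

/-! ### Finiteness of Frobenius and residue field degrees -/

section FFinite
variable (p : ℕ) [Fact p.Prime]

/-- Frobenius is integral, as `x` is a root of `X ^ p - x ^ p` with coefficients read through
Frobenius, and it is of finite type because its composite with `k → R` is. -/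
lemma frobenius_finite_of_finiteType {k R : Type*} [Field k] [CharP k p] [CommRing R] [CharP R p]
    [Algebra k R] [Algebra.FiniteType k R] (hk : (frobenius k p).Finite) :
    (frobenius R p).Finite := by
  refine RingHom.IsIntegral.to_finite (fun x => ⟨Polynomial.X ^ p - Polynomial.C x, ?_, ?_⟩) ?_
  · exact Polynomial.monic_X_pow_sub_C _ (Fact.out : p.Prime).ne_zero
  · simp [frobenius_def]
  · refine RingHom.FiniteType.of_comp_finiteType (f := algebraMap k R) ?_
    have : (frobenius R p).comp (algebraMap k R) = (algebraMap k R).comp (frobenius k p) := by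
      ext x
      simp [frobenius_def]
    rw [this]
    exact RingHom.FiniteType.comp (RingHom.finiteType_algebraMap.2 ‹_›) hk.finiteType

/-- The residue field is the only simple module, and its twist has dimension `[k : k ^ (p ^ e)]`. -/
lemma length_frobTwist_of_isLocalRing {R : Type u} {W : Type v} (e : ℕ) [CommRing R]
    [IsLocalRing R] [CharP R p]
    [CharP (IsLocalRing.ResidueField R) p] (hk : (frobenius (IsLocalRing.ResidueField R) p).Finite)
    [AddCommGroup W] [Module R W] (h : IsFiniteLength R W) :
    Module.length R (FrobTwist p e W) =
      Module.length R W * (frobDegree p e (IsLocalRing.ResidueField R) : ℕ∞) := by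
  refine length_frobTwist p e _ (fun S _ _ hS => ?_) h
  obtain ⟨I, hI, ⟨f⟩⟩ := isSimpleModule_iff_quot_maximal.1 hS
  obtain rfl := IsLocalRing.eq_maximalIdeal hI
  rw [length_frobTwist_congr p e f]
  change Module.length R (FrobTwist p e (IsLocalRing.ResidueField R)) = _
  have : Module.Finite (IsLocalRing.ResidueField R) (FrobTwist p e (IsLocalRing.ResidueField R)) :=
    (moduleFinite_frobTwist_iff p e _).2 (hk.iterateFrobenius p e)
  rw [Module.length_eq_of_surjective (R := IsLocalRing.ResidueField R)
    IsLocalRing.residue_surjective, Module.length_eq_finrank, frobDegree_eq_finrank]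

lemma length_frobTwist_of_field {k : Type u} {W : Type v} (e : ℕ) [Field k] [CharP k p]
    (hk : (frobenius k p).Finite) [AddCommGroup W] [Module k W] (h : IsFiniteLength k W) :
    Module.length k (FrobTwist p e W) = Module.length k W * (frobDegree p e k : ℕ∞) := by
  refine length_frobTwist p e _ (fun S _ _ hS => ?_) h
  have : Module.Finite k (FrobTwist p e k) :=
    (moduleFinite_frobTwist_iff p e _).2 (hk.iterateFrobenius p e)
  obtain ⟨I, hI, ⟨f⟩⟩ := isSimpleModule_iff_quot_maximal.1 hS
  obtain rfl := IsSimpleOrder.eq_bot_of_lt hI.ne_top.lt_top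
  rw [length_frobTwist_congr p e (f.trans (Submodule.quotEquivOfEqBot ⊥ rfl)),
      Module.length_eq_finrank, frobDegree_eq_finrank]

lemma frobDegree_ne_zero (e : ℕ) {k : Type*} [Field k] [CharP k p] (hk : (frobenius k p).Finite) :
    frobDegree p e k ≠ 0 := by
  have : Module.Finite k (FrobTwist p e k) :=
    (moduleFinite_frobTwist_iff p e _).2 (hk.iterateFrobenius p e)
  have : Nontrivial (FrobTwist p e k) := inferInstanceAs (Nontrivial k)
  rw [frobDegree_eq_finrank]
  exact Module.finrank_pos.ne'

lemma frobDegree_of_perfectRing (e : ℕ) (k : Type*) [Field k] [CharP k p] [PerfectRing k p] :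
    frobDegree p e k = 1 := by
  let f : k →ₗ[k] FrobTwist p e k :=
    { toFun := fun x => (FrobTwist.toBase p e k).symm (iterateFrobenius k p e x)
      map_add' := fun x y => map_add (iterateFrobenius k p e) x y
      map_smul' := fun a x => map_mul (iterateFrobenius k p e) a x }
  rw [frobDegree_eq_finrank,
    ← (LinearEquiv.ofBijective f (bijective_iterateFrobenius k p e)).finrank_eq,
    Module.finrank_self]

lemma IsLocalRing.isFiniteLength_quotient {R : Type*} [CommRing R] [IsLocalRing R]
    [IsNoetherianRing R] {I : Ideal R} {n : ℕ} (hn : IsLocalRing.maximalIdeal R ^ n ≤ I) :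
    IsFiniteLength R (R ⧸ I) := by
  rcases eq_or_ne I ⊤ with rfl | hI
  · exact .of_subsingleton
  have : Nontrivial (R ⧸ I) := Ideal.Quotient.nontrivial_iff.mpr hI
  have := IsLocalRing.of_surjective' (Ideal.Quotient.mk I) Ideal.Quotient.mk_surjective
  have := IsLocalHom.of_surjective (Ideal.Quotient.mk I) Ideal.Quotient.mk_surjective
  have h1 : (IsLocalRing.maximalIdeal R).map (Ideal.Quotient.mk I) =
      IsLocalRing.maximalIdeal (R ⧸ I) := by
    ext x
    obtain ⟨x, rfl⟩ := Ideal.Quotient.mk_surjective x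
    simp [sup_eq_left.mpr (IsLocalRing.le_maximalIdeal hI)]
  have h2 : IsArtinianRing (R ⧸ I) := by
    rw [isArtinianRing_iff_isNilpotent_maximalIdeal, ← h1]
    refine ⟨n, ?_⟩
    rw [← Ideal.map_pow, Ideal.zero_eq_bot, Ideal.map_eq_bot_iff_le_ker, Ideal.mk_ker]
    exact hn
  exact isFiniteLength_iff_isNoetherian_isArtinian.2 ⟨inferInstance,
    isArtinian_of_surjective_algebraMap (R := R ⧸ I) Ideal.Quotient.mk_surjective⟩

/-- The ideal `I` generated by the `p ^ e`-th powers of `m` contains a power of `m`, so `R ⧸ I` and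
its twist have finite length. The kernel of `ᵉR → ᵉ(R ⧸ I)` lies in `m • ᵉR`, and `ᵉR` is
`m`-adically separated, so the complete form of Nakayama's lemma applies. -/
lemma finite_frobTwist_of_isAdicComplete (R : Type*) (e : ℕ) [CommRing R] [IsLocalRing R]
    [IsNoetherianRing R] [IsAdicComplete (IsLocalRing.maximalIdeal R) R] [CharP R p]
    [CharP (IsLocalRing.ResidueField R) p]
        (hk : (frobenius (IsLocalRing.ResidueField R) p).Finite) :
    Module.Finite R (FrobTwist p e R) := by
  set m := IsLocalRing.maximalIdeal R with hm
  let I := m.map (iterateFrobenius R p e)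
  have hI : IsFiniteLength R (R ⧸ I) := by
    obtain ⟨n, hn⟩ := Ideal.exists_pow_le_of_le_radical_of_fg (I := m) (J := I)
      (fun x hx => ⟨p ^ e, Ideal.mem_map_of_mem (iterateFrobenius R p e) hx⟩)
          (IsNoetherian.noetherian m)
    exact IsLocalRing.isFiniteLength_quotient hn
  have hfin : Module.length R (FrobTwist p e (R ⧸ I)) ≠ ⊤ := by
    rw [length_frobTwist_of_isLocalRing p e hk hI]
    exact WithTop.mul_ne_top (Module.length_ne_top_iff.2 hI) (ENat.natCast_ne_top _)
  have hnoeth : IsNoetherian R (FrobTwist p e (R ⧸ I)) :=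
    (isFiniteLength_iff_isNoetherian_isArtinian.1 (Module.length_ne_top_iff.1 hfin)).1
  let g : FrobTwist p e R →ₗ[R] FrobTwist p e (R ⧸ I) := FrobTwist.map p e I.mkQ
  have hg : LinearMap.ker g ≤ m • ⊤ := by
    intro x hx
    have hx' : FrobTwist.toBase p e R x ∈ I := (Submodule.Quotient.mk_eq_zero I).1 hx
    have hI' : I = Submodule.span R (iterateFrobenius R p e '' m) := rfl
    rw [hI'] at hx'
    change (FrobTwist.toBase p e R).symm (FrobTwist.toBase p e R x) ∈ _
    generalize FrobTwist.toBase p e R x = y at hx'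
    induction hx' using Submodule.span_induction with
    | mem y hy =>
      obtain ⟨r, hr, rfl⟩ := hy
      have : (FrobTwist.toBase p e R).symm (iterateFrobenius R p e r) =
          r • (FrobTwist.toBase p e R).symm 1 := (mul_one (r ^ p ^ e : R)).symm
      rw [this]
      exact Submodule.smul_mem_smul hr trivial
    | zero => simp
    | add y z _ _ h1 h2 => exact add_mem h1 h2
    | smul a y _ h =>
      have : FrobTwist.map p e (LinearMap.mulLeft R a) ((FrobTwist.toBase p e R).symm y) ∈
          (m • ⊤ : Submodule R (FrobTwist p e R)) := by
        have h2 := Submodule.mem_map_of_mem (f := FrobTwist.map p e (LinearMap.mulLeft R a)) h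
        rw [Submodule.map_smul''] at h2
        exact Submodule.smul_mono le_rfl le_top h2
      exact this
  have h1 : IsHausdorff m (FrobTwist p e R) := ⟨fun x hx => by
    refine IsHausdorff.haus' (I := m) (M := R) (FrobTwist.toBase p e R x) fun n => ?_
    have h := hx n
    rw [SModEq.zero] at h ⊢
    let N : Submodule R (FrobTwist p e R) :=
      { carrier := {y | FrobTwist.toBase p e R y ∈ m ^ n}
        add_mem' := fun hx hy => (m ^ n).add_mem hx hy
        zero_mem' := (m ^ n).zero_mem
        smul_mem' := fun a _ hx => (m ^ n).mul_mem_left (a ^ p ^ e) hx }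
    have hN : (m ^ n • ⊤ : Submodule R (FrobTwist p e R)) ≤ N := Submodule.smul_le.2 fun r hr y _ =>
      (m ^ n).mul_mem_right (FrobTwist.toBase p e R y)
        ((m ^ n).pow_mem_of_mem hr _ (pow_pos (Fact.out : p.Prime).pos e))
    have h3 : FrobTwist.toBase p e R x ∈ m ^ n := hN h
    simpa using h3⟩
  have h2 : Module.Finite R (FrobTwist p e R ⧸ (m • ⊤ : Submodule R (FrobTwist p e R))) := by
    have : Module.Finite R (FrobTwist p e R ⧸ LinearMap.ker g) :=
      Module.Finite.equiv g.quotKerEquivRange.symm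
    exact Module.Finite.of_surjective (Submodule.factor hg) (Submodule.factor_surjective hg)
  exact Module.Finite.of_isAdicComplete m _

end FFinite

/-! ### Existence of indecomposable decompositions -/

section Decomposition

variable {R X : Type*} [CommRing R] [AddCommGroup X] [Module R X]

/-- In a Noetherian module every submodule with property `P` is a finite direct sum of submodules
with property `P` that cannot be split further. -/
lemma exists_finset_indecomposable [IsNoetherian R X] (P : Submodule R X → Prop)
    (C N : Submodule R X) (hN : P N) (hNC : N ⊓ C = ⊥) :
    ∃ s : Finset (Submodule R X), s.SupIndep id ∧ s.sup id = N ∧ ∀ M ∈ s, P M ∧ M ≠ ⊥ ∧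
      ∀ A B : Submodule R X, P A → P B → A ⊔ B = M → A ⊓ B = ⊥ → A = ⊥ ∨ B = ⊥ := by
  classical
  -- Noetherian induction runs upwards on the complement `C`: splitting `N` into `A` and `B`
  -- enlarges the complement of `A` to `C ⊔ B`.
  induction C using WellFoundedGT.induction generalizing N with
  | ind C ih =>
    rcases eq_or_ne N ⊥ with rfl | hne
    · exact ⟨∅, by simp, by simp, by simp⟩
    by_cases hind : ∀ A B : Submodule R X, P A → P B → A ⊔ B = N → A ⊓ B = ⊥ → A = ⊥ ∨ B = ⊥
    · exact ⟨{N}, by simp, by simp, by simpa using ⟨hN, hne, hind⟩⟩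
    push Not at hind
    obtain ⟨A, B, hA, hB, hAB, hdisj, hA0, hB0⟩ := hind
    have step : ∀ A B : Submodule R X, P A → A ⊔ B = N → A ⊓ B = ⊥ → B ≠ ⊥ →
        ∃ s : Finset (Submodule R X), s.SupIndep id ∧ s.sup id = A ∧ ∀ M ∈ s, P M ∧ M ≠ ⊥ ∧
          ∀ A B : Submodule R X, P A → P B → A ⊔ B = M → A ⊓ B = ⊥ → A = ⊥ ∨ B = ⊥ := by
      intro A B hA hAB hdisj hB0
      have hBN : B ≤ N := hAB ▸ le_sup_right
      refine ih (C ⊔ B) (left_lt_sup.2 fun hBC => hB0 ?_) A hA ?_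
      · exact le_bot_iff.1 (hNC ▸ le_inf hBN hBC)
      · have h1 : Disjoint (A ⊔ B) C := by rwa [hAB, disjoint_iff]
        rw [sup_comm, ← disjoint_iff]
        exact Disjoint.disjoint_sup_right_of_disjoint_sup_left (disjoint_iff.2 hdisj) h1
    obtain ⟨s, hs1, hs2, hs3⟩ := step A B hA hAB hdisj hB0
    obtain ⟨t, ht1, ht2, ht3⟩ := step B A hB (by rwa [sup_comm]) (by rwa [inf_comm]) hA0
    refine ⟨s ∪ t, hs1.union ht1 ?_, ?_, ?_⟩
    · rw [hs2, ht2, disjoint_iff, hdisj]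
    · rw [Finset.sup_union, hs2, ht2, hAB]
    · intro M hM
      rcases Finset.mem_union.1 hM with h | h
      · exact hs3 M h
      · exact ht3 M h

lemma exists_internal_indecomposable [IsNoetherian R X] (P : Submodule R X → Prop) (hP : P ⊤) :
    ∃ (n : ℕ) (s : Fin n → Submodule R X), DirectSum.IsInternal s ∧ ∀ i, P (s i) ∧ s i ≠ ⊥ ∧
      ∀ A B : Submodule R X, P A → P B → A ⊔ B = s i → A ⊓ B = ⊥ → A = ⊥ ∨ B = ⊥ := by
  obtain ⟨s, hs1, hs2, hs3⟩ := exists_finset_indecomposable P ⊥ ⊤ hP (by simp)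
  refine ⟨s.card, fun i => (s.equivFin.symm i : Submodule R X), ?_, fun i => hs3 _ (Subtype.prop _)⟩
  rw [DirectSum.isInternal_submodule_iff_iSupIndep_and_iSup_eq_top]
  constructor
  · exact (iSupIndep_iff_supIndep_univ.2 (by simpa using hs1.attach)).comp s.equivFin.symm.injective
  · rw [Equiv.iSup_comp (g := fun i : s => (i : Submodule R X)) s.equivFin.symm, ← hs2,
      Finset.sup_eq_iSup, iSup_subtype]
    rfl

lemma nonempty_indecDecomposition [IsNoetherian R X] : Nonempty (IndecDecomposition R X) := by
  obtain ⟨n, s, hs, h⟩ := exists_internal_indecomposable (R := R) (X := X) (fun _ => True) trivial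
  refine ⟨⟨n, s, hs, fun i => ⟨Submodule.nontrivial_iff_ne_bot.2 (h i).2.1, fun A B hAB => ?_⟩⟩⟩
  have hinj := (s i).injective_subtype
  have := (h i).2.2 (A.map (s i).subtype) (B.map (s i).subtype) trivial trivial
    (by rw [← Submodule.map_sup, hAB.sup_eq_top, Submodule.map_subtype_top])
    (by rw [← Submodule.map_inf _ hinj, hAB.inf_eq_bot, Submodule.map_bot])
  have h0 := Submodule.map_injective_of_injective hinj
  exact this.imp (fun h => h0 (h.trans (Submodule.map_bot _).symm))
    (fun h => h0 (h.trans (Submodule.map_bot _).symm))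

lemma nonempty_gradedIndecDecomposition {k : Type*} [Field k] [Algebra k R] [Module k X]
    [IsScalarTower k R X] [IsNoetherian R X] (gr : ℚ → Submodule k X)
    (htop : IsGradedSubmodule gr (⊤ : Submodule R X)) :
    Nonempty (GradedIndecDecomposition (R := R) gr) := by
  obtain ⟨n, s, hs, h⟩ := exists_internal_indecomposable (IsGradedSubmodule (R := R) gr) htop
  exact ⟨⟨n, s, hs, h⟩⟩

end Decomposition

/-! ### The supremum as a minimum of integers -/

section Arithmetic

/-- By `h1` every member of `N` is at least the supremum `s`. By `h3` the quotients `a e / c e` are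
integers or infinite, so if `s` is finite its floor still bounds all of them, and `h2` yields a
member of `N` that is at most `s`. -/
lemma iSup_div_eq_sInf (N : Set ℕ∞) (a : ℕ → ℕ∞) (c : ℕ → ℕ) (hc : ∀ e, c e ≠ 0)
    (hfin : ∀ n ∈ N, n ≠ ⊤) (h1 : ∀ n ∈ N, ∀ e, a e ≤ n * c e)
    (h2 : ∀ u : ℕ, (∀ e, a e ≤ u * c e) → ∃ n ∈ N, n ≤ u)
    (h3 : ∀ e, a e = ⊤ ∨ ∃ b : ℕ, a e = b * c e) :
    ((sInf N : ℕ∞) : ℝ≥0∞) = ⨆ e, (a e : ℝ≥0∞) / (c e : ℝ≥0∞) ∧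
    (N = ∅ ↔ (⨆ e, (a e : ℝ≥0∞) / (c e : ℝ≥0∞)) = ⊤) := by
  have hle : ∀ n ∈ N, (⨆ e, (a e : ℝ≥0∞) / (c e : ℝ≥0∞)) ≤ ((n : ℕ∞) : ℝ≥0∞) := by
    intro n hn
    refine iSup_le fun e => ENNReal.div_le_of_le_mul ?_
    have := ENat.toENNReal_le.2 (h1 n hn e)
    rwa [ENat.toENNReal_mul] at this
  have hge : (⨆ e, (a e : ℝ≥0∞) / (c e : ℝ≥0∞)) ≠ ⊤ →
      ∃ n ∈ N, ((n : ℕ∞) : ℝ≥0∞) ≤ ⨆ e, (a e : ℝ≥0∞) / (c e : ℝ≥0∞) := by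
    intro hs
    set s := ⨆ e, (a e : ℝ≥0∞) / (c e : ℝ≥0∞) with hs'
    have hb : ∀ e, a e ≤ (⌊s.toNNReal⌋₊ : ℕ∞) * c e := by
      intro e
      have he : (a e : ℝ≥0∞) / (c e : ℝ≥0∞) ≤ s := le_iSup (fun e => (a e : ℝ≥0∞) / (c e : ℝ≥0∞)) e
      have hc0 : (c e : ℝ≥0∞) ≠ 0 := by exact_mod_cast hc e
      rcases h3 e with h | ⟨b, h⟩
      · rw [h, ENat.toENNReal_top, ENNReal.top_div_of_ne_top (ENNReal.natCast_ne_top _)] at he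
        exact absurd (top_le_iff.1 he) hs
      · rw [h] at he ⊢
        rw [ENat.toENNReal_mul, ENat.toENNReal_coe, ENat.toENNReal_coe,
          ENNReal.mul_div_cancel_right hc0 (ENNReal.natCast_ne_top _)] at he
        have : b ≤ ⌊s.toNNReal⌋₊ := Nat.le_floor (by
          rw [← ENNReal.coe_le_coe, ENNReal.coe_toNNReal hs]
          exact_mod_cast he)
        gcongr
    obtain ⟨n, hn, hnu⟩ := h2 _ hb
    refine ⟨n, hn, (ENat.toENNReal_le.2 hnu).trans ?_⟩
    rw [ENat.toENNReal_coe]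
    calc ((⌊s.toNNReal⌋₊ : ℕ) : ℝ≥0∞) = ((⌊s.toNNReal⌋₊ : NNReal) : ℝ≥0∞) := by simp
      _ ≤ (s.toNNReal : ℝ≥0∞) := ENNReal.coe_le_coe.2 (Nat.floor_le zero_le)
      _ = s := ENNReal.coe_toNNReal hs
  constructor
  · by_cases hs : (⨆ e, (a e : ℝ≥0∞) / (c e : ℝ≥0∞)) = ⊤
    · have : N = ∅ := by
        by_contra hne
        obtain ⟨n, hn⟩ := Set.nonempty_iff_ne_empty.2 hne
        have := hle n hn
        rw [hs, top_le_iff, ENat.toENNReal_eq_top] at this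
        exact hfin n hn this
      rw [hs, this, sInf_empty, ENat.toENNReal_top]
    · refine le_antisymm ?_ ?_
      · obtain ⟨n, hn, h⟩ := hge hs
        exact (ENat.toENNReal_le.2 (sInf_le hn)).trans h
      · obtain ⟨n, hn, h⟩ := hge hs
        exact hle _ (csInf_mem ⟨n, hn⟩)
  · constructor
    · intro h
      by_contra hs
      obtain ⟨n, hn, -⟩ := hge hs
      simp [h] at hn
    · intro hs
      by_contra hne
      obtain ⟨n, hn⟩ := Set.nonempty_iff_ne_empty.2 hne
      have := hle n hn
      rw [hs, top_le_iff, ENat.toENNReal_eq_top] at this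
      exact hfin n hn this

end Arithmetic

/-! ### From the levels `End(ᵉR)` to `D(R)` -/

section Levels

variable (p : ℕ) [Fact p.Prime] (A : Type v) (R : Type u) [CommRing A] [CommRing R] [CharP A p]
  [CharP R p] [IsNoetherianRing R] [Algebra A R]

/-- The action of the coefficients `A` on a module over `End(ᵉR) ≅ frobLevel p R e` through the
ring `D(R)`. -/
noncomputable def coeffEnd {e : ℕ} (hfin : (iterateFrobenius R p e).Finite) :
    A →+* Module.End R (FrobTwist p e R) :=
  (endEquivFrobLevel p R hfin).symm.toRingHom.comp
    (((toDZ R).comp (algebraMap A R)).codRestrict (frobLevel p R e)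
      fun a => toDZ_mem_frobLevel e (algebraMap A R a))

variable {A R}

/-- Thus the algebra action of `A` on a module over `End(ᵉR)` is the Frobenius twist of its action
through `D(R)`. -/
lemma coeffEnd_pow {e : ℕ} (hfin : (iterateFrobenius R p e).Finite) (a : A) :
    coeffEnd p A R hfin (a ^ p ^ e) = algebraMap A _ a := by
  refine (endEquivFrobLevel p R hfin).injective ?_
  refine ((endEquivFrobLevel p R hfin).apply_symm_apply _).trans (Subtype.ext ?_)
  change toDZ R (algebraMap A R (a ^ p ^ e)) = _
  rw [map_pow, ← endEquivFrobLevel_algebraMap p R hfin]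
  exact congrArg _ (congrArg _ (IsScalarTower.algebraMap_apply A R
      (Module.End R (FrobTwist p e R)) a).symm)

section Scale

variable {e c : ℕ} (hfin : (iterateFrobenius R p e).Finite) (W : Type u) [AddCommGroup W]
  [Module (Module.End R (FrobTwist p e R)) W] [Module A W]
  [IsScalarTower A (Module.End R (FrobTwist p e R)) W]

include hfin in
omit [Module A W] [IsScalarTower A (Module.End R (FrobTwist p e R)) W] in
lemma lengthVia_algebraMap_eq :
    letI : Module A W := Module.compHom W (coeffEnd p A R hfin)
    lengthVia (algebraMap A (Module.End R (FrobTwist p e R))) W =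
      Module.length A (FrobTwist p e W) := by
  let i1 : Module A W := Module.compHom W (coeffEnd p A R hfin)
  let i2 : Module A W := inferInstanceAs (Module A (FrobTwist p e W))
  exact @lengthVia_eq_length A _ W _ _ _ _ i2 _ fun a x =>
    congrArg (· • x) (coeffEnd_pow p hfin a)

lemma lengthVia_coeffEnd_le : lengthVia (coeffEnd p A R hfin) W ≤ Module.length A W := by
  rw [← lengthVia_eq_length (algebraMap A (Module.End R (FrobTwist p e R)))
    (fun a x => algebra_compatible_smul _ a x), lengthVia_algebraMap_eq p hfin W]
  exact @length_le_length_frobTwist p _ e A _ _ W _ (Module.compHom W (coeffEnd p A R hfin))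

omit [Module A W] [IsScalarTower A (Module.End R (FrobTwist p e R)) W] in
lemma lengthVia_algebraMap_eq_mul
    (hscale : ∀ (V : Type u) [AddCommGroup V] [Module A V], IsFiniteLength A V →
      Module.length A (FrobTwist p e V) = Module.length A V * (c : ℕ∞))
    (h : lengthVia (coeffEnd p A R hfin) W ≠ ⊤) :
    lengthVia (algebraMap A (Module.End R (FrobTwist p e R))) W =
      lengthVia (coeffEnd p A R hfin) W * c :=
  (lengthVia_algebraMap_eq p hfin W).trans
    (@hscale W _ (Module.compHom W (coeffEnd p A R hfin)) ((@Module.length_ne_top_iff A W _ _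
      (Module.compHom W (coeffEnd p A R hfin))).1 h))

lemma length_eq_lengthVia_coeffEnd_mul
    (hscale : ∀ (V : Type u) [AddCommGroup V] [Module A V], IsFiniteLength A V →
      Module.length A (FrobTwist p e V) = Module.length A V * (c : ℕ∞))
    (h : lengthVia (coeffEnd p A R hfin) W ≠ ⊤) :
    Module.length A W = lengthVia (coeffEnd p A R hfin) W * c := by
  rw [← lengthVia_algebraMap_eq_mul p hfin W hscale h]
  exact (lengthVia_eq_length _ (fun a x => algebra_compatible_smul _ a x)).symm

end Scale

/-- The quotient is a finite dimensional vector space over `B ⧸ m`. -/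
lemma isFiniteLength_quotient_span_algebraMap {B S : Type*} [CommRing B] [Ring S] [Algebra B S]
    [IsNoetherianRing B] [Module.Finite B S] (m : Ideal B) [m.IsMaximal] :
    IsFiniteLength S (S ⧸ Ideal.span {x : S | ∃ r ∈ m, x = algebraMap B S r}) := by
  set I := Ideal.span {x : S | ∃ r ∈ m, x = algebraMap B S r} with hI
  have htors : Module.IsTorsionBySet B (S ⧸ I) m := by
    rintro x ⟨r, hr⟩
    obtain ⟨x, rfl⟩ := Submodule.Quotient.mk_surjective I x
    change r • Submodule.Quotient.mk x = 0
    rw [← Submodule.Quotient.mk_smul, Submodule.Quotient.mk_eq_zero, Algebra.smul_def,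
      Algebra.commutes]
    exact I.mul_mem_left _ (Ideal.subset_span ⟨r, hr, rfl⟩)
  let _ : Field (B ⧸ m) := Ideal.Quotient.field m
  let _ : Module (B ⧸ m) (S ⧸ I) := htors.module
  have : IsScalarTower B (B ⧸ m) (S ⧸ I) := htors.isScalarTower
  have : Module.Finite (B ⧸ m) (S ⧸ I) := Module.Finite.of_restrictScalars_finite B _ _
  have : IsArtinian B (S ⧸ I) :=
    isArtinian_of_surjective_algebraMap (R := B ⧸ m) (S := B) (M := S ⧸ I)
        Ideal.Quotient.mk_surjective
  exact isFiniteLength_iff_isNoetherian_isArtinian.2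
    ⟨isNoetherian_of_tower B inferInstance, isArtinian_of_tower B this⟩

lemma isFiniteLength_frobLevel_quotient {e : ℕ} (hfin : (iterateFrobenius R p e).Finite)
    (m : Ideal R) [m.IsMaximal] :
    IsFiniteLength (frobLevel p R e) (frobLevel p R e ⧸ Ideal.span
      {x : frobLevel p R e | ∃ r ∈ m, (x : DZ R) = toDZ R r ^ p ^ e}) := by
  let φ : R →+* frobLevel p R e :=
    (endEquivFrobLevel p R hfin).toRingHom.comp (algebraMap R (Module.End R (FrobTwist p e R)))
  have hφ : ∀ r, (φ r : DZ R) = toDZ R r ^ p ^ e := fun r =>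
    (endEquivFrobLevel_algebraMap p R hfin r).trans (map_pow _ _ _)
  have hcomm : ∀ r x, φ r * x = x * φ r := fun r x => by
    obtain ⟨y, rfl⟩ := (endEquivFrobLevel p R hfin).surjective x
    change endEquivFrobLevel p R hfin _ * _ = _ * endEquivFrobLevel p R hfin _
    rw [← map_mul, ← map_mul, Algebra.commutes]
  let _ : Algebra R (frobLevel p R e) := φ.toAlgebra' hcomm
  have hX : Module.Finite R (FrobTwist p e R) := (moduleFinite_frobTwist_iff p e R).2 hfin
  let g : Module.End R (FrobTwist p e R) →ₗ[R] frobLevel p R e :=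
    { toFun := endEquivFrobLevel p R hfin
      map_add' := map_add _
      map_smul' := fun r x => by
        rw [Algebra.smul_def, Algebra.smul_def, map_mul]
        rfl }
  have hS : Module.Finite R (frobLevel p R e) :=
    Module.Finite.of_surjective g (endEquivFrobLevel p R hfin).surjective
  have h := isFiniteLength_quotient_span_algebraMap (S := frobLevel p R e) m
  have hset : {x : frobLevel p R e | ∃ r ∈ m, x = algebraMap R (frobLevel p R e) r} =
      {x : frobLevel p R e | ∃ r ∈ m, (x : DZ R) = toDZ R r ^ p ^ e} := by
    ext x
    refine exists_congr fun r => and_congr_right fun _ => ?_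
    rw [← hφ, ← Subtype.ext_iff]
    rfl
  rwa [hset] at h

lemma FiltrationData.exists_good {A R D : Type*} [Ring A] [CommRing R] [Ring D]
    {F : FiltrationData A R D} {e u : ℕ} (W : Type*) [AddCommGroup W] [Module (F.S e) W]
    [Nontrivial W] (hlen : lengthVia (F.φS e) W ≤ u)
    (htors : ∀ r ∈ F.m, ∀ w : W, ∃ n : ℕ, (⟨F.ψ r, F.ψ_mem r e⟩ : F.S e) ^ n • w = 0) :
    ∃ J, F.Good e u J := by
  obtain ⟨w, hw⟩ := exists_ne (0 : W)
  let f : F.S e →ₗ[F.S e] W := LinearMap.toSpanSingleton _ W w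
  refine ⟨LinearMap.ker f, fun h => hw ?_, le_trans ?_ hlen, fun r hr x => ?_⟩
  · have := (Ideal.eq_top_iff_one _).1 h
    rwa [LinearMap.mem_ker, LinearMap.toSpanSingleton_apply, one_smul] at this
  · exact lengthVia_le_of_injective _ _ ((LinearMap.ker f).liftQ f le_rfl).toAddMonoidHom
      (fun a x => ((LinearMap.ker f).liftQ f le_rfl).map_smul _ _)
      (LinearMap.ker_eq_bot.1 (Submodule.ker_liftQ_eq_bot _ _ _ le_rfl))
  · obtain ⟨n, hn⟩ := htors r hr (x • w)
    refine ⟨n, ?_⟩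
    rw [LinearMap.mem_ker, LinearMap.toSpanSingleton_apply, mul_smul, hn]

lemma lengthVia_congr {A B B' V : Type*} [Ring A] [Ring B] [Ring B'] [AddCommGroup V] [Module B V]
    [Module B' V] (φ : A →+* B) (φ' : A →+* B') (h : ∀ a (x : V), φ a • x = φ' a • x) :
    lengthVia φ V = lengthVia φ' V :=
  letI : Module A V := Module.compHom V φ'
  lengthVia_eq_length φ fun a x => (h a x).symm

variable (A)

/-- The filtration of `D(R)` by the rings `frobLevel p R e`. -/
noncomputable def frobFiltration (hfin : ∀ e, (iterateFrobenius R p e).Finite) (m : Ideal R)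
    [m.IsMaximal] : FiltrationData A R (DZ R) where
  S := frobLevel p R
  mono := frobLevel_mono
  exists_mem := exists_mem_frobLevel
  φ := (toDZ R).comp (algebraMap A R)
  φ_mem a e := toDZ_mem_frobLevel e _
  ψ := toDZ R
  ψ_mem r e := toDZ_mem_frobLevel e r
  m := m
  q e := p ^ e
  q_ne_zero e := pow_ne_zero e (Fact.out : p.Prime).ne_zero
  central e r x hx := by
    rw [← map_pow]
    refine Subtype.ext (LinearMap.ext fun y => ?_)
    exact (hx r y).symm
  finiteLength e := isFiniteLength_frobLevel_quotient p (hfin e) m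

variable {A}

omit [CharP A p] in
lemma exists_good_frobFiltration {e u : ℕ} (hfin : ∀ e, (iterateFrobenius R p e).Finite)
    (m : Ideal R) [m.IsMaximal] (W : Type u) [AddCommGroup W]
    [Module (Module.End R (FrobTwist p e R)) W]
    [Nontrivial W] (hlen : lengthVia (coeffEnd p A R (hfin e)) W ≤ u)
    (htors : ∀ r ∈ m, ∀ w : W, algebraMap R (Module.End R (FrobTwist p e R)) r • w = 0) :
    ∃ J, (frobFiltration p A hfin m).Good e u J := by
  let _ : Module ((frobFiltration p A hfin m).S e) W :=
    Module.compHom W (endEquivFrobLevel p R (hfin e)).symm.toRingHom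
  refine FiltrationData.exists_good W ((lengthVia_congr _ _ fun a x => rfl).trans_le hlen)
    fun r hr w => ⟨p ^ e, ?_⟩
  have key : (endEquivFrobLevel p R (hfin e)).symm
      ((⟨toDZ R r, toDZ_mem_frobLevel e r⟩ : frobLevel p R e) ^ p ^ e) =
        algebraMap R (Module.End R (FrobTwist p e R)) r := by
    rw [RingEquiv.symm_apply_eq]
    exact Subtype.ext ((map_pow _ _ _).symm.trans
      (endEquivFrobLevel_algebraMap p R (hfin e) r).symm)
  have h := htors r hr w
  rw [← key] at h
  exact h

/-- The bound `hLB` concerns the algebra action of `End(ᵉR)`, for which `W` is `c` times as long as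
through `D(R)`. -/
lemma le_lengthVia_mul {e c : ℕ} {a : ℕ∞} (hfin : (iterateFrobenius R p e).Finite)
    (hscale : ∀ (V : Type u) [AddCommGroup V] [Module A V], IsFiniteLength A V →
      Module.length A (FrobTwist p e V) = Module.length A V * (c : ℕ∞))
    (hLB : ∀ (W : Type u) [AddCommGroup W] [Module (Module.End R (FrobTwist p e R)) W]
      [Module A W] [IsScalarTower A (Module.End R (FrobTwist p e R)) W] [Nontrivial W],
      a ≤ Module.length A W)
    (W : Type u) [AddCommGroup W] [Module (DZ R) W] [Nontrivial W]
    (h : lengthVia ((toDZ R).comp (algebraMap A R)) W ≠ ⊤) :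
    a ≤ lengthVia ((toDZ R).comp (algebraMap A R)) W * c := by
  let _ : Module (Module.End R (FrobTwist p e R)) W :=
    Module.compHom W ((frobLevel p R e).subtype.comp (endEquivFrobLevel p R hfin).toRingHom)
  have heq : lengthVia (coeffEnd p A R hfin) W =
      lengthVia ((toDZ R).comp (algebraMap A R)) W :=
    lengthVia_congr _ _ fun a x => congrArg (fun y : frobLevel p R e => (y : DZ R) • x)
      ((endEquivFrobLevel p R hfin).apply_symm_apply
        ⟨toDZ R (algebraMap A R a), toDZ_mem_frobLevel e _⟩)
  let _ : Module A W := Module.compHom W (algebraMap A (Module.End R (FrobTwist p e R)))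
  have : IsScalarTower A (Module.End R (FrobTwist p e R)) W :=
    ⟨fun a f w => by rw [Algebra.smul_def, mul_smul]; rfl⟩
  rw [← heq] at h ⊢
  rw [← length_eq_lengthVia_coeffEnd_mul p hfin W hscale h]
  exact hLB W

/-- Length bounds at all finite levels determine the minimal length over `D(R)`. -/
theorem minimal_length_eq (hfin : ∀ e, (iterateFrobenius R p e).Finite) (m : Ideal R)
    [m.IsMaximal] (a : ℕ → ℕ∞) (c : ℕ → ℕ) (hc : ∀ e, c e ≠ 0)
    (hscale : ∀ e, ∀ (V : Type u) [AddCommGroup V] [Module A V], IsFiniteLength A V →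
      Module.length A (FrobTwist p e V) = Module.length A V * (c e : ℕ∞))
    (hLB : ∀ e, ∀ (W : Type u) [AddCommGroup W] [Module (Module.End R (FrobTwist p e R)) W]
      [Module A W] [IsScalarTower A (Module.End R (FrobTwist p e R)) W] [Nontrivial W],
      a e ≤ Module.length A W)
    (hUB : ∀ e, ∃ (W : Type u) (_ : AddCommGroup W)
      (_ : Module (Module.End R (FrobTwist p e R)) W) (_ : Module A W),
      IsScalarTower A (Module.End R (FrobTwist p e R)) W ∧ Nontrivial W ∧ Module.length A W = a e ∧
      ∀ r ∈ m, ∀ w : W, algebraMap R (Module.End R (FrobTwist p e R)) r • w = 0)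
    (N : Set ℕ∞) (hN : N = {n : ℕ∞ | ∃ (W : Type u) (_ : AddCommGroup W) (_ : Module (DZ R) W),
      Nontrivial W ∧ lengthVia ((toDZ R).comp (algebraMap A R)) W ≠ ⊤ ∧
        n = lengthVia ((toDZ R).comp (algebraMap A R)) W}) :
    ((sInf N : ℕ∞) : ℝ≥0∞) = ⨆ e, (a e : ℝ≥0∞) / (c e : ℝ≥0∞) ∧
    (N = ∅ ↔ (⨆ e, (a e : ℝ≥0∞) / (c e : ℝ≥0∞)) = ⊤) := by
  subst hN
  refine iSup_div_eq_sInf _ a c hc ?_ ?_ ?_ ?_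
  · rintro n ⟨W, _, _, _, hW, rfl⟩
    exact hW
  · rintro n ⟨W, _, _, _, hW, rfl⟩ e
    exact le_lengthVia_mul p (hfin e) (hscale e) (hLB e) W hW
  · intro u hu
    have hgood : ∀ e, ∃ J, (frobFiltration p A hfin m).Good e u J := by
      intro e
      obtain ⟨W, _, _, _, _, _, hW, hm⟩ := hUB e
      have hne : lengthVia (coeffEnd p A R (hfin e)) W ≠ ⊤ := by
        refine ne_top_of_le_ne_top ?_ (lengthVia_coeffEnd_le p (hfin e) W)
        rw [hW]
        exact ne_top_of_le_ne_top (WithTop.mul_ne_top (ENat.natCast_ne_top _)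
          (ENat.natCast_ne_top _)) (hu e)
      refine exists_good_frobFiltration p hfin m W ?_ hm
      have h1 := hu e
      rw [← hW, length_eq_lengthVia_coeffEnd_mul p (hfin e) W (hscale e) hne] at h1
      exact (ENat.mul_le_mul_right_iff (by exact_mod_cast hc e) (ENat.natCast_ne_top _)).1 h1
    obtain ⟨J, hJ, hlen⟩ := FiltrationData.exists_of_forall_good hgood
    have : Nontrivial (DZ R ⧸ J) := Submodule.Quotient.nontrivial_iff.2 hJ
    exact ⟨_, ⟨DZ R ⧸ J, inferInstance, inferInstance, this,
      ne_top_of_le_ne_top (ENat.natCast_ne_top u) hlen, rfl⟩, hlen⟩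
  -- The witness of length `a e` has either infinite length through `D(R)`, or finite length `b`
  -- with `a e = b * c e`; this is the integrality that permits rounding.
  · intro e
    obtain ⟨W, _, _, _, _, _, hW, hm⟩ := hUB e
    by_cases h : lengthVia (coeffEnd p A R (hfin e)) W = ⊤
    · left
      rw [← hW]
      exact top_le_iff.1 (h ▸ lengthVia_coeffEnd_le p (hfin e) W)
    · right
      obtain ⟨b, hb⟩ := ENat.ne_top_iff_exists.1 h
      refine ⟨b, ?_⟩
      rw [← hW, length_eq_lengthVia_coeffEnd_mul p (hfin e) W (hscale e) h, hb]

end Levels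

lemma eq_iSup_of_toENNReal_eq {n : ℕ∞} {P : Prop} {a : ℕ → ℕ∞} {c : ℕ → ℕ} (hc : ∀ e, c e = 1)
    (h : (n : ℝ≥0∞) = ⨆ e, (a e : ℝ≥0∞) / (c e : ℝ≥0∞))
    (h' : P ↔ (⨆ e, (a e : ℝ≥0∞) / (c e : ℝ≥0∞)) = ⊤) :
    n = ⨆ e, a e ∧ (P ↔ (⨆ e, a e) = ⊤) := by
  have hs : (⨆ e, (a e : ℝ≥0∞) / (c e : ℝ≥0∞)) = ((⨆ e, a e : ℕ∞) : ℝ≥0∞) := by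
    simp [hc, ENat.toENNReal_iSup]
  rw [hs] at h h'
  exact ⟨ENat.toENNReal_inj.1 h, h'.trans ENat.toENNReal_eq_top⟩

/-- If `c` is a right inverse of `f ∘ g`, then `g ∘ c ∘ f` is a nonzero idempotent of the
indecomposable `N`, hence the identity. So maps that factor through a non-isomorphic summand are not
units. -/
lemma IsIndecomposableModule.bijective_of_isUnit_comp {R M N : Type*} [CommRing R]
    [AddCommGroup M] [AddCommGroup N] [Module R M] [Module R N] [Nontrivial M]
    (hN : IsIndecomposableModule R N) (g : M →ₗ[R] N) (f : N →ₗ[R] M)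
    (h : IsUnit (f ∘ₗ g : Module.End R M)) : Function.Bijective f := by
  obtain ⟨c, hc⟩ := h.exists_right_inv
  have hc' : ∀ x, f (g (c x)) = x := fun x => LinearMap.congr_fun hc x
  refine ⟨?_, fun x => ⟨g (c x), hc' x⟩⟩
  rcases exists_isCompl_of_idempotent hN (g ∘ₗ c ∘ₗ f) (by ext x; simp [hc']) with h0 | h1
  · obtain ⟨x, hx⟩ := exists_ne (0 : M)
    refine absurd ?_ hx
    have := congrArg f (LinearMap.congr_fun h0 (g (c x)))
    simpa [hc'] using this
  · intro x y hxy
    have hx := LinearMap.congr_fun h1 x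
    have hy := LinearMap.congr_fun h1 y
    simp only [LinearMap.comp_apply, Module.End.one_apply, hxy] at hx hy
    exact hx.symm.trans hy

/-! ### The complete local case -/

section RepDim

variable (p : ℕ) [Fact p.Prime] {R : Type u} [CommRing R]

lemma isFiniteDimRep_iff {W : Type*} [AddCommGroup W] [Module (DZ R) W] :
    IsFiniteDimRep R W ↔ lengthVia (toDZ R) W ≠ ⊤ :=
  letI : Module R W := Module.compHom W (toDZ R)
  (Module.length_ne_top_iff (R := R) (M := W)).symm

lemma Ideal.Quotient.mk_jacobson_eq_zero {Λ : Type*} [Ring Λ] [IsLocalRing Λ] {f : Λ}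
    (h : ¬ IsUnit f) : Ideal.Quotient.mk (Ring.jacobson Λ) f = 0 :=
  Ideal.Quotient.eq_zero_iff_mem.2 (mem_jacobson_of_not_isUnit h)

lemma Ring.nontrivial_quotient_jacobson (Λ : Type*) [Ring Λ] [Nontrivial Λ] :
    Nontrivial (Λ ⧸ Ring.jacobson Λ) := by
  exact Submodule.Quotient.nontrivial_iff.2 (Ring.jacobson_lt_top Λ).ne

lemma not_isUnit_algebraMap_end [IsLocalRing R] {M : Type*} [AddCommGroup M] [Module R M]
    [Module.Finite R M] [Nontrivial M] {r : R} (hr : r ∈ IsLocalRing.maximalIdeal R) :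
    ¬ IsUnit (algebraMap R (Module.End R M) r) := by
  intro h
  have hs := ((Module.End.isUnit_iff _).1 h).2
  have htop : (⊤ : Submodule R M) = ⊥ := by
    refine Submodule.eq_bot_of_le_smul_of_le_jacobson_bot (IsLocalRing.maximalIdeal R) _
      Module.Finite.fg_top (fun x _ => ?_) (IsLocalRing.maximalIdeal_le_jacobson _)
    obtain ⟨y, rfl⟩ := hs x
    exact Submodule.smul_mem_smul hr trivial
  exact top_ne_bot htop

/-- The coefficients are `A = R`. The local ring `End(Mᵢ)` itself gives the lower bound, its residue
division ring the upper one; the maximal ideal acts as zero there by Nakayama's lemma. -/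
theorem repDim_of_complete [IsLocalRing R] [IsNoetherianRing R]
    [IsAdicComplete (IsLocalRing.maximalIdeal R) R] [CharP R p]
    [CharP (IsLocalRing.ResidueField R) p] (hk : (frobenius (IsLocalRing.ResidueField R) p).Finite)
    (D : ∀ e : ℕ, IndecDecomposition R (FrobTwist p e R)) :
    ((minRepDimLocal R : ℝ≥0∞) =
      ⨆ e : ℕ, ((D e).minDim : ℝ≥0∞) / (frobDegree p e (IsLocalRing.ResidueField R) : ℝ≥0∞)) ∧
    (¬ HasFiniteDimRep R ↔
      (⨆ e : ℕ, ((D e).minDim : ℝ≥0∞) /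
        (frobDegree p e (IsLocalRing.ResidueField R) : ℝ≥0∞)) = ⊤) := by
  have hX : ∀ e, Module.Finite R (FrobTwist p e R) :=
    fun e => finite_frobTwist_of_isAdicComplete p R e hk
  have hM : ∀ e i, IsLocalRing (Module.End R ((D e).summand i)) := fun e i =>
    ((D e).indecomposable i).isLocalRing_end
  have hLB : ∀ e, ∀ (W : Type u) [AddCommGroup W] [Module (Module.End R (FrobTwist p e R)) W]
      [Module R W] [IsScalarTower R (Module.End R (FrobTwist p e R)) W] [Nontrivial W],
      (D e).minDim ≤ Module.length R W := by
    intro e W _ _ _ _ _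
    obtain ⟨i, hi⟩ := exists_mul_length_residue_le (A := R) (D e).isInternal
      (fun j i => Nonempty ((D e).summand j ≃ₗ[R] (D e).summand i)) (fun _ _ h => h)
      (fun i => Module.End R ((D e).summand i)) (fun i => AlgHom.id R _) W
    exact (iInf_le _ i).trans hi
  have hUB : ∀ e, ∃ (W : Type u) (_ : AddCommGroup W)
      (_ : Module (Module.End R (FrobTwist p e R)) W) (_ : Module R W),
      IsScalarTower R (Module.End R (FrobTwist p e R)) W ∧ Nontrivial W ∧
      Module.length R W = (D e).minDim ∧ ∀ r ∈ IsLocalRing.maximalIdeal R, ∀ w : W,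
        algebraMap R (Module.End R (FrobTwist p e R)) r • w = 0 := by
    intro e
    have hne : Nonempty (Fin (D e).n) := by
      by_contra hempty
      rw [not_nonempty_iff] at hempty
      have : Nontrivial (FrobTwist p e R) := inferInstanceAs (Nontrivial R)
      have := (D e).isInternal.submodule_iSup_eq_top
      rw [iSup_of_empty] at this
      exact bot_ne_top this
    obtain ⟨i, hi⟩ := exists_eq_ciInf_of_finite (f := fun i : Fin (D e).n =>
      endResidueLength R ((D e).summand i) * ((D e).mult i : ℕ∞))
    have := ((D e).indecomposable i).1
    have := Ring.nontrivial_quotient_jacobson (Module.End R ((D e).summand i))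
    obtain ⟨W, i1, i2, i3, h1, h2, h3, h4⟩ := exists_module_of_residue (A := R) (D e).isInternal i
      (fun j => Nonempty ((D e).summand j ≃ₗ[R] (D e).summand i)) ⟨LinearEquiv.refl _ _⟩
      (fun j ⟨f⟩ => ⟨f.symm⟩) (Ideal.Quotient.mk (Ring.jacobson (Module.End R ((D e).summand i))))
      Ideal.Quotient.mk_surjective (fun a f => rfl)
      (fun j hj g f => Ideal.Quotient.mk_jacobson_eq_zero fun hu => hj
        ⟨LinearEquiv.ofBijective f
          (((D e).indecomposable j).bijective_of_isUnit_comp g f hu)⟩)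
    exact ⟨W, i1, i2, i3, h1, h2, h3.trans hi, fun r hr =>
      h4 r (Ideal.Quotient.mk_jacobson_eq_zero (not_isUnit_algebraMap_end hr))⟩
  obtain ⟨h1, h2⟩ := minimal_length_eq (A := R) p
    (fun e => (moduleFinite_frobTwist_iff p e R).1 (hX e)) (IsLocalRing.maximalIdeal R)
    (fun e => (D e).minDim) (fun e => frobDegree p e (IsLocalRing.ResidueField R))
    (fun e => frobDegree_ne_zero p e hk) (fun e V _ _ hV => length_frobTwist_of_isLocalRing p e hk
        hV)
    hLB hUB _ rfl
  have hN : ∀ (W : Type u) [AddCommGroup W] [Module (DZ R) W],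
    IsFiniteDimRep R W ↔ lengthVia ((toDZ R).comp (algebraMap R R)) W ≠ ⊤ :=
    fun W => isFiniteDimRep_iff
  refine ⟨Eq.trans ?_ h1, Iff.trans ?_ h2⟩
  · refine congrArg (fun s : Set ℕ∞ => ((sInf s : ℕ∞) : ℝ≥0∞)) ?_
    ext n
    refine exists_congr fun W => exists_congr fun _ => exists_congr fun _ => ?_
    rw [hN]
    rfl
  · rw [Set.eq_empty_iff_forall_notMem]
    constructor
    · rintro h n ⟨W, i1, i2, h3, h4, -⟩
      exact h ⟨W, i1, i2, h3, isFiniteDimRep_iff.2 h4⟩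
    · rintro h ⟨W, i1, i2, h3, h4⟩
      exact h _ ⟨W, i1, i2, h3, isFiniteDimRep_iff.1 h4, rfl⟩

end RepDim

/-! ### Homogeneous components of linear maps -/

section HomogeneousComponents

variable {k R : Type*} [Field k] [CommRing R] [Algebra k R] (𝒜 : ℕ → Submodule k R)
  {M N L : Type*} [AddCommGroup M] [Module R M] [Module k M]
  [AddCommGroup N] [Module R N] [Module k N]
  [AddCommGroup L] [Module R L] [Module k L]

/-- `P α` is the projection to degree `α` for a `ℚ`-grading, bounded below, of a module over
the graded ring `R`. -/
structure IsGradingProj (P : ℚ → M →ₗ[k] M) : Prop where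
  apply_self : ∀ α x, P α (P α x) = P α x
  apply_ne : ∀ α β, α ≠ β → ∀ x, P α (P β x) = 0
  finite : ∀ x, {α | P α x ≠ 0}.Finite
  finsum_eq : ∀ x, ∑ᶠ α, P α x = x
  smul : ∀ n, ∀ r ∈ 𝒜 n, ∀ α x, P (α + n) (r • x) = r • P α x
  bddBelow : ∃ b, ∀ α < b, P α = 0

/-- `f` raises degrees by `δ`. -/
def IsHomogeneousMap (P : ℚ → M →ₗ[k] M) (Q : ℚ → N →ₗ[k] N) (δ : ℚ) (f : M →ₗ[R] N) : Prop :=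
  ∀ α x, P α x = x → Q (α + δ) (f x) = f x

variable {𝒜} {P : ℚ → M →ₗ[k] M} {Q : ℚ → N →ₗ[k] N} {T : ℚ → L →ₗ[k] L}

namespace IsGradingProj

include 𝒜

lemma induction (hP : IsGradingProj 𝒜 P) {C : M → Prop} (h0 : C 0)
    (hadd : ∀ x y, C x → C y → C (x + y)) (h : ∀ α x, P α x = x → C x) (x : M) : C x := by
  rw [← hP.finsum_eq x]
  exact finsum_induction C h0 hadd fun α => h α _ (hP.apply_self α x)

omit [Module k N] in
lemma hom_ext (hP : IsGradingProj 𝒜 P) {f g : M →ₗ[R] N} (h : ∀ α x, P α x = x → f x = g x) :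
    f = g :=
  LinearMap.ext (hP.induction (by simp) (fun x y hx hy => by simp [hx, hy]) h)

lemma eq_of_homogeneous (hP : IsGradingProj 𝒜 P) {α β : ℚ} {x : M} (hx : P α x = x) (h : β ≠ α) :
    P β x = 0 := by
  rw [← hx, hP.apply_ne _ _ h]

lemma apply_map (hP : IsGradingProj 𝒜 P) (hQ : IsGradingProj 𝒜 Q) {δ : ℚ} {f : M →ₗ[R] N}
    (hf : IsHomogeneousMap P Q δ f) (β : ℚ) (x : M) : Q (β + δ) (f x) = f (P β x) := by
  refine hP.induction (C := fun x => Q (β + δ) (f x) = f (P β x)) (by simp)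
    (fun x y hx hy => by simp [hx, hy]) (fun α x hx => ?_) x
  by_cases h : β = α
  · rw [h, hf α x hx, hx]
  · rw [hP.eq_of_homogeneous hx h, map_zero, ← hf α x hx,
      hQ.apply_ne _ _ (fun h' => h (add_right_cancel h'))]

lemma finite_comp (hP : IsGradingProj 𝒜 P) (δ : ℚ) (f : M →ₗ[R] N) (x : M) :
    (fun α => Q (α + δ) (f (P α x))).HasFiniteSupport :=
  (hP.finite x).subset fun α h h0 => h (by simp [h0])

lemma exists_ne_zero (hP : IsGradingProj 𝒜 P) [Nontrivial M] : ∃ α x, x ≠ 0 ∧ P α x = x := by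
  by_contra! h
  obtain ⟨x, hx⟩ := exists_ne (0 : M)
  refine hx (hP.induction (C := fun x => x = 0) rfl (fun x y hx hy => by rw [hx, hy, add_zero])
      (fun α x hx => ?_) x)
  by_contra h0
  exact h α x h0 hx

variable [GradedAlgebra 𝒜]

/-- The component of degree `δ` of a linear map. -/
noncomputable def component (hP : IsGradingProj 𝒜 P) (hQ : IsGradingProj 𝒜 Q) (δ : ℚ)
    (f : M →ₗ[R] N) : M →ₗ[R] N where
  toFun x := ∑ᶠ α, Q (α + δ) (f (P α x))
  map_add' x y := by
    simp only [map_add]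
    exact finsum_add_distrib (hP.finite_comp δ f x) (hP.finite_comp δ f y)
  map_smul' r x := by
    have hadd : ∀ x y, (∑ᶠ α, Q (α + δ) (f (P α (x + y)))) =
        (∑ᶠ α, Q (α + δ) (f (P α x))) + ∑ᶠ α, Q (α + δ) (f (P α y)) := fun x y => by
      simp only [map_add]
      exact finsum_add_distrib (hP.finite_comp δ f x) (hP.finite_comp δ f y)
    rw [RingHom.id_apply]
    induction r using DirectSum.Decomposition.inductionOn 𝒜 with
    | zero => simp
    | @homogeneous n r =>
      rw [smul_finsum' _ (hP.finite_comp δ f x), ← finsum_comp_equiv (Equiv.addRight (n : ℚ))]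
      refine finsum_congr fun α => ?_
      rw [Equiv.coe_addRight, hP.smul n r r.2, map_smul, add_right_comm, hQ.smul n r r.2]
    | add r s hr hs => rw [add_smul, hadd, hr, hs, add_smul]

lemma component_apply (hP : IsGradingProj 𝒜 P) (hQ : IsGradingProj 𝒜 Q) (δ : ℚ) (f : M →ₗ[R] N)
    {α : ℚ} {x : M} (hx : P α x = x) : hP.component hQ δ f x = Q (α + δ) (f x) := by
  change ∑ᶠ β, Q (β + δ) (f (P β x)) = _
  rw [finsum_eq_single _ α, hx]
  intro β hβ
  rw [hP.eq_of_homogeneous hx hβ, map_zero, map_zero]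

lemma isHomogeneousMap_component (hP : IsGradingProj 𝒜 P) (hQ : IsGradingProj 𝒜 Q) (δ : ℚ)
    (f : M →ₗ[R] N) : IsHomogeneousMap P Q δ (hP.component hQ δ f) := fun α x hx => by
  rw [hP.component_apply hQ δ f hx, hQ.apply_self]

lemma component_eq_self (hP : IsGradingProj 𝒜 P) (hQ : IsGradingProj 𝒜 Q) {δ : ℚ}
    {f : M →ₗ[R] N} (hf : IsHomogeneousMap P Q δ f) : hP.component hQ δ f = f :=
  hP.hom_ext fun α x hx => by rw [hP.component_apply hQ δ f hx, hf α x hx]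

lemma component_add (hP : IsGradingProj 𝒜 P) (hQ : IsGradingProj 𝒜 Q) (δ : ℚ) (f g : M →ₗ[R] N) :
    hP.component hQ δ (f + g) = hP.component hQ δ f + hP.component hQ δ g :=
  hP.hom_ext fun α x hx => by
    simp [hP.component_apply hQ δ _ hx]

lemma finsum_component (hP : IsGradingProj 𝒜 P) (hQ : IsGradingProj 𝒜 Q) (f : M →ₗ[R] N) {α : ℚ}
    {x : M} (hx : P α x = x) : ∑ᶠ δ, hP.component hQ δ f x = f x :=
  (finsum_congr fun δ => hP.component_apply hQ δ f hx).trans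
    ((finsum_comp_equiv (Equiv.addLeft α) (f := fun β => Q β (f x))).trans (hQ.finsum_eq _))

/-- A component is determined by its values on finitely many generators, and only finitely many
degrees occur in these and in the images of their components. -/
lemma finite_component [Module.Finite R M] (hP : IsGradingProj 𝒜 P) (hQ : IsGradingProj 𝒜 Q)
    (f : M →ₗ[R] N) : {δ | hP.component hQ δ f ≠ 0}.Finite := by
  obtain ⟨S, hS⟩ := Module.Finite.fg_top (R := R) (M := M)
  refine (S.finite_toSet.biUnion fun s _ => (hP.finite s).biUnion fun α _ =>
    (hQ.finite (f (P α s))).preimage (add_right_injective α).injOn).subset fun δ hδ => ?_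
  by_contra hnot
  refine hδ (LinearMap.ext_on hS fun s hs => ?_)
  change ∑ᶠ α, Q (α + δ) (f (P α s)) = 0
  refine finsum_eq_zero_of_forall_eq_zero fun α => ?_
  by_contra h
  refine hnot (Set.mem_biUnion hs (Set.mem_biUnion (x := α) ?_ h))
  intro h0
  exact h (by simp [h0])

lemma component_zero_comp [Module.Finite R M] (hP : IsGradingProj 𝒜 P) (hQ : IsGradingProj 𝒜 Q)
    (hT : IsGradingProj 𝒜 T) (f : N →ₗ[R] L) (g : M →ₗ[R] N) :
    hP.component hT 0 (f ∘ₗ g) = ∑ δ ∈ (hP.finite_component hQ g).toFinset,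
      hQ.component hT (-δ) f ∘ₗ hP.component hQ δ g := by
  refine hP.hom_ext fun α x hx => ?_
  have hg : g x = ∑ δ ∈ (hP.finite_component hQ g).toFinset, hP.component hQ δ g x := by
    rw [← finsum_eq_finsetSum_of_support_subset, hP.finsum_component hQ g hx]
    intro δ hδ
    simp only [Set.Finite.coe_toFinset, Set.mem_ofPred_eq]
    intro h0
    exact hδ (by simp [h0])
  rw [hP.component_apply hT 0 _ hx, LinearMap.comp_apply, hg, map_sum, map_sum, LinearMap.sum_apply]
  refine Finset.sum_congr rfl fun δ _ => ?_
  rw [LinearMap.comp_apply,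
    hQ.component_apply hT (-δ) f (hP.isHomogeneousMap_component hQ δ g α x hx),
    add_neg_cancel_right, add_zero]

omit [GradedAlgebra 𝒜] in
/-- A homogeneous endomorphism of negative degree is not injective. -/
lemma not_injective_of_neg (hP : IsGradingProj 𝒜 P) [Nontrivial M] {δ : ℚ} (hδ : δ < 0)
    {f : M →ₗ[R] M} (hf : IsHomogeneousMap P P δ f) : ¬ Function.Injective f := by
  intro hinj
  obtain ⟨α, x, hx0, hx⟩ := hP.exists_ne_zero
  obtain ⟨b, hb⟩ := hP.bddBelow
  have hit : ∀ n : ℕ, P (α + n * δ) (f^[n] x) = f^[n] x := by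
    intro n
    induction n with
    | zero => simpa using hx
    | succ n ih =>
      have := hf _ _ ih
      rw [Function.iterate_succ_apply', ← this]
      congr 2
      push_cast
      ring
  -- With this `n` the iterate lands in degree `α + n * δ < b`, where the module is zero.
  obtain ⟨n, hn⟩ := exists_nat_gt ((α - b) / -δ)
  rw [div_lt_iff₀ (by linarith)] at hn
  have := hit n
  rw [hb _ (by linarith), LinearMap.zero_apply] at this
  refine hx0 (hinj.iterate n ?_)
  rw [← this, Function.iterate_fixed (map_zero f)]

end IsGradingProj

omit [Algebra k R] in
/-- Maps between modules without nontrivial degree preserving idempotents that compose to an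
automorphism are bijective. -/
lemma IsHomogeneousMap.bijective_of_comp [Nontrivial M]
    (hN : ∀ e : N →ₗ[R] N, IsHomogeneousMap Q Q 0 e → e ∘ₗ e = e → e = 0 ∨ e = LinearMap.id)
    {δ : ℚ} {f : N →ₗ[R] M} {g : M →ₗ[R] N} {c : M →ₗ[R] M} (hf : IsHomogeneousMap Q P (-δ) f)
    (hg : IsHomogeneousMap P Q δ g) (hc : IsHomogeneousMap P P 0 c)
    (h : f ∘ₗ g ∘ₗ c = LinearMap.id) : Function.Bijective f := by
  have hc' : ∀ x, f (g (c x)) = x := fun x => LinearMap.congr_fun h x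
  refine ⟨?_, fun x => ⟨g (c x), hc' x⟩⟩
  have hdeg : IsHomogeneousMap Q Q 0 (g ∘ₗ c ∘ₗ f) := fun α x hx => by
    have := hg _ _ (hc _ _ (hf α x hx))
    simpa using this
  rcases hN (g ∘ₗ c ∘ₗ f) hdeg (by ext x; simp [hc']) with h0 | h1
  · obtain ⟨x, hx⟩ := exists_ne (0 : M)
    refine absurd ?_ hx
    have := congrArg f (LinearMap.congr_fun h0 (g (c x)))
    simpa [hc'] using this
  · intro x y hxy
    have hx := LinearMap.congr_fun h1 x
    have hy := LinearMap.congr_fun h1 y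
    simp only [LinearMap.comp_apply, LinearMap.id_apply, hxy] at hx hy
    exact hx.symm.trans hy


end HomogeneousComponents

lemma Ideal.Quotient.mk_finsetSum {Λ ι : Type*} [Ring Λ] (J : Ideal Λ) [J.IsTwoSided]
    (s : Finset ι) (f : ι → Λ) :
    Ideal.Quotient.mk J (∑ i ∈ s, f i) = ∑ i ∈ s, Ideal.Quotient.mk J (f i) :=
  map_sum _ _ _

/-! ### Degree preserving endomorphisms and the residue map -/

section HomogeneousEnd

variable {k R : Type*} [Field k] [CommRing R] [Algebra k R] {𝒜 : ℕ → Submodule k R}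
  [GradedAlgebra 𝒜] {M N : Type*} [AddCommGroup M] [Module R M] [Module k M] [IsScalarTower k R M]
  [AddCommGroup N] [Module R N] [Module k N]
  {P : ℚ → M →ₗ[k] M} {Q : ℚ → N →ₗ[k] N}

namespace IsGradingProj

omit [IsScalarTower k R M] in
lemma apply_smul_eq_zero (hP : IsGradingProj 𝒜 P) {r : R} {β : ℚ} {x : M}
    (h : ∀ n : ℕ, GradedRing.proj 𝒜 n r = 0 ∨ P (β - n) x = 0) : P β (r • x) = 0 := by
  classical
  rw [← DirectSum.sum_support_decompose 𝒜 r, Finset.sum_smul, map_sum]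
  refine Finset.sum_eq_zero fun n _ => ?_
  have := hP.smul n _ (DirectSum.decompose 𝒜 r n).2 (β - n) x
  rw [sub_add_cancel] at this
  rw [this]
  rcases h n with h | h
  · rw [GradedRing.proj_apply] at h
    rw [h, zero_smul]
  · rw [h, smul_zero]

/-- The elements of degree at least `b`. -/
def degreeGE (hP : IsGradingProj 𝒜 P) (b : ℚ) : Submodule R M where
  carrier := {x | ∀ β < b, P β x = 0}
  add_mem' hx hy β hβ := by rw [map_add, hx β hβ, hy β hβ, add_zero]
  zero_mem' β _ := map_zero _
  smul_mem' r x hx β hβ := hP.apply_smul_eq_zero fun n => Or.inr (hx _ (by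
    have : (0 : ℚ) ≤ n := n.cast_nonneg
    linarith))

omit [IsScalarTower k R M] in
lemma irrelevant_pow_smul_top_le (hP : IsGradingProj 𝒜 P) {b : ℚ} (hb : ∀ α < b, P α = 0) (n : ℕ) :
    (HomogeneousIdeal.irrelevant 𝒜).toIdeal ^ n • (⊤ : Submodule R M) ≤ hP.degreeGE (b + n) := by
  induction n with
  | zero =>
    intro x _ β hβ
    rw [hb β (by simpa using hβ), LinearMap.zero_apply]
  | succ n ih =>
    rw [pow_succ', ← smul_eq_mul, Submodule.smul_assoc]
    refine (Submodule.smul_mono le_rfl ih).trans (Submodule.smul_le.2 fun r hr x hx β hβ => ?_)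
    refine hP.apply_smul_eq_zero fun m => ?_
    rcases Nat.eq_zero_or_pos m with rfl | hm
    · exact Or.inl ((HomogeneousIdeal.mem_irrelevant_iff 𝒜 r).1 hr)
    · refine Or.inr (hx _ ?_)
      have : (1 : ℚ) ≤ m := by exact_mod_cast hm
      push_cast at hβ
      linarith

end IsGradingProj

lemma Module.Finite.of_pow_smul_eq_bot {B : Type*} [CommRing B] [Algebra k B] [IsNoetherianRing B]
    (m : Ideal B) (hm : Function.Surjective (algebraMap k (B ⧸ m))) (n : ℕ) :
    ∀ (V : Type*) [AddCommGroup V] [Module B V] [Module k V] [IsScalarTower k B V]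
      [Module.Finite B V], m ^ n • (⊤ : Submodule B V) = ⊥ → Module.Finite k V := by
  induction n with
  | zero =>
    intro V _ _ _ _ _ h
    rw [pow_zero, Ideal.one_eq_top, Submodule.top_smul] at h
    have : Subsingleton V := (Submodule.subsingleton_iff B).1 (subsingleton_of_bot_eq_top h.symm)
    infer_instance
  | succ n ih =>
    intro V _ _ _ _ _ h
    let L : Submodule B V := m • ⊤
    have hL : Module.Finite k L := by
      refine ih L (Submodule.map_injective_of_injective L.injective_subtype ?_)
      rw [Submodule.map_smul'', Submodule.map_top, Submodule.range_subtype, Submodule.map_bot, ← h,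
        pow_succ, ← smul_eq_mul, Submodule.smul_assoc]
    have hQ : Module.Finite k (V ⧸ L) := by
      have h1 : Module.Finite k (B ⧸ m) :=
        Module.Finite.of_surjective (Algebra.linearMap k (B ⧸ m)) hm
      have h2 : IsScalarTower k (B ⧸ m) (V ⧸ L) := by
        refine ⟨fun c x y => ?_⟩
        obtain ⟨x, rfl⟩ := Ideal.Quotient.mk_surjective x
        obtain ⟨y, rfl⟩ := Submodule.Quotient.mk_surjective _ y
        change Submodule.Quotient.mk ((c • x) • y) = c • Submodule.Quotient.mk (x • y)
        rw [smul_assoc]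
        rfl
      have h3 : Module.Finite (B ⧸ m) (V ⧸ L) := Module.Finite.of_restrictScalars_finite B _ _
      exact Module.Finite.trans (B ⧸ m) _
    have : Module.Finite k (V ⧸ L.restrictScalars k) := hQ
    have : Module.Finite k (L.restrictScalars k) := hL
    exact Module.Finite.of_submodule_quotient (L.restrictScalars k)

lemma algebraMap_quotient_irrelevant_surjective (h0 : ∀ x ∈ 𝒜 0, ∃ c : k, algebraMap k R c = x) :
    Function.Surjective (algebraMap k (R ⧸ (HomogeneousIdeal.irrelevant 𝒜).toIdeal)) := by
  intro x
  obtain ⟨x, rfl⟩ := Ideal.Quotient.mk_surjective x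
  obtain ⟨c, hc⟩ := h0 (GradedRing.proj 𝒜 0 x) (SetLike.coe_mem _)
  refine ⟨c, ?_⟩
  rw [IsScalarTower.algebraMap_apply k R, hc, Ideal.Quotient.algebraMap_eq,
      Ideal.Quotient.mk_eq_mk_iff_sub_mem,
    HomogeneousIdeal.toIdeal_irrelevant, RingHom.mem_ker, map_sub, sub_eq_zero]
  simp

lemma irrelevant_isMaximal [Nontrivial R] (h0 : ∀ x ∈ 𝒜 0, ∃ c : k, algebraMap k R c = x) :
    (HomogeneousIdeal.irrelevant 𝒜).toIdeal.IsMaximal := by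
  have hne : (HomogeneousIdeal.irrelevant 𝒜).toIdeal ≠ ⊤ := by
    rw [Ne, Ideal.eq_top_iff_one]
    intro h
    have := (HomogeneousIdeal.mem_irrelevant_iff 𝒜 1).1 h
    rw [GradedRing.proj_apply, DirectSum.decompose_of_mem_same _ SetLike.GradedOne.one_mem] at this
    exact one_ne_zero this
  have : Nontrivial (R ⧸ (HomogeneousIdeal.irrelevant 𝒜).toIdeal) :=
    Ideal.Quotient.nontrivial_iff.2 hne
  exact Ideal.Quotient.maximal_of_isField _ ((RingEquiv.ofBijective _
    ⟨(algebraMap k _).injective, algebraMap_quotient_irrelevant_surjective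
        h0⟩).symm.toMulEquiv.isField
      (Field.toIsField k))

namespace IsGradingProj

/-- If `n > α - b`, the `n`-th power of the irrelevant ideal times `M` has nothing in degree `α`. So
`M_α` embeds into the quotient, which is finite over `k` since `R` modulo the irrelevant ideal is
`k`. -/
lemma finite_range [IsNoetherianRing R] [Module.Finite R M] (hP : IsGradingProj 𝒜 P)
    (h0 : ∀ x ∈ 𝒜 0, ∃ c : k, algebraMap k R c = x) (α : ℚ) :
    Module.Finite k (LinearMap.range (P α)) := by
  obtain ⟨b, hb⟩ := hP.bddBelow
  obtain ⟨n, hn⟩ := exists_nat_gt (α - b)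
  let m := (HomogeneousIdeal.irrelevant 𝒜).toIdeal
  let L : Submodule R M := m ^ n • ⊤
  have hL : Module.Finite k (M ⧸ L) := by
    refine Module.Finite.of_pow_smul_eq_bot m (algebraMap_quotient_irrelevant_surjective h0) n _ ?_
    rw [← Submodule.range_mkQ L, ← Submodule.map_top, ← Submodule.map_smul'', ← le_bot_iff,
      Submodule.map_le_iff_le_comap, Submodule.comap_bot, Submodule.ker_mkQ]
  let f : LinearMap.range (P α) →ₗ[k] M ⧸ L :=
    (L.mkQ.restrictScalars k) ∘ₗ (LinearMap.range (P α)).subtype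
  refine Module.Finite.of_injective f ((injective_iff_map_eq_zero f).2 ?_)
  rintro ⟨_, x, rfl⟩ hx
  have hx' : P α x ∈ L := (Submodule.Quotient.mk_eq_zero L).1 hx
  have := hP.irrelevant_pow_smul_top_le hb n hx' α (by linarith)
  rw [hP.apply_self] at this
  exact Subtype.ext this

variable (Λ : Subalgebra k (Module.End R M))

/-- Such an endomorphism is determined by its values on generators, and each value is confined to
the finitely many finite dimensional degrees that occur in the generator. -/
lemma finite_end [IsNoetherianRing R] [Module.Finite R M] (hP : IsGradingProj 𝒜 P)
    (h0 : ∀ x ∈ 𝒜 0, ∃ c : k, algebraMap k R c = x) (hΛ : ∀ f, f ∈ Λ → IsHomogeneousMap P P 0 f) :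
    Module.Finite k Λ := by
  obtain ⟨S, hS⟩ := Module.Finite.fg_top (R := R) (M := M)
  let V : M → Submodule k M := fun s => ⨆ α ∈ (hP.finite s).toFinset, LinearMap.range (P α)
  have hV : ∀ s, Module.Finite k (V s) := fun s => by
    have := fun α => hP.finite_range h0 α
    change Module.Finite k ↥(⨆ α ∈ (hP.finite s).toFinset, LinearMap.range (P α))
    rw [← Finset.sup_eq_iSup]
    exact Submodule.finite_finset_sup _ _
  have hmem : ∀ f ∈ Λ, ∀ s, f s ∈ V s := by
    intro f hf s
    rw [← hP.finsum_eq (f s)]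
    refine finsum_induction (· ∈ V s) (zero_mem _) (fun _ _ => add_mem) fun α => ?_
    by_cases hα : P α s = 0
    · have := hP.apply_map hP (hΛ f hf) α s
      rw [add_zero, hα, map_zero] at this
      rw [this]
      exact zero_mem _
    · exact Submodule.mem_iSup_of_mem α (Submodule.mem_iSup_of_mem
        ((hP.finite s).mem_toFinset.2 hα) ⟨_, rfl⟩)
  let ev : Λ →ₗ[k] ∀ s : S, V s :=
    { toFun := fun f s => ⟨f.1 s, hmem f f.2 s⟩
      map_add' := fun f g => rfl
      map_smul' := fun c f => rfl }
  refine Module.Finite.of_injective ev fun f g hfg => Subtype.ext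
      (LinearMap.ext_on hS fun s hs => ?_)
  exact congrArg Subtype.val (congrFun hfg ⟨s, hs⟩)

lemma isLocalRing_end [IsNoetherianRing R] [Module.Finite R M] [Nontrivial M]
    (hP : IsGradingProj 𝒜 P) (h0 : ∀ x ∈ 𝒜 0, ∃ c : k, algebraMap k R c = x)
    (hΛ : ∀ f, f ∈ Λ → IsHomogeneousMap P P 0 f)
    (h : ∀ e ∈ Λ, e ∘ₗ e = e → e = 0 ∨ e = LinearMap.id) : IsLocalRing Λ := by
  have := hP.finite_end Λ h0 hΛ
  -- A field is a complete local ring with zero maximal ideal, so the locality criterion for finite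
  -- algebras covers `Λ` over `k`.
  have : IsAdicComplete (IsLocalRing.maximalIdeal k) k := by
    rw [IsLocalRing.maximalIdeal_eq_bot]
    infer_instance
  refine isLocalRing_of_finite_of_isAdicComplete k Λ fun e he => ?_
  rcases h e e.2 (congrArg Subtype.val he) with h | h
  · exact Or.inl (Subtype.ext h)
  · exact Or.inr (Subtype.ext h)

variable {Λ}

section Residue

variable (hP : IsGradingProj 𝒜 P) (hΛ : ∀ f, f ∈ Λ ↔ IsHomogeneousMap P P 0 f)

/-- The class of the degree preserving component of an endomorphism. -/
noncomputable def residue (f : Module.End R M) : Λ ⧸ Ring.jacobson Λ :=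
  Ideal.Quotient.mk _ ⟨hP.component hP 0 f, (hΛ _).2 (hP.isHomogeneousMap_component hP 0 f)⟩

include hP hΛ in
lemma comp_mem (hQ : IsGradingProj 𝒜 Q) (δ : ℚ) (f : N →ₗ[R] M) (g : M →ₗ[R] N) :
    hQ.component hP (-δ) f ∘ₗ hP.component hQ δ g ∈ Λ :=
  (hΛ _).2 fun α x hx => by
    have h := hQ.isHomogeneousMap_component hP (-δ) f _ _
      (hP.isHomogeneousMap_component hQ δ g α x hx)
    rw [add_neg_cancel_right] at h
    rw [add_zero]
    exact h

variable [Module.Finite R M]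

lemma residue_comp (hQ : IsGradingProj 𝒜 Q) (f : N →ₗ[R] M) (g : M →ₗ[R] N) : hP.residue hΛ
    (f ∘ₗ g) =
    ∑ δ ∈ (hP.finite_component hQ g).toFinset,
      Ideal.Quotient.mk _ (⟨_, hP.comp_mem hΛ hQ δ f g⟩ : Λ) := by
  refine Eq.trans (congrArg (Ideal.Quotient.mk (Ring.jacobson Λ)) (Subtype.ext ?_))
    (Ideal.Quotient.mk_finsetSum _ _ _)
  rw [AddSubmonoidClass.coe_finsetSum]
  exact hP.component_zero_comp hQ hP f g

variable [IsLocalRing Λ] [Nontrivial M]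

include hΛ in
omit [IsLocalRing Λ] [Module.Finite R M] in
lemma bijective_of_isUnit (hQ : IsGradingProj 𝒜 Q)
    (hN : ∀ e : N →ₗ[R] N, IsHomogeneousMap Q Q 0 e → e ∘ₗ e = e →
    e = 0 ∨ e = LinearMap.id) {δ : ℚ} {f : N →ₗ[R] M} {g : M →ₗ[R] N}
    (h : IsUnit (⟨_, hP.comp_mem hΛ hQ δ f g⟩ : Λ)) :
    Function.Bijective (hQ.component hP (-δ) f) := by
  obtain ⟨c, hc⟩ := h.exists_right_inv
  exact (hQ.isHomogeneousMap_component hP (-δ) f).bijective_of_comp hN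
    (hP.isHomogeneousMap_component hQ δ g) ((hΛ _).1 c.2) (congrArg Subtype.val hc)

/-- The degree zero part of `f ∘ g` is a sum of products `f_{-δ} g_δ`; if one were a unit, `f_{-δ}`
would be a homogeneous isomorphism from `N` to `M`. -/
lemma residue_comp_eq_zero (hQ : IsGradingProj 𝒜 Q)
    (hN : ∀ e : N →ₗ[R] N, IsHomogeneousMap Q Q 0 e → e ∘ₗ e = e →
    e = 0 ∨ e = LinearMap.id)
    (hiso : ∀ (δ : ℚ) (f : N →ₗ[R] M), IsHomogeneousMap Q P δ f → ¬ Function.Bijective f)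
    (f : N →ₗ[R] M) (g : M →ₗ[R] N) : hP.residue hΛ (f ∘ₗ g) = 0 := by
  rw [hP.residue_comp hΛ hQ]
  exact Finset.sum_eq_zero fun δ _ => Ideal.Quotient.mk_jacobson_eq_zero fun hu =>
    hiso _ _ (hQ.isHomogeneousMap_component hP (-δ) f) (hP.bijective_of_isUnit hΛ hQ hN hu)

/-- The degree zero part of `f * g` is the sum of the `f_{-δ} g_δ`. For `δ ≠ 0` one factor has
negative degree, so it is not injective; the product is then a nonunit and dies in the residue ring,
leaving `f_0 g_0`. -/
lemma residue_mul (hM : ∀ e : M →ₗ[R] M, IsHomogeneousMap P P 0 e → e ∘ₗ e = e →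
    e = 0 ∨ e = LinearMap.id) (f g : Module.End R M) :
    hP.residue hΛ (f * g) = hP.residue hΛ f * hP.residue hΛ g := by
  have hz : ∀ δ ≠ 0, Ideal.Quotient.mk (Ring.jacobson Λ) (⟨_, hP.comp_mem hΛ hP δ f g⟩ : Λ) = 0 :=
      by
    refine fun δ hδ => Ideal.Quotient.mk_jacobson_eq_zero fun hu => ?_
    rcases lt_or_gt_of_ne hδ with h | h
    · refine hP.not_injective_of_neg h (hP.isHomogeneousMap_component hP δ g) ?_
      obtain ⟨c, hc⟩ := hu.exists_left_inv
      intro x y hxy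
      have hcx := fun x => LinearMap.congr_fun (congrArg Subtype.val hc) x
      have := congrArg (fun z => c.1 (hP.component hP (-δ) f z)) hxy
      exact (hcx x).symm.trans (this.trans (hcx y))
    -- A unit product by itself only makes the left factor surjective; its injectivity comes from
    -- the absence of nontrivial idempotents.
    · exact hP.not_injective_of_neg (neg_lt_zero.2 h) (hP.isHomogeneousMap_component hP (-δ) f)
        (hP.bijective_of_isUnit hΛ hP hM hu).1
  refine (hP.residue_comp hΛ hP f g).trans ?_
  refine (Finset.sum_eq_single 0 (fun δ _ => hz δ) ?_).trans ?_
  rotate_left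
  · refine Eq.trans (congrArg (Ideal.Quotient.mk (Ring.jacobson Λ)) (Subtype.ext ?_))
      ((Ideal.Quotient.mk (Ring.jacobson Λ)).map_mul _ _)
    change hP.component hP (-0) f ∘ₗ hP.component hP 0 g = _
    rw [neg_zero]
    rfl
  · intro h
    have h' : hP.component hP 0 g = 0 := by simpa using h
    refine Eq.trans (congrArg (Ideal.Quotient.mk (Ring.jacobson Λ)) (Subtype.ext ?_)) (map_zero _)
    change hP.component hP (-0) f ∘ₗ hP.component hP 0 g = 0
    rw [h', LinearMap.comp_zero]

/-- The residue map on endomorphisms, as a ring homomorphism. -/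
noncomputable def residueHom (hM : ∀ e : M →ₗ[R] M, IsHomogeneousMap P P 0 e → e ∘ₗ e = e →
    e = 0 ∨ e = LinearMap.id) : Module.End R M →+* Λ ⧸ Ring.jacobson Λ where
  toFun := hP.residue hΛ
  map_one' := by
    rw [← map_one (Ideal.Quotient.mk (Ring.jacobson Λ))]
    refine congrArg _ (Subtype.ext (hP.component_eq_self hP fun α x hx => ?_))
    rwa [add_zero]
  map_mul' := hP.residue_mul hΛ hM
  map_zero' := by
    rw [← map_zero (Ideal.Quotient.mk (Ring.jacobson Λ))]
    refine congrArg _ (Subtype.ext (hP.component_eq_self hP fun α x hx => ?_))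
    rw [LinearMap.zero_apply, map_zero]
  map_add' f g := by
    exact Eq.trans (congrArg (Ideal.Quotient.mk (Ring.jacobson Λ))
        (Subtype.ext (hP.component_add hP 0 f g)))
      ((Ideal.Quotient.mk _).map_add _ _)

omit [Nontrivial M] [IsLocalRing Λ] [Module.Finite R M] in
lemma residue_surjective : Function.Surjective (hP.residue hΛ) := by
  intro x
  obtain ⟨f, rfl⟩ := Ideal.Quotient.mk_surjective x
  exact ⟨f.1, congrArg _ (Subtype.ext (hP.component_eq_self hP ((hΛ _).1 f.2)))⟩

omit [Nontrivial M] [IsLocalRing Λ] [Module.Finite R M] in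
lemma residue_smul (c : k) (f : Module.End R M) :
    hP.residue hΛ (c • f) = c • hP.residue hΛ f := by
  change _ = Ideal.Quotient.mk _ (c • _)
  refine congrArg _ (Subtype.ext (hP.hom_ext fun α x hx => ?_))
  change _ = c • hP.component hP 0 f x
  rw [hP.component_apply hP 0 _ hx, hP.component_apply hP 0 _ hx]
  exact map_smul _ _ _

omit [Nontrivial M] [IsLocalRing Λ] [Module.Finite R M] in
lemma residue_algebraMap {r : R} (hr : r ∈ HomogeneousIdeal.irrelevant 𝒜) :
    hP.residue hΛ (algebraMap R _ r) = 0 := by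
  rw [← map_zero (Ideal.Quotient.mk (Ring.jacobson Λ))]
  refine congrArg _ (Subtype.ext (hP.hom_ext fun α x hx => ?_))
  rw [hP.component_apply hP 0 _ hx]
  refine hP.apply_smul_eq_zero fun n => ?_
  rcases Nat.eq_zero_or_pos n with rfl | hn
  · exact Or.inl ((HomogeneousIdeal.mem_irrelevant_iff 𝒜 r).1 hr)
  · refine Or.inr (hP.eq_of_homogeneous hx ?_)
    have : (0 : ℚ) < n := by exact_mod_cast hn
    intro h
    linarith

end Residue

end IsGradingProj

end HomogeneousEnd

/-! ### Graded submodules and projections -/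

section GradedSubmodules

variable {k R X : Type*} [Field k] [CommRing R] [Algebra k R] {𝒜 : ℕ → Submodule k R}
  [AddCommGroup X] [Module R X] [Module k X] [IsScalarTower k R X]
  {gr : ℚ → Submodule k X} {P : ℚ → X →ₗ[k] X}

/-- The restriction of the projections `P α` to a graded submodule. -/
def restrictProj {N : Submodule R X} (hN : ∀ α, ∀ x ∈ N, P α x ∈ N) (α : ℚ) : N →ₗ[k] N where
  toFun x := ⟨P α x, hN α x x.2⟩
  map_add' x y := Subtype.ext (map_add (P α) (x : X) y)
  map_smul' c x := Subtype.ext (map_smul (P α) c (x : X))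

namespace IsGradingProj

variable (hP : IsGradingProj 𝒜 P) (hgr : ∀ α x, x ∈ gr α ↔ P α x = x)

include hP

lemma restrict {N : Submodule R X} (hN : ∀ α, ∀ x ∈ N, P α x ∈ N) :
    IsGradingProj 𝒜 (restrictProj hN) where
  apply_self α x := Subtype.ext (hP.apply_self α x)
  apply_ne α β h x := Subtype.ext (hP.apply_ne α β h x)
  finite x := (hP.finite x).subset fun α h h0 => h (Subtype.ext h0)
  finsum_eq x := by
    refine Subtype.ext ?_
    have hf : (fun α => restrictProj hN α x).HasFiniteSupport :=
      (hP.finite x).subset fun α h h0 => h (Subtype.ext h0)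
    exact (N.subtype.toAddMonoidHom.map_finsum hf).trans (hP.finsum_eq x)
  smul n r hr α x := Subtype.ext (hP.smul n r hr α x)
  bddBelow := by
    obtain ⟨b, hb⟩ := hP.bddBelow
    exact ⟨b, fun α hα => LinearMap.ext fun x => Subtype.ext (LinearMap.congr_fun (hb α hα) x)⟩

include hgr

lemma isGradedSubmodule_iff {N : Submodule R X} :
    IsGradedSubmodule gr N ↔ ∀ α, ∀ x ∈ N, P α x ∈ N := by
  constructor
  · intro h α
    suffices N.restrictScalars k ≤ (N.restrictScalars k).comap (P α) from this
    conv_lhs => rw [h]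
    refine iSup_le fun β x hx => ?_
    obtain ⟨hxN, hxβ⟩ := hx
    rw [Submodule.mem_comap]
    by_cases h : α = β
    · rw [h, (hgr β x).1 hxβ]
      exact hxN
    · rw [hP.eq_of_homogeneous ((hgr β x).1 hxβ) h]
      exact zero_mem _
  · intro h
    refine le_antisymm (fun x hx => ?_) (iSup_le fun α => inf_le_left)
    rw [← hP.finsum_eq x]
    exact finsum_induction (· ∈ ⨆ α, N.restrictScalars k ⊓ gr α) (zero_mem _) (fun _ _ => add_mem)
      fun α => Submodule.mem_iSup_of_mem α ⟨h α x hx, (hgr α _).2 (hP.apply_self α x)⟩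

omit hP in
lemma mem_gradedEnd_iff {N : Submodule R X} (hN : ∀ α, ∀ x ∈ N, P α x ∈ N)
    (f : Module.End R N) :
    f ∈ gradedEnd gr N ↔ IsHomogeneousMap (restrictProj hN) (restrictProj hN) 0 f := by
  refine forall₂_congr fun α x => ?_
  rw [hgr, hgr, add_zero, Subtype.ext_iff, Subtype.ext_iff]
  rfl

/-- A degree preserving idempotent commutes with the projections, so its range and kernel are graded
and split `N`. -/
lemma eq_zero_or_eq_id {N : Submodule R X} (hind : IsGradedIndecomposable gr N)
    (hN : ∀ α, ∀ x ∈ N, P α x ∈ N) (e : N →ₗ[R] N)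
    (he : IsHomogeneousMap (restrictProj hN) (restrictProj hN) 0 e) (hee : e ∘ₗ e = e) :
    e = 0 ∨ e = LinearMap.id := by
  have hc : IsCompl (LinearMap.range e) (LinearMap.ker e) :=
    LinearMap.IsIdempotentElem.isCompl (f := e) hee
  have hinj := N.injective_subtype
  have hcomm : ∀ α (x : N), restrictProj hN α (e x) = e (restrictProj hN α x) := fun α x => by
    have := (hP.restrict hN).apply_map (hP.restrict hN) he α x
    rwa [add_zero] at this
  have h0 := Submodule.map_injective_of_injective hinj
  have hr : ∀ α, ∀ x ∈ (LinearMap.range e).map N.subtype, P α x ∈ (LinearMap.range e).map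
      N.subtype := by
    rintro α _ ⟨_, ⟨x, rfl⟩, rfl⟩
    exact ⟨_, ⟨restrictProj hN α x, rfl⟩, (congrArg Subtype.val (hcomm α x)).symm⟩
  have hk : ∀ α, ∀ x ∈ (LinearMap.ker e).map N.subtype, P α x ∈ (LinearMap.ker e).map N.subtype :=
      by
    rintro α _ ⟨x, hx, rfl⟩
    refine ⟨restrictProj hN α x, ?_, rfl⟩
    rw [SetLike.mem_coe, LinearMap.mem_ker] at hx ⊢
    rw [← hcomm, hx, map_zero]
  rcases hind.2.2 ((LinearMap.range e).map N.subtype) ((LinearMap.ker e).map N.subtype)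
    ((hP.isGradedSubmodule_iff hgr).2 hr) ((hP.isGradedSubmodule_iff hgr).2 hk)
    (by rw [← Submodule.map_sup, hc.sup_eq_top, Submodule.map_subtype_top])
    (by rw [← Submodule.map_inf _ hinj, hc.inf_eq_bot, Submodule.map_bot]) with h | h
  · exact Or.inl (LinearMap.range_eq_bot.1 (h0 (h.trans (Submodule.map_bot _).symm)))
  · have hk := LinearMap.ker_eq_bot.1 (h0 (h.trans (Submodule.map_bot _).symm))
    exact Or.inr (LinearMap.ext fun x => hk (LinearMap.congr_fun hee x))

lemma gradedIsoUpToShift {N N' : Submodule R X} (hN : ∀ α, ∀ x ∈ N, P α x ∈ N)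
    (hN' : ∀ α, ∀ x ∈ N', P α x ∈ N') {δ : ℚ} {f : N →ₗ[R] N'}
    (hf : IsHomogeneousMap (restrictProj hN) (restrictProj hN') δ f) (hbij : Function.Bijective f) :
    GradedIsoUpToShift gr N N' := by
  refine ⟨δ, LinearEquiv.ofBijective f hbij, fun α x => ?_⟩
  have h := (hP.restrict hN).apply_map (hP.restrict hN') hf α x
  rw [hgr, hgr]
  change _ ↔ ((restrictProj hN' (α + δ) (f x) : N') : X) = (f x : N')
  rw [h, ← Subtype.ext_iff, hbij.1.eq_iff, Subtype.ext_iff]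
  rfl

end IsGradingProj

omit [Algebra k R] [IsScalarTower k R X] in
lemma GradedIsoUpToShift.refl (N : Submodule R X) : GradedIsoUpToShift gr N N :=
  ⟨0, LinearEquiv.refl R N, fun α x => by rw [add_zero]; rfl⟩

end GradedSubmodules

/-! ### The rational grading of `ᵉR` -/

section FrobeniusGrading

variable (p e : ℕ) [Fact p.Prime] {k R : Type*} [Field k] [CommRing R] [Algebra k R] [CharP k p]
  (𝒜 : ℕ → Submodule k R) [GradedAlgebra 𝒜]

/-- The projection of `R` to its component of degree `n`, as a linear endomorphism of `ᵉR`. -/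
noncomputable def twistProj [CharP R p] (n : ℕ) : FrobTwist p e R →ₗ[k] FrobTwist p e R where
  toFun x := (FrobTwist.toBase p e R).symm (GradedRing.proj 𝒜 n (FrobTwist.toBase p e R x))
  map_add' x y := by simp
  map_smul' c x := map_smul (GradedAlgebra.proj 𝒜 n) (c ^ p ^ e) (FrobTwist.toBase p e R x)

variable [CharP R p]

open Classical in
/-- The projection of `ᵉR` to its component of degree `α`. -/
noncomputable def frobProj (α : ℚ) : FrobTwist p e R →ₗ[k] FrobTwist p e R :=
  -- The test says that `p ^ e * α` is a natural number; negative values fail it, as their floor is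
  -- `0`.
  if (⌊(p : ℚ) ^ e * α⌋₊ : ℚ) = (p : ℚ) ^ e * α then twistProj p e 𝒜 ⌊(p : ℚ) ^ e * α⌋₊ else 0

variable {p e 𝒜}

lemma frobProj_of_eq {n : ℕ} {α : ℚ} (h : (n : ℚ) = (p : ℚ) ^ e * α) :
    frobProj p e 𝒜 α = twistProj p e 𝒜 n := by
  have : ⌊(p : ℚ) ^ e * α⌋₊ = n := by rw [← h, Nat.floor_natCast]
  rw [frobProj, this, if_pos h]

lemma frobProj_of_ne {α : ℚ} (h : ∀ n : ℕ, (n : ℚ) ≠ (p : ℚ) ^ e * α) : frobProj p e 𝒜 α = 0 :=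
  if_neg (h _)

lemma twistProj_self (n : ℕ) (x : FrobTwist p e R) :
    twistProj p e 𝒜 n (twistProj p e 𝒜 n x) = twistProj p e 𝒜 n x :=
  DirectSum.decompose_of_mem_same 𝒜 (SetLike.coe_mem (DirectSum.decompose 𝒜 (x : R) n))

lemma twistProj_ne {m n : ℕ} (h : m ≠ n) (x : FrobTwist p e R) :
    twistProj p e 𝒜 n (twistProj p e 𝒜 m x) = 0 :=
  DirectSum.decompose_of_mem_ne 𝒜 (SetLike.coe_mem (DirectSum.decompose 𝒜 (x : R) m)) h

lemma exists_sum_twistProj (x : FrobTwist p e R) : ∃ s : Finset ℕ,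
    (∀ n ∉ s, twistProj p e 𝒜 n x = 0) ∧ ∑ n ∈ s, twistProj p e 𝒜 n x = x := by
  classical
  refine ⟨(DirectSum.decompose 𝒜 (FrobTwist.toBase p e R x)).support, fun n hn => ?_,
    DirectSum.sum_support_decompose 𝒜 (FrobTwist.toBase p e R x)⟩
  have h : DirectSum.decompose 𝒜 (FrobTwist.toBase p e R x) n = 0 := by
    by_contra h
    exact hn (DFinsupp.mem_support_iff.2 h)
  exact congrArg Subtype.val h

omit [Fact p.Prime] [CharP k p] [CharP R p] in
lemma pow_mem_mul {n : ℕ} {r : R} (hr : r ∈ 𝒜 n) : r ^ p ^ e ∈ 𝒜 (p ^ e * n) := by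
  have := SetLike.pow_mem_graded (p ^ e) hr
  rwa [smul_eq_mul] at this

lemma twistProj_smul {n : ℕ} {r : R} (hr : r ∈ 𝒜 n) (m : ℕ) (x : FrobTwist p e R) :
    twistProj p e 𝒜 (p ^ e * n + m) (r • x) = r • twistProj p e 𝒜 m x :=
  DirectSum.coe_decompose_mul_add_of_left_mem 𝒜 (b := FrobTwist.toBase p e R x)
    (pow_mem_mul (p := p) (e := e) hr)

lemma twistProj_smul_of_lt {n : ℕ} {r : R} (hr : r ∈ 𝒜 n) {m : ℕ} (h : m < p ^ e * n)
    (x : FrobTwist p e R) : twistProj p e 𝒜 m (r • x) = 0 :=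
  DirectSum.coe_decompose_mul_of_left_mem_of_not_le 𝒜 (b := FrobTwist.toBase p e R x)
    (pow_mem_mul (p := p) (e := e) hr) h.not_ge

variable (p e 𝒜)

/-- An `r` of degree `n` acts as `r ^ (p ^ e)`, of degree `p ^ e * n` in `R`, which is degree `n`
again in the scale of `ᵉR`. -/
lemma isGradingProj_frobProj : IsGradingProj 𝒜 (frobProj (R := R) p e 𝒜) := by
  have hp : (p : ℚ) ^ e ≠ 0 := pow_ne_zero _ (Nat.cast_ne_zero.2 (Fact.out : p.Prime).ne_zero)
  let ι : ℕ → ℚ := fun n => (n : ℚ) / (p : ℚ) ^ e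
  have hι : ∀ n : ℕ, (n : ℚ) = (p : ℚ) ^ e * ι n := fun n => (mul_div_cancel₀ _ hp).symm
  have hιinj : Function.Injective ι := fun m n h => Nat.cast_injective (R := ℚ) (by
    rw [hι m, hι n, h])
  have hsupp : ∀ (x : FrobTwist p e R) (s : Finset ℕ), (∀ n ∉ s, twistProj p e 𝒜 n x = 0) →
      {α | frobProj p e 𝒜 α x ≠ 0} ⊆ (s.map ⟨ι, hιinj⟩ : Finset ℚ) := by
    intro x s hs α hα
    by_cases h : ∃ n : ℕ, (n : ℚ) = (p : ℚ) ^ e * α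
    · obtain ⟨n, hn⟩ := h
      refine Finset.mem_map.2 ⟨n, ?_, mul_left_cancel₀ hp ((hι n).symm.trans hn)⟩
      by_contra hns
      exact hα (by rw [frobProj_of_eq hn, hs n hns])
    · push Not at h
      exact absurd (by rw [frobProj_of_ne h, LinearMap.zero_apply]) hα
  refine ⟨fun α x => ?_, fun α β h x => ?_, fun x => ?_, fun x => ?_, fun n r hr α x => ?_, 0,
    fun α hα => ?_⟩
  · by_cases h : ∃ n : ℕ, (n : ℚ) = (p : ℚ) ^ e * α
    · obtain ⟨n, hn⟩ := h
      rw [frobProj_of_eq hn, twistProj_self]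
    · push Not at h
      rw [frobProj_of_ne h, LinearMap.zero_apply, LinearMap.zero_apply]
  · by_cases hα : ∃ n : ℕ, (n : ℚ) = (p : ℚ) ^ e * α
    · by_cases hβ : ∃ n : ℕ, (n : ℚ) = (p : ℚ) ^ e * β
      · obtain ⟨n, hn⟩ := hα
        obtain ⟨m, hm⟩ := hβ
        rw [frobProj_of_eq hn, frobProj_of_eq hm, twistProj_ne]
        rintro rfl
        exact h (mul_left_cancel₀ hp (hn.symm.trans hm))
      · push Not at hβ
        rw [frobProj_of_ne hβ, LinearMap.zero_apply, map_zero]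
    · push Not at hα
      rw [frobProj_of_ne hα, LinearMap.zero_apply]
  · obtain ⟨s, hs, -⟩ := exists_sum_twistProj (𝒜 := 𝒜) x
    exact (Finset.finite_toSet _).subset (hsupp x s hs)
  · obtain ⟨s, hs, hsum⟩ := exists_sum_twistProj (𝒜 := 𝒜) x
    rw [finsum_eq_finsetSum_of_support_subset _ (hsupp x s hs), Finset.sum_map]
    exact (Finset.sum_congr rfl fun n _ => by rw [← frobProj_of_eq (hι n)]; rfl).trans hsum
  · by_cases hα : ∃ m : ℕ, (m : ℚ) = (p : ℚ) ^ e * α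
    · obtain ⟨m, hm⟩ := hα
      rw [frobProj_of_eq hm, frobProj_of_eq (n := p ^ e * n + m) (by push_cast; rw [hm]; ring),
        twistProj_smul hr]
    · push Not at hα
      rw [frobProj_of_ne hα, LinearMap.zero_apply, smul_zero]
      by_cases hβ : ∃ m : ℕ, (m : ℚ) = (p : ℚ) ^ e * (α + n)
      · obtain ⟨m, hm⟩ := hβ
        -- The target degree is natural and the source degree is not, so `m < p ^ e * n`, and
        -- multiples of `r ^ (p ^ e)` have no component there.
        rw [frobProj_of_eq hm, twistProj_smul_of_lt hr]
        by_contra! hle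
        refine hα (m - p ^ e * n) ?_
        rw [Nat.cast_sub hle, hm]
        push_cast
        ring
      · push Not at hβ
        rw [frobProj_of_ne hβ, LinearMap.zero_apply]
  · refine frobProj_of_ne fun n hn => ?_
    have h1 : (0 : ℚ) ≤ n := n.cast_nonneg
    have h2 : (0 : ℚ) < (p : ℚ) ^ e := pow_pos (Nat.cast_pos.2 (Fact.out : p.Prime).pos) _
    nlinarith

lemma mem_frobGrading_iff (α : ℚ) (x : FrobTwist p e R) :
    x ∈ frobGrading p e 𝒜 α ↔ frobProj p e 𝒜 α x = x := by
  by_cases h : ∃ n : ℕ, (n : ℚ) = (p : ℚ) ^ e * α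
  · obtain ⟨n, hn⟩ := h
    have : x ∈ frobGrading p e 𝒜 α ↔ FrobTwist.toBase p e R x ∈ 𝒜 n := by
      constructor
      · intro hx
        have hle : frobGrading p e 𝒜 α ≤
            { carrier := {x | FrobTwist.toBase p e R x ∈ 𝒜 n}
              add_mem' := fun hx hy => (𝒜 n).add_mem hx hy
              zero_mem' := (𝒜 n).zero_mem
              smul_mem' := fun c _ hx => (𝒜 n).smul_mem (c ^ p ^ e) hx } := by
          refine iSup₂_le fun m hm => ?_
          rw [show m = n from Nat.cast_injective (R := ℚ) (hm.trans hn.symm)]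
        exact hle hx
      · intro hx
        exact Submodule.mem_iSup_of_mem n (Submodule.mem_iSup_of_mem hn hx)
    rw [this, frobProj_of_eq hn]
    exact ⟨fun hx => DirectSum.decompose_of_mem_same 𝒜 hx, fun hx => by
      rw [← hx]
      exact SetLike.coe_mem (DirectSum.decompose 𝒜 (FrobTwist.toBase p e R x) n)⟩
  · push Not at h
    have : frobGrading p e 𝒜 α = ⊥ := by
      refine iSup₂_eq_bot.2 fun n hn => absurd hn (h n)
    rw [this, frobProj_of_ne h, Submodule.mem_bot, LinearMap.zero_apply, eq_comm]

end FrobeniusGrading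

/-! ### Finite length over finitely generated algebras -/

section FiniteLength

variable {k R : Type*} [Field k] [CommRing R] [Algebra k R]

/-- By Zariski's lemma simple modules are finite dimensional over `k`; extensions preserve this. -/
lemma IsFiniteLength.finite_of_finiteType [Algebra.FiniteType k R] {W : Type*} [AddCommGroup W]
    [Module R W] (h : IsFiniteLength R W) :
    ∀ [Module k W] [IsScalarTower k R W], Module.Finite k W := by
  induction h with
  | of_subsingleton => exact inferInstance
  | @of_simple_quotient M _ _ N hS _ ih =>
    intro _ _
    have h1 : Module.Finite k (N.restrictScalars k) := ih
    have h2 : Module.Finite k (M ⧸ N.restrictScalars k) := by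
      obtain ⟨I, hI, ⟨f⟩⟩ := isSimpleModule_iff_quot_maximal.1 hS
      let _ : Field (R ⧸ I) := Ideal.Quotient.field I
      have : Module.Finite k (R ⧸ I) := finite_of_finite_type_of_isJacobsonRing k (R ⧸ I)
      exact Module.Finite.equiv (f.symm.restrictScalars k)
    exact Module.Finite.of_submodule_quotient (N.restrictScalars k)

lemma isFiniteLength_of_finite {W : Type*} [AddCommGroup W] [Module R W] [Module k W]
    [IsScalarTower k R W] [Module.Finite k W] : IsFiniteLength R W :=
  isFiniteLength_iff_isNoetherian_isArtinian.2
    ⟨isNoetherian_of_tower k inferInstance, isArtinian_of_tower k inferInstance⟩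

lemma isFiniteDimRep_iff_of_finiteType (k : Type*) [Field k] [Algebra k R]
    [Algebra.FiniteType k R] {W : Type*} [AddCommGroup W]
    [Module (DZ R) W] : IsFiniteDimRep R W ↔ lengthVia ((toDZ R).comp (algebraMap k R)) W ≠ ⊤ := by
  let _ : Module R W := Module.compHom W (toDZ R)
  let _ : Module k W := Module.compHom W ((toDZ R).comp (algebraMap k R))
  have : IsScalarTower k R W := ⟨fun c r w => by rw [Algebra.smul_def, mul_smul]; rfl⟩
  refine Iff.trans ?_ (Module.length_ne_top_iff (R := k) (M := W)).symm
  constructor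
  · intro h
    have := IsFiniteLength.finite_of_finiteType (k := k) h
    exact isFiniteLength_iff_isNoetherian_isArtinian.2 ⟨inferInstance, inferInstance⟩
  · intro h
    have := (isFiniteLength_iff_isNoetherian_isArtinian.1 h).1
    exact isFiniteLength_of_finite (k := k)

lemma repFinrank_eq_lengthVia {W : Type*} [AddCommGroup W] [Module (DZ R) W]
    (h : lengthVia ((toDZ R).comp (algebraMap k R)) W ≠ ⊤) :
    (repFinrank k R W : ℕ∞) = lengthVia ((toDZ R).comp (algebraMap k R)) W := by
  let _ : Module k W := Module.compHom W ((toDZ R).comp (algebraMap k R))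
  have := (isFiniteLength_iff_isNoetherian_isArtinian.1
    ((Module.length_ne_top_iff (R := k) (M := W)).1 h)).1
  exact (Module.length_eq_finrank k W).symm

end FiniteLength

/-! ### The graded case -/

section GradedCase

variable (p : ℕ) [Fact p.Prime] {k : Type v} {R : Type u} [Field k] [CommRing R] [Nontrivial R]
  [Algebra k R] [CharP k p] [CharP R p] [Algebra.FiniteType k R] (𝒜 : ℕ → Submodule k R)
  [GradedAlgebra 𝒜]

omit [Nontrivial R] in
theorem nonempty_gradedIndecDecomposition_frobTwist (hk : (frobenius k p).Finite) (e : ℕ) :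
    Nonempty (GradedIndecDecomposition (R := R) (frobGrading p e 𝒜)) := by
  have : IsNoetherianRing R := Algebra.FiniteType.isNoetherianRing k R
  have : Module.Finite R (FrobTwist p e R) := (moduleFinite_frobTwist_iff p e R).2
    ((frobenius_finite_of_finiteType p hk).iterateFrobenius p e)
  exact nonempty_gradedIndecDecomposition _ (((isGradingProj_frobProj p e 𝒜).isGradedSubmodule_iff
    (mem_frobGrading_iff p e 𝒜)).2 fun _ _ _ => trivial)

/-- The coefficients are `A = k`. The degree preserving endomorphisms give the lower bound,
`residueHom` the upper one. The modules over `End(ᵉR)` are ungraded, so isomorphisms up to shift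
serve simply as isomorphisms. -/
theorem repDim_of_graded (h0 : ∀ x ∈ 𝒜 0, ∃ c : k, algebraMap k R c = x)
    (hk : (frobenius k p).Finite)
    (D : ∀ e : ℕ, GradedIndecDecomposition (R := R) (frobGrading p e 𝒜)) :
    ((minRepDimOver k R : ℝ≥0∞) =
      ⨆ e : ℕ, ((D e).minDim : ℝ≥0∞) / (frobDegree p e k : ℝ≥0∞)) ∧
    (¬ HasFiniteDimRep R ↔
      (⨆ e : ℕ, ((D e).minDim : ℝ≥0∞) / (frobDegree p e k : ℝ≥0∞)) = ⊤) := by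
  have hR : IsNoetherianRing R := Algebra.FiniteType.isNoetherianRing k R
  have hfin : ∀ e, (iterateFrobenius R p e).Finite := fun e =>
    (frobenius_finite_of_finiteType p hk).iterateFrobenius p e
  have hX : ∀ e, Module.Finite R (FrobTwist p e R) := fun e =>
    (moduleFinite_frobTwist_iff p e R).2 (hfin e)
  have hP := fun e => isGradingProj_frobProj p e 𝒜
  have hgr := fun e => mem_frobGrading_iff p e 𝒜
  have hN : ∀ e i, ∀ α, ∀ x ∈ (D e).summand i, frobProj p e 𝒜 α x ∈ (D e).summand i := fun e i =>
    ((hP e).isGradedSubmodule_iff (hgr e)).1 ((D e).indecomposable i).1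
  have hΛ := fun e i => IsGradingProj.mem_gradedEnd_iff (hgr e) (hN e i)
  have hid := fun e i => (hP e).eq_zero_or_eq_id (hgr e) ((D e).indecomposable i) (hN e i)
  have hPN := fun e i => (hP e).restrict (hN e i)
  have hnt : ∀ e i, Nontrivial ((D e).summand i) := fun e i =>
    Submodule.nontrivial_iff_ne_bot.2 ((D e).indecomposable i).2.1
  have hloc : ∀ e i, IsLocalRing (gradedEnd (frobGrading p e 𝒜) ((D e).summand i)) := fun e i =>
    (hPN e i).isLocalRing_end _ h0 (fun f => (hΛ e i f).1) fun f hf => hid e i f ((hΛ e i f).1 hf)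
  have hlen : ∀ e i, Module.length k (gradedEnd (frobGrading p e 𝒜) ((D e).summand i) ⧸
      Ring.jacobson (gradedEnd (frobGrading p e 𝒜) ((D e).summand i))) =
      (gradedEndResidueDim (frobGrading p e 𝒜) ((D e).summand i) : ℕ∞) := fun e i => by
    have := (hPN e i).finite_end _ h0 (fun f => (hΛ e i f).1)
    have : Module.Finite k (gradedEnd (frobGrading p e 𝒜) ((D e).summand i) ⧸
        Ring.jacobson (gradedEnd (frobGrading p e 𝒜) ((D e).summand i))) :=
      Module.Finite.of_surjective ((Submodule.mkQ _).restrictScalars k) (Submodule.mkQ_surjective _)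
    exact Module.length_eq_finrank _ _
  have hLB : ∀ e, ∀ (W : Type u) [AddCommGroup W] [Module (Module.End R (FrobTwist p e R)) W]
      [Module k W] [IsScalarTower k (Module.End R (FrobTwist p e R)) W] [Nontrivial W],
      (D e).minDim ≤ Module.length k W := by
    intro e W _ _ _ _ _
    obtain ⟨i, hi⟩ := exists_mul_length_residue_le (A := k) (D e).isInternal
      (fun j i => GradedIsoUpToShift (frobGrading p e 𝒜) ((D e).summand j) ((D e).summand i))
      (fun _ _ ⟨_, f, _⟩ => ⟨f⟩)
      (fun i => gradedEnd (frobGrading p e 𝒜) ((D e).summand i)) (fun i => Subalgebra.val _) W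
    rw [hlen] at hi
    exact (iInf_le _ i).trans hi
  have hmax := irrelevant_isMaximal h0
  have hUB : ∀ e, ∃ (W : Type u) (_ : AddCommGroup W)
      (_ : Module (Module.End R (FrobTwist p e R)) W) (_ : Module k W),
      IsScalarTower k (Module.End R (FrobTwist p e R)) W ∧ Nontrivial W ∧
      Module.length k W = (D e).minDim ∧ ∀ r ∈ (HomogeneousIdeal.irrelevant 𝒜).toIdeal, ∀ w : W,
        algebraMap R (Module.End R (FrobTwist p e R)) r • w = 0 := by
    intro e
    have hne : Nonempty (Fin (D e).n) := by
      by_contra hempty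
      rw [not_nonempty_iff] at hempty
      have : Nontrivial (FrobTwist p e R) := inferInstanceAs (Nontrivial R)
      have := (D e).isInternal.submodule_iSup_eq_top
      rw [iSup_of_empty] at this
      exact bot_ne_top this
    obtain ⟨i, hi⟩ := exists_eq_ciInf_of_finite (f := fun i : Fin (D e).n =>
      (gradedEndResidueDim (frobGrading p e 𝒜) ((D e).summand i) : ℕ∞) * ((D e).mult i : ℕ∞))
    have := Ring.nontrivial_quotient_jacobson (gradedEnd (frobGrading p e 𝒜) ((D e).summand i))
    obtain ⟨W, i1, i2, i3, h1, h2, h3, h4⟩ := exists_module_of_residue (A := k) (D e).isInternal i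
      (fun j => GradedIsoUpToShift (frobGrading p e 𝒜) ((D e).summand j) ((D e).summand i))
      (GradedIsoUpToShift.refl _) (fun j ⟨_, f, _⟩ => ⟨f.symm⟩)
      ((hPN e i).residueHom (hΛ e i) (hid e i)) ((hPN e i).residue_surjective (hΛ e i))
      ((hPN e i).residue_smul (hΛ e i))
      (fun j hj g f => (hPN e i).residue_comp_eq_zero (hΛ e i) (hPN e j) (hid e j)
        (fun δ f hf hbij => hj ((hP e).gradedIsoUpToShift (hgr e) (hN e j) (hN e i) hf hbij)) f g)
    rw [hlen] at h3
    exact ⟨W, i1, i2, i3, h1, h2, h3.trans hi, fun r hr =>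
      h4 r ((hPN e i).residue_algebraMap (hΛ e i) hr)⟩
  obtain ⟨h1, h2⟩ := minimal_length_eq (A := k) p hfin (HomogeneousIdeal.irrelevant 𝒜).toIdeal
    (fun e => (D e).minDim) (fun e => frobDegree p e k)
    (fun e => frobDegree_ne_zero p e hk) (fun e V _ _ hV => length_frobTwist_of_field p e hk hV)
    hLB hUB _ rfl
  refine ⟨Eq.trans ?_ h1, Iff.trans ?_ h2⟩
  · refine congrArg (fun s : Set ℕ∞ => ((sInf s : ℕ∞) : ℝ≥0∞)) ?_
    ext n
    refine exists_congr fun W => exists_congr fun _ => exists_congr fun _ => and_congr_right fun _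
        => ?_
    rw [isFiniteDimRep_iff_of_finiteType k]
    refine and_congr_right fun h => ?_
    rw [repFinrank_eq_lengthVia h]
  · rw [Set.eq_empty_iff_forall_notMem]
    constructor
    · rintro h n ⟨W, i1, i2, h3, h4, -⟩
      exact h ⟨W, i1, i2, h3, (isFiniteDimRep_iff_of_finiteType k).2 h4⟩
    · rintro h ⟨W, i1, i2, h3, h4⟩
      exact h _ ⟨W, i1, i2, h3, (isFiniteDimRep_iff_of_finiteType k).1 h4, rfl⟩

end GradedCase

/-! ### The main theorem -/

theorem mainTheorem11 (p : ℕ) [Fact p.Prime] :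
    -- the complete case
    (∀ (R : Type u) [CommRing R] [IsLocalRing R] [IsNoetherianRing R]
        [IsAdicComplete (IsLocalRing.maximalIdeal R) R] [CharP R p]
        [CharP (IsLocalRing.ResidueField R) p],
      (frobenius (IsLocalRing.ResidueField R) p).Finite →
      (∀ e : ℕ, Nonempty (IndecDecomposition R (FrobTwist p e R))) ∧
      ∀ D : ∀ e : ℕ, IndecDecomposition R (FrobTwist p e R),
        ((minRepDimLocal R : ℝ≥0∞) =
          ⨆ e : ℕ, ((D e).minDim : ℝ≥0∞) / (frobDegree p e (IsLocalRing.ResidueField R) : ℝ≥0∞)) ∧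
        (¬ HasFiniteDimRep R ↔
          (⨆ e : ℕ, ((D e).minDim : ℝ≥0∞) /
            (frobDegree p e (IsLocalRing.ResidueField R) : ℝ≥0∞)) = ⊤) ∧
        (PerfectRing (IsLocalRing.ResidueField R) p →
          (minRepDimLocal R = ⨆ e : ℕ, (D e).minDim) ∧
          (¬ HasFiniteDimRep R ↔ (⨆ e : ℕ, (D e).minDim) = ⊤))) ∧
    -- the graded case
    (∀ (k : Type v) (R : Type u) [Field k] [CommRing R] [Nontrivial R] [Algebra k R]
        [CharP k p] [CharP R p] [Algebra.FiniteType k R]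
        (𝒜 : ℕ → Submodule k R) [GradedAlgebra 𝒜],
      (∀ x ∈ 𝒜 0, ∃ c : k, algebraMap k R c = x) →
      (frobenius k p).Finite →
      (∀ e : ℕ, Nonempty (GradedIndecDecomposition (R := R) (frobGrading p e 𝒜))) ∧
      ∀ D : ∀ e : ℕ, GradedIndecDecomposition (R := R) (frobGrading p e 𝒜),
        ((minRepDimOver k R : ℝ≥0∞) =
          ⨆ e : ℕ, ((D e).minDim : ℝ≥0∞) / (frobDegree p e k : ℝ≥0∞)) ∧
        (¬ HasFiniteDimRep R ↔
          (⨆ e : ℕ, ((D e).minDim : ℝ≥0∞) / (frobDegree p e k : ℝ≥0∞)) = ⊤) ∧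
        (PerfectRing k p →
          (minRepDimOver k R = ⨆ e : ℕ, (D e).minDim) ∧
          (¬ HasFiniteDimRep R ↔ (⨆ e : ℕ, (D e).minDim) = ⊤))) := by
  refine ⟨fun R _ _ _ _ _ _ hk => ⟨fun e => ?_, fun D => ?_⟩,
    fun k R _ _ _ _ _ _ _ 𝒜 _ h0 hk =>
      ⟨nonempty_gradedIndecDecomposition_frobTwist p 𝒜 hk, fun D => ?_⟩⟩
  · have := finite_frobTwist_of_isAdicComplete p R e hk
    exact nonempty_indecDecomposition
  · obtain ⟨h1, h2⟩ := repDim_of_complete p hk D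
    exact ⟨h1, h2, fun _ => eq_iSup_of_toENNReal_eq (fun e => frobDegree_of_perfectRing p e _) h1
        h2⟩
  · obtain ⟨h1, h2⟩ := repDim_of_graded p 𝒜 h0 hk D
    exact ⟨h1, h2, fun _ => eq_iSup_of_toENNReal_eq (fun e => frobDegree_of_perfectRing p e _) h1
        h2⟩
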